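/- Let $q=-1$. Let $\mathbb C_q$ be the quantum torus, i.e. the associative complex algebra with basis $x^{m}=x_1^{m_1}x_2^{m_2}$, $m=(m_1,m_2)\in\mathbb Z^2$, and multiplication $x^{m}x^{n}=q^{m_2n_1}x^{m+n}$ (so $x_2x_1=qx_1x_2$). Let $\operatorname{Der}\mathbb C_q$ be the Lie algebra of all $\mathbb C$-linear derivations of the associative algebra $\mathbb C_q$, let $\mathbb C_q'=[\mathbb C_q,\mathbb C_q]$ be the span of all commutators, and let $\partial_1,\partial_2$ be the degree derivations, $\partial_s(x^{m})=m_sx^{m}$. Put $H=\mathbb C\partial_1\oplus\mathbb C\partial_2$ and, for $\partial=a_1\partial_1+a_2\partial_2\in H$ and $\lambda\in\mathbb C^2$, put $\langle\partial,\lambda\rangle=a_1\lambda_1+a_2\lambda_2$. One has $\operatorname{Der}\mathbb C_q=\operatorname{ad}\mathbb C_q'\oplus W$, where $\operatorname{ad}\mathbb C_q'$ has basis $\operatorname{ad}x^{m}$, $m\in\mathbb Z^2\setminus2\mathbb Z^2$, and $W$ is spanned by the $x^{n}\partial$ with $n\in2\mathbb Z^2$, $\partial\in H$ (a rank-2 Witt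 algebra). A $\operatorname{Der}\mathbb C_q$-module $V$ is a module of the intermediate series if $V=\bigoplus_{\lambda\in\mathbb C^2}V_\lambda$ with $V_\lambda=\{v\in V:\partial v=\langle\partial,\lambda\rangle v\ \text{for all}\ \partial\in H\}$ and $\dim V_\lambda\le1$ for all $\lambda$. For $a\in\{0,1\}$, $\alpha\in\mathbb C^2$, $b\in\mathbb C$ let $A_{a,\alpha,b}$ be the $\operatorname{Der}\mathbb C_q$-module with basis $\{v_k: k\in\mathbb Z^2\}$ and action $$(\operatorname{ad}x^{m})v_k=\bigl((-1)^{m_2k_1}-a(-1)^{m_1k_2}\bigr)v_{m+k},\qquad (x^{n}\partial)v_k=\langle\partial,\alpha+k+bn\rangle v_{n+k}$$ for $m\in\mathbb Z^2\setminus2\mathbb Z^2$, $n\in2\mathbb Z^2$, $k\in\mathbb Z^2$, $\partial\in H$, and let $A'_{1,\alpha,b}$ be the submodule of $A_{1,\alpha,b}$ spanned by the $v_k$ with $k\in\mathbb Z^2\setminus2\mathbb Z^2$. **Theorem 2.3.** Every irreducible $\operatorname{Der}\mathbb C_q$-module $V$ of the intermediate series is isomorphic to a sub-quotient of $A_{a,\alpha,b}$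 for some $a\in\{0,1\}$, $\alpha\in\mathbb C^2$, $b\in\mathbb C$. More precisely, $V\cong A_{0,\alpha,b}$ for some $\alpha,b$, or $V\cong A'_{1,\alpha,b}$ for some $\alpha,b$, or $\operatorname{ad}\mathbb C_q'$ acts trivially on $V$ (so that $V$ is simply a module over $W$). -/

import Mathlib

attribute [local instance 100] LieRing.ofAssociativeRing

noncomputable section

/-- The quantum torus `ℂ_q[x₁^±1, x₂^±1]` with `x₂ x₁ = q x₁ x₂`, as the vector space with basis the
monomials `x^m = x₁^m₁ x₂^m₂`, `m ∈ ℤ²`. The multiplication, `x^m x^n = q^(m₂ n₁) x^(m+n)`, is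
defined below. -/
def QTorus (_q : ℂˣ) : Type := ℤ × ℤ →₀ ℂ

namespace QTorus

instance (q : ℂˣ) : AddCommGroup (QTorus q) := inferInstanceAs (AddCommGroup (ℤ × ℤ →₀ ℂ))
instance (q : ℂˣ) : Module ℂ (QTorus q) := inferInstanceAs (Module ℂ (ℤ × ℤ →₀ ℂ))

variable {q : ℂˣ}

/-- The monomial `x^m = x₁^m₁ x₂^m₂`. -/
def mono (q : ℂˣ) (m : ℤ × ℤ) : QTorus q := Finsupp.single m (1 : ℂ)

/-- The coefficient of `x^m`, as a linear functional. -/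
def coef (m : ℤ × ℤ) : QTorus q →ₗ[ℂ] ℂ := Finsupp.lapply m

/-- The linear map sending `x^m` to `f m`. -/
def lift {M : Type*} [AddCommGroup M] [Module ℂ M] (f : ℤ × ℤ → M) : QTorus q →ₗ[ℂ] M :=
  Finsupp.linearCombination ℂ f

@[simp] theorem lift_mono {M : Type*} [AddCommGroup M] [Module ℂ M] (f : ℤ × ℤ → M) (m : ℤ × ℤ) :
    lift f (mono q m) = f m := by
  simp only [lift, mono]
  erw [Finsupp.linearCombination_single]
  simp

theorem hom_ext {M : Type*} [AddCommGroup M] [Module ℂ M] {f g : QTorus q →ₗ[ℂ] M}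
    (h : ∀ m, f (mono q m) = g (mono q m)) : f = g := by
  refine Finsupp.lhom_ext' (M := ℂ) fun m => LinearMap.ext_ring ?_
  exact h m

@[ext] theorem ext {x y : QTorus q} (h : ∀ m, coef m x = coef m y) : x = y :=
  Finsupp.ext h

theorem coef_mono (m n : ℤ × ℤ) : coef m (mono q n) = if n = m then 1 else 0 := by
  classical
  exact Finsupp.single_apply

/-- The bilinear multiplication `x^m x^n = q^(m₂ n₁) x^(m+n)`. -/
def mulHom (q : ℂˣ) : QTorus q →ₗ[ℂ] QTorus q →ₗ[ℂ] QTorus q :=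
  lift fun m => lift fun n => ((q ^ (m.2 * n.1) : ℂˣ) : ℂ) • mono q (m + n)

instance : Mul (QTorus q) := ⟨fun x y => mulHom q x y⟩
instance : One (QTorus q) := ⟨mono q 0⟩

theorem mul_def (x y : QTorus q) : x * y = mulHom q x y := rfl
theorem one_def : (1 : QTorus q) = mono q 0 := rfl

theorem mono_mul_mono (m n : ℤ × ℤ) :
    mono q m * mono q n = ((q ^ (m.2 * n.1) : ℂˣ) : ℂ) • mono q (m + n) := by
  simp [mul_def, mulHom]

theorem induct {p : QTorus q → Prop} (x : QTorus q) (h0 : p 0)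
    (hadd : ∀ x y, p x → p y → p (x + y)) (hmono : ∀ (c : ℂ) m, p (c • mono q m)) : p x := by
  refine Finsupp.induction_linear (motive := p) x h0 (fun f g hf hg => hadd f g hf hg) ?_
  intro m c
  have h : (Finsupp.single m c : ℤ × ℤ →₀ ℂ) = c • Finsupp.single m (1 : ℂ) := by simp
  rw [h]
  exact hmono c m

theorem mulHom_assoc (x y z : QTorus q) :
    mulHom q (mulHom q x y) z = mulHom q x (mulHom q y z) := by
  induction x using induct with
  | h0 => simp
  | hadd x x' hx hx' => simp [hx, hx']
  | hmono a l =>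
    induction y using induct with
    | h0 => simp
    | hadd y y' hy hy' => simp only [map_add, LinearMap.add_apply, hy, hy']
    | hmono b m =>
      induction z using induct with
      | h0 => simp
      | hadd z z' hz hz' => simp only [map_add, hz, hz']
      | hmono c n =>
        simp only [map_smul, LinearMap.smul_apply, mulHom, lift_mono, smul_smul, add_assoc]
        congr 1
        have e : (l + m).2 * n.1 = l.2 * n.1 + m.2 * n.1 := by simp [add_mul]
        have e' : l.2 * (m + n).1 = l.2 * m.1 + l.2 * n.1 := by simp [mul_add]
        rw [e, e', zpow_add, zpow_add]
        push_cast
        ring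

instance : Ring (QTorus q) :=
  { (inferInstance : AddCommGroup (QTorus q)) with
    mul := (· * ·)
    one := 1
    left_distrib := fun x y z => by simp [mul_def]
    right_distrib := fun x y z => by simp [mul_def]
    zero_mul := fun x => by simp [mul_def]
    mul_zero := fun x => by simp [mul_def]
    mul_assoc := fun x y z => mulHom_assoc x y z
    one_mul := fun x => by
      have h : mulHom q (mono q 0) = LinearMap.id := hom_ext fun m => by simp [mulHom]
      simp [mul_def, one_def, h]
    mul_one := fun x => by
      have h : (mulHom q).flip (mono q 0) = LinearMap.id := hom_ext fun m => by simp [mulHom]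
      exact congrArg (fun f => f x) h }

instance : Algebra ℂ (QTorus q) :=
  Algebra.ofModule (fun r x y => by simp [mul_def]) (fun r x y => by simp [mul_def])

end QTorus
/-- The Lie algebra of derivations of an associative, not necessarily commutative, algebra. -/
def derivationAlgebra (A : Type*) [Ring A] [Algebra ℂ A] : LieSubalgebra ℂ (Module.End ℂ A) where
  carrier := {d | ∀ x y, d (x * y) = d x * y + x * d y}
  add_mem' := by
    intro d d' hd hd' x y
    simp only [LinearMap.add_apply, hd x y, hd' x y]
    noncomm_ring
  zero_mem' := by intro x y; simp
  smul_mem' := by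
    intro c d hd x y
    simp only [LinearMap.smul_apply, hd x y, smul_add, smul_mul_assoc, mul_smul_comm]
  lie_mem' := by
    intro d d' hd hd' x y
    have hd : ∀ x y, d (x * y) = d x * y + x * d y := hd
    have hd' : ∀ x y, d' (x * y) = d' x * y + x * d' y := hd'
    simp only [LieRing.of_associative_ring_bracket, LinearMap.sub_apply, Module.End.mul_apply, hd, hd',
      map_add]
    noncomm_ring


section Generic

variable {A : Type*} [Ring A] [Algebra ℂ A]

theorem derivation_mul (d : derivationAlgebra A) (x y : A) :
    d.1 (x * y) = d.1 x * y + x * d.1 y := d.2 x y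

/-- The inner derivation `ad u`. -/
def innerDer : A →ₗ[ℂ] derivationAlgebra A where
  toFun u := ⟨LinearMap.mulLeft ℂ u - LinearMap.mulRight ℂ u, by
    intro x y
    simp only [LinearMap.sub_apply, LinearMap.mulLeft_apply, LinearMap.mulRight_apply]
    noncomm_ring⟩
  map_add' u v := by
    apply Subtype.ext
    ext x
    simp [add_mul, mul_add]
    abel
  map_smul' c u := by
    apply Subtype.ext
    ext x
    simp [smul_sub]

theorem innerDer_apply (u x : A) : (innerDer u).1 x = u * x - x * u := rfl

theorem center_comm {z : A} (hz : z ∈ Subalgebra.center ℂ A) (x : A) : z * x = x * z :=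
  (Subalgebra.mem_center_iff.mp hz x).symm

/-- The derivation `z d`, for `z` in the center and `d` a derivation. -/
def centralSMul (d : derivationAlgebra A) :
    Subalgebra.center ℂ A →ₗ[ℂ] derivationAlgebra A where
  toFun z := ⟨LinearMap.mulLeft ℂ (z : A) ∘ₗ d.1, by
    intro x y
    simp only [LinearMap.comp_apply, LinearMap.mulLeft_apply, derivation_mul, mul_add]
    rw [← mul_assoc, ← mul_assoc, center_comm z.2 x, mul_assoc x]⟩
  map_add' u v := by
    apply Subtype.ext
    ext x
    simp [add_mul]
  map_smul' c u := by
    apply Subtype.ext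
    ext x
    simp

theorem centralSMul_apply (d : derivationAlgebra A) (z : Subalgebra.center ℂ A) (x : A) :
    (centralSMul d z).1 x = z * d.1 x := rfl

/-- The derived algebra `[A, A]` of `A` with its commutator bracket: the span of all commutators. -/
def commutatorSpan (A : Type*) [Ring A] [Algebra ℂ A] : Submodule ℂ A :=
  Submodule.span ℂ {w | ∃ x y : A, w = x * y - y * x}

theorem commutator_mem (x y : A) : x * y - y * x ∈ commutatorSpan A :=
  Submodule.subset_span ⟨x, y, rfl⟩

theorem derivation_commutatorSpan (d : derivationAlgebra A) {u : A} (hu : u ∈ commutatorSpan A) :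
    d.1 u ∈ commutatorSpan A := by
  induction hu using Submodule.span_induction with
  | mem w hw =>
    obtain ⟨x, y, rfl⟩ := hw
    have e : d.1 (x * y - y * x) = (d.1 x * y - y * d.1 x) + (x * d.1 y - d.1 y * x) := by
      rw [map_sub, derivation_mul, derivation_mul]; abel
    rw [e]
    exact add_mem (commutator_mem _ _) (commutator_mem _ _)
  | zero => simp
  | add x y _ _ hx hy => rw [map_add]; exact add_mem hx hy
  | smul c x _ hx => rw [map_smul]; exact Submodule.smul_mem _ _ hx

theorem derivation_center (d : derivationAlgebra A) {z : A} (hz : z ∈ Subalgebra.center ℂ A) :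
    d.1 z ∈ Subalgebra.center ℂ A := by
  rw [Subalgebra.mem_center_iff]
  intro x
  have h := congrArg d.1 (center_comm hz x)
  rw [derivation_mul, derivation_mul, center_comm hz (d.1 x), add_comm] at h
  exact (add_left_cancel h).symm

end Generic

/-- The bilinear form `⟨∂, lam⟩ = a₁ lam₁ + a₂ lam₂` for `∂ = a₁ ∂₁ + a₂ ∂₂`. -/
def pairing (a lam : ℂ × ℂ) : ℂ := a.1 * lam.1 + a.2 * lam.2

/-- The inclusion of `ℤ²` in `ℂ²`. -/
def toC (m : ℤ × ℤ) : ℂ × ℂ := ((m.1 : ℂ), (m.2 : ℂ))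

namespace QTorus

variable {q : ℂˣ}

/-- The degree derivation `∂ = a₁ ∂₁ + a₂ ∂₂`, given by `∂ (x^m) = ⟨∂, m⟩ x^m`. -/
def degDer (q : ℂˣ) (a : ℂ × ℂ) : derivationAlgebra (QTorus q) :=
  ⟨lift fun m => pairing a (toC m) • mono q m, by
    intro x y
    induction x using induct with
    | h0 => simp
    | hadd x x' hx hx' => simp only [add_mul, map_add, hx, hx']; abel
    | hmono c m =>
      induction y using induct with
      | h0 => simp
      | hadd y y' hy hy' => simp only [mul_add, map_add, hy, hy']; abel
      | hmono c' n =>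
        simp only [smul_mul_assoc, mul_smul_comm, map_smul, mono_mul_mono, lift_mono, smul_smul,
          ← add_smul]
        congr 1
        simp [pairing, toC]
        ring⟩

theorem degDer_mono (a : ℂ × ℂ) (m : ℤ × ℤ) :
    (degDer q a).1 (mono q m) = pairing a (toC m) • mono q m := by
  simp [degDer]

theorem coef_degDer (a : ℂ × ℂ) (m : ℤ × ℤ) (x : QTorus q) :
    coef m ((degDer q a).1 x) = pairing a (toC m) * coef m x := by
  induction x using induct with
  | h0 => simp
  | hadd x y hx hy => simp only [map_add, hx, hy, mul_add]
  | hmono c n =>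
    simp only [map_smul, degDer_mono, coef_mono, smul_eq_mul]
    split_ifs with h
    · subst h; ring
    · ring

theorem degDer_comm (a b : ℂ × ℂ) (x : QTorus q) :
    (degDer q a).1 ((degDer q b).1 x) = (degDer q b).1 ((degDer q a).1 x) := by
  ext m
  simp only [coef_degDer]
  ring

theorem coef_mono_mul (m k : ℤ × ℤ) (x : QTorus q) :
    coef k (mono q m * x) = ((q ^ (m.2 * (k - m).1) : ℂˣ) : ℂ) * coef (k - m) x := by
  induction x using induct with
  | h0 => simp
  | hadd x y hx hy => simp only [mul_add, map_add, hx, hy]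
  | hmono c n =>
    simp only [mul_smul_comm, map_smul, mono_mul_mono, coef_mono, smul_eq_mul]
    by_cases h : n = k - m
    · subst h; simp; ring
    · rw [if_neg h, if_neg (fun e => h (by rw [← e]; abel))]; simp

theorem coef_mul_mono (m k : ℤ × ℤ) (x : QTorus q) :
    coef k (x * mono q m) = ((q ^ ((k - m).2 * m.1) : ℂˣ) : ℂ) * coef (k - m) x := by
  induction x using induct with
  | h0 => simp
  | hadd x y hx hy => simp only [add_mul, map_add, hx, hy, mul_add]
  | hmono c n =>
    simp only [smul_mul_assoc, map_smul, mono_mul_mono, coef_mono, smul_eq_mul]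
    by_cases h : n = k - m
    · subst h; simp; ring
    · rw [if_neg h, if_neg (fun e => h (by rw [← e]; abel))]; simp

/-- The linear map `(u, z₁, z₂) ↦ ad u + z₁ ∂₁ + z₂ ∂₂`, for `u` in the derived algebra and
`z₁`, `z₂` in the center. -/
def decompMap (q : ℂˣ) :
    (commutatorSpan (QTorus q) × Subalgebra.center ℂ (QTorus q) × Subalgebra.center ℂ (QTorus q))
      →ₗ[ℂ] derivationAlgebra (QTorus q) :=
  (innerDer ∘ₗ (commutatorSpan (QTorus q)).subtype).coprod
    ((centralSMul (degDer q (1, 0))).coprod (centralSMul (degDer q (0, 1))))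

theorem decompMap_apply (u : commutatorSpan (QTorus q)) (z₁ z₂ : Subalgebra.center ℂ (QTorus q))
    (x : QTorus q) :
    (decompMap q (u, z₁, z₂)).1 x = (u * x - x * u) +
      (z₁ * (degDer q (1, 0)).1 x + z₂ * (degDer q (0, 1)).1 x) := rfl

/-- The operator by which `ad u + z₁ ∂₁ + z₂ ∂₂` acts. For `z₁ = z₂ = 0` it is
`y ↦ u y - a y u`, and `z ∂` acts by `y ↦ z ∂ y + ⟨∂, α⟩ z y + b ∂(z) y`. -/
def actionMap (q : ℂˣ) (a : ℂ) (α : ℂ × ℂ) (b : ℂ) :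
    (commutatorSpan (QTorus q) × Subalgebra.center ℂ (QTorus q) × Subalgebra.center ℂ (QTorus q))
      →ₗ[ℂ] QTorus q →ₗ[ℂ] QTorus q :=
  LinearMap.mk₂ ℂ (fun p y =>
    ((p.1 : QTorus q) * y - a • (y * (p.1 : QTorus q))) +
    ((p.2.1 : QTorus q) * (degDer q (1, 0)).1 y + (p.2.2 : QTorus q) * (degDer q (0, 1)).1 y) +
    (α.1 • (p.2.1 : QTorus q) + α.2 • (p.2.2 : QTorus q) +
      b • ((degDer q (1, 0)).1 p.2.1 + (degDer q (0, 1)).1 p.2.2)) * y)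
    (by intro p p' y
        simp only [Prod.fst_add, Prod.snd_add, Submodule.coe_add, Subalgebra.coe_add, map_add,
          smul_add, add_mul, mul_add]
        abel)
    (by intro c p y
        simp only [Prod.smul_fst, Prod.smul_snd, Submodule.coe_smul, Subalgebra.coe_smul, map_smul,
          smul_mul_assoc, mul_smul_comm, ← smul_add, smul_comm _ c, ← smul_sub])
    (by intro p y y'
        simp only [map_add, smul_add, add_mul, mul_add]
        abel)
    (by intro c p y
        simp only [map_smul,
          smul_mul_assoc, mul_smul_comm, ← smul_add, smul_comm _ c, ← smul_sub])

theorem action_bracket (a : ℂ) (ha : a * a = a) (α : ℂ × ℂ) (b : ℂ)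
    (p p' : commutatorSpan (QTorus q) × Subalgebra.center ℂ (QTorus q) ×
      Subalgebra.center ℂ (QTorus q)) :
    ∃ r, decompMap q r = ⁅decompMap q p, decompMap q p'⁆ ∧
      ∀ y, actionMap q a α b r y = actionMap q a α b p (actionMap q a α b p' y) -
        actionMap q a α b p' (actionMap q a α b p y) := by
  obtain ⟨⟨u, hu⟩, ⟨z₁, h₁⟩, ⟨z₂, h₂⟩⟩ := p
  obtain ⟨⟨u', hu'⟩, ⟨z₁', h₁'⟩, ⟨z₂', h₂'⟩⟩ := p'
  obtain ⟨d₁, hd₁⟩ : ∃ d, d = degDer q (1, 0) := ⟨_, rfl⟩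
  obtain ⟨d₂, hd₂⟩ : ∃ d, d = degDer q (0, 1) := ⟨_, rfl⟩
  have hcomm : ∀ x, d₁.1 (d₂.1 x) = d₂.1 (d₁.1 x) := by
    intro x; rw [hd₁, hd₂, degDer_comm]
  obtain ⟨w, hw⟩ : ∃ w, w = centralSMul d₁ ⟨z₁, h₁⟩ + centralSMul d₂ ⟨z₂, h₂⟩ := ⟨_, rfl⟩
  obtain ⟨w', hw'⟩ : ∃ w, w = centralSMul d₁ ⟨z₁', h₁'⟩ + centralSMul d₂ ⟨z₂', h₂'⟩ := ⟨_, rfl⟩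
  have hwa : ∀ x, w.1 x = z₁ * d₁.1 x + z₂ * d₂.1 x := by intro x; rw [hw]; rfl
  have hwa' : ∀ x, w'.1 x = z₁' * d₁.1 x + z₂' * d₂.1 x := by intro x; rw [hw']; rfl
  have hww : ∀ x, w.1 (w'.1 x) - w'.1 (w.1 x) =
      (w.1 z₁' - w'.1 z₁) * d₁.1 x + (w.1 z₂' - w'.1 z₂) * d₂.1 x := by
    intro x
    rw [hwa' x, hwa x]
    simp only [map_add, derivation_mul]
    rw [hwa (d₁.1 x), hwa (d₂.1 x), hwa' (d₁.1 x), hwa' (d₂.1 x), hcomm]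
    simp only [mul_add, sub_mul]
    have e : ∀ (z z' t : QTorus q), z ∈ Subalgebra.center ℂ (QTorus q) →
        z' * (z * t) = z * (z' * t) := by
      intro z z' t hz
      rw [← mul_assoc, ← center_comm hz, mul_assoc]
    rw [e z₁ z₁' _ h₁, e z₂ z₁' _ h₂, e z₁ z₂' _ h₁, e z₂ z₂' _ h₂]
    abel
  -- the new central element
  obtain ⟨t, ht⟩ : ∃ t, t = α.1 • z₁ + α.2 • z₂ + b • (d₁.1 z₁ + d₂.1 z₂) := ⟨_, rfl⟩
  obtain ⟨t', ht'⟩ : ∃ t, t = α.1 • z₁' + α.2 • z₂' + b • (d₁.1 z₁' + d₂.1 z₂') := ⟨_, rfl⟩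
  have htc : t ∈ Subalgebra.center ℂ (QTorus q) := by
    rw [ht]
    exact add_mem (add_mem (Subalgebra.smul_mem _ h₁ _) (Subalgebra.smul_mem _ h₂ _))
      (Subalgebra.smul_mem _ (add_mem (derivation_center _ h₁) (derivation_center _ h₂)) _)
  have htc' : t' ∈ Subalgebra.center ℂ (QTorus q) := by
    rw [ht']
    exact add_mem (add_mem (Subalgebra.smul_mem _ h₁' _) (Subalgebra.smul_mem _ h₂' _))
      (Subalgebra.smul_mem _ (add_mem (derivation_center _ h₁') (derivation_center _ h₂')) _)
  have hdiv : d₁.1 (w.1 z₁' - w'.1 z₁) + d₂.1 (w.1 z₂' - w'.1 z₂) =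
      w.1 (d₁.1 z₁' + d₂.1 z₂') - w'.1 (d₁.1 z₁ + d₂.1 z₂) := by
    simp only [hwa, hwa', map_add, map_sub, derivation_mul, hcomm]
    rw [center_comm (derivation_center d₁ h₁') (d₁.1 z₁),
      center_comm (derivation_center d₁ h₂') (d₂.1 z₁),
      center_comm (derivation_center d₂ h₁') (d₁.1 z₂),
      center_comm (derivation_center d₂ h₂') (d₂.1 z₂)]
    simp only [mul_add]
    abel
  have htt : α.1 • (w.1 z₁' - w'.1 z₁) + α.2 • (w.1 z₂' - w'.1 z₂) +
      b • (d₁.1 (w.1 z₁' - w'.1 z₁) + d₂.1 (w.1 z₂' - w'.1 z₂)) = w.1 t' - w'.1 t := by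
    rw [hdiv, ht, ht']
    simp only [map_add, map_smul, smul_add, smul_sub]
    abel
  have hA : ∀ y, actionMap q a α b (⟨u, hu⟩, ⟨z₁, h₁⟩, ⟨z₂, h₂⟩) y =
      (u * y - a • (y * u)) + w.1 y + t * y := by
    intro y; rw [hwa, ht, hd₁, hd₂]; rfl
  have hA' : ∀ y, actionMap q a α b (⟨u', hu'⟩, ⟨z₁', h₁'⟩, ⟨z₂', h₂'⟩) y =
      (u' * y - a • (y * u')) + w'.1 y + t' * y := by
    intro y; rw [hwa', ht', hd₁, hd₂]; rfl
  have hD : ∀ y, (decompMap q (⟨u, hu⟩, ⟨z₁, h₁⟩, ⟨z₂, h₂⟩)).1 y = (u * y - y * u) + w.1 y := by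
    intro y; rw [hwa, hd₁, hd₂]; rfl
  have hD' : ∀ y, (decompMap q (⟨u', hu'⟩, ⟨z₁', h₁'⟩, ⟨z₂', h₂'⟩)).1 y =
      (u' * y - y * u') + w'.1 y := by
    intro y; rw [hwa', hd₁, hd₂]; rfl
  refine ⟨(⟨(u * u' - u' * u) + (w.1 u' - w'.1 u), add_mem (commutator_mem _ _)
      (sub_mem (derivation_commutatorSpan w hu') (derivation_commutatorSpan w' hu))⟩,
    ⟨w.1 z₁' - w'.1 z₁, sub_mem (derivation_center w h₁') (derivation_center w' h₁)⟩,
    ⟨w.1 z₂' - w'.1 z₂, sub_mem (derivation_center w h₂') (derivation_center w' h₂)⟩), ?_, ?_⟩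
  · apply Subtype.ext
    apply LinearMap.ext
    intro y
    have e : (⁅decompMap q (⟨u, hu⟩, ⟨z₁, h₁⟩, ⟨z₂, h₂⟩),
        decompMap q (⟨u', hu'⟩, ⟨z₁', h₁'⟩, ⟨z₂', h₂'⟩)⁆ : derivationAlgebra (QTorus q)).1 y =
        (decompMap q (⟨u, hu⟩, ⟨z₁, h₁⟩, ⟨z₂, h₂⟩)).1
          ((decompMap q (⟨u', hu'⟩, ⟨z₁', h₁'⟩, ⟨z₂', h₂'⟩)).1 y) -
        (decompMap q (⟨u', hu'⟩, ⟨z₁', h₁'⟩, ⟨z₂', h₂'⟩)).1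
          ((decompMap q (⟨u, hu⟩, ⟨z₁, h₁⟩, ⟨z₂, h₂⟩)).1 y) := rfl
    rw [e, hD, hD', hD, hD', decompMap_apply, ← hd₁, ← hd₂, ← hww]
    simp only [map_add, map_sub, derivation_mul]
    noncomm_ring
  · intro y
    have hl : ∀ (r₁ : commutatorSpan (QTorus q)) (r₂ r₃ : Subalgebra.center ℂ (QTorus q)),
        actionMap q a α b (r₁, r₂, r₃) y = ((r₁ : QTorus q) * y - a • (y * (r₁ : QTorus q))) +
          (r₂ * d₁.1 y + r₃ * d₂.1 y) +
          (α.1 • (r₂ : QTorus q) + α.2 • (r₃ : QTorus q) + b • (d₁.1 r₂ + d₂.1 r₃)) * y := by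
      intro r₁ r₂ r₃; rw [hd₁, hd₂]; rfl
    rw [hl, htt, ← hww, hA, hA', hA, hA']
    simp only [map_add, map_sub, map_smul, derivation_mul, mul_add, add_mul, mul_sub, sub_mul,
      smul_add, smul_sub, smul_mul_assoc, mul_smul_comm, smul_smul, ha]
    have c1 : u * (t' * y) = t' * (u * y) := by rw [← mul_assoc, ← center_comm htc', mul_assoc]
    have c2 : u' * (t * y) = t * (u' * y) := by rw [← mul_assoc, ← center_comm htc, mul_assoc]
    have c3 : t * (t' * y) = t' * (t * y) := by rw [← mul_assoc, center_comm htc, mul_assoc]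
    simp only [mul_assoc, c1, c2, c3]
    abel

/-- Membership in `2ℤ²`. -/
def InTwo (m : ℤ × ℤ) : Prop := Even m.1 ∧ Even m.2

theorem neg_one_zpow (k : ℤ) :
    (((-1 : ℂˣ) ^ k : ℂˣ) : ℂ) = (-1 : ℂ) ^ k := by simp

theorem neg_one_zpow_even {k : ℤ} (h : Even k) : (((-1 : ℂˣ) ^ k : ℂˣ) : ℂ) = 1 := by
  simp [h.neg_one_zpow]

theorem neg_one_zpow_odd {k : ℤ} (h : ¬ Even k) : (((-1 : ℂˣ) ^ k : ℂˣ) : ℂ) = -1 := by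
  simp [(Int.not_even_iff_odd.mp h).neg_one_zpow]

theorem mono_mem_center {m : ℤ × ℤ} (hm : InTwo m) :
    mono (-1) m ∈ Subalgebra.center ℂ (QTorus (-1)) := by
  rw [Subalgebra.mem_center_iff]
  intro x
  ext k
  rw [coef_mul_mono, coef_mono_mul, neg_one_zpow_even (hm.1.mul_left _),
    neg_one_zpow_even (hm.2.mul_right _)]

theorem coef_center {z : QTorus (-1)} (hz : z ∈ Subalgebra.center ℂ (QTorus (-1)))
    {m : ℤ × ℤ} (hm : ¬ InTwo m) : coef m z = 0 := by
  have h1 := congrArg (coef (m + (1, 0))) (center_comm hz (mono (-1) (1, 0)))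
  have h2 := congrArg (coef (m + (0, 1))) (center_comm hz (mono (-1) (0, 1)))
  rw [coef_mul_mono, coef_mono_mul] at h1 h2
  simp only [add_sub_cancel_right, mul_one, zero_mul, mul_zero, one_mul, zpow_zero,
    Units.val_one] at h1 h2
  by_cases h : Even m.2
  · have h' : ¬ Even m.1 := fun e => hm ⟨e, h⟩
    rw [neg_one_zpow_odd h'] at h2
    linear_combination (1 / 2 : ℂ) * h2
  · rw [neg_one_zpow_odd h] at h1
    linear_combination -(1 / 2 : ℂ) * h1

theorem coef_commutatorSpan {u : QTorus (-1)} (hu : u ∈ commutatorSpan (QTorus (-1)))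
    {m : ℤ × ℤ} (hm : InTwo m) : coef m u = 0 := by
  induction hu using Submodule.span_induction with
  | zero => simp
  | add x y _ _ hx hy => simp [hx, hy]
  | smul c x _ hx => simp [hx]
  | mem w hw =>
    obtain ⟨x, y, rfl⟩ := hw
    rw [map_sub, sub_eq_zero]
    induction x using induct with
    | h0 => simp
    | hadd x x' hx hx' => simp only [add_mul, mul_add, map_add, hx, hx']
    | hmono c k =>
      rw [smul_mul_assoc, mul_smul_comm, map_smul, map_smul, coef_mono_mul, coef_mul_mono]
      congr 2
      obtain ⟨⟨i, hi⟩, ⟨j, hj⟩⟩ := hm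
      have e : k.2 * (m - k).1 = (m - k).2 * k.1 + (2 * (k.2 * i - j * k.1)) := by
        simp only [Prod.fst_sub, Prod.snd_sub, hi, hj]; ring
      have e2 : ((-1 : ℂˣ) ^ (2 * (k.2 * i - j * k.1))) = 1 := (even_two_mul _).neg_one_zpow
      rw [e, zpow_add, e2, mul_one]

theorem mono_mem_commutatorSpan {m : ℤ × ℤ} (hm : ¬ InTwo m) :
    mono (-1) m ∈ commutatorSpan (QTorus (-1)) := by
  by_cases h : Even m.2
  · have h' : ¬ Even m.1 := fun e => hm ⟨e, h⟩
    have e : mono (-1) m = (1 / 2 : ℂ) • (mono (-1) (m - (0, 1)) * mono (-1) (0, 1) -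
        mono (-1) (0, 1) * mono (-1) (m - (0, 1))) := by
      rw [mono_mul_mono, mono_mul_mono]
      simp only [sub_add_cancel, add_sub_cancel, Prod.fst_sub, one_mul, sub_zero]
      rw [neg_one_zpow_odd h', ← sub_smul, smul_smul]
      norm_num
    rw [e]
    exact Submodule.smul_mem _ _ (commutator_mem _ _)
  · have e : mono (-1) m = (1 / 2 : ℂ) • (mono (-1) (1, 0) * mono (-1) (m - (1, 0)) -
        mono (-1) (m - (1, 0)) * mono (-1) (1, 0)) := by
      rw [mono_mul_mono, mono_mul_mono]
      simp only [sub_add_cancel, add_sub_cancel, Prod.snd_sub, mul_one, sub_zero]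
      rw [neg_one_zpow_odd h, ← sub_smul, smul_smul]
      norm_num
    rw [e]
    exact Submodule.smul_mem _ _ (commutator_mem _ _)

theorem mem_of_forall_coef {S : Submodule ℂ (QTorus q)} (x : QTorus q)
    (h : ∀ m, coef m x ≠ 0 → mono q m ∈ S) : x ∈ S := by
  have e : x = ∑ m ∈ Finsupp.support (M := ℂ) x, coef m x • mono q m := by
    have h1 := (Finsupp.sum_single (M := ℂ) x).symm
    refine h1.trans (Finset.sum_congr rfl fun m _ => ?_)
    change Finsupp.single m (coef m x) = (coef m x) • Finsupp.single m (1 : ℂ)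
    simp
  rw [e]
  exact Submodule.sum_mem _ fun m hm => Submodule.smul_mem _ _ (h m (Finsupp.mem_support_iff.mp hm))

/-- The element with coefficients `f`, where `f` has finite support. -/
theorem exists_coef (f : ℤ × ℤ → ℂ) (hf : f.support.Finite) :
    ∃ x : QTorus q, ∀ m, coef m x = f m :=
  ⟨Finsupp.ofSupportFinite f hf, fun _ => rfl⟩

theorem coef_decomp {u z₁ z₂ : QTorus (-1)} (hu : u ∈ commutatorSpan (QTorus (-1)))
    (h₁ : z₁ ∈ Subalgebra.center ℂ (QTorus (-1))) (h₂ : z₂ ∈ Subalgebra.center ℂ (QTorus (-1)))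
    (m s : ℤ × ℤ) :
    coef (s + m) ((decompMap (-1) (⟨u, hu⟩, ⟨z₁, h₁⟩, ⟨z₂, h₂⟩)).1 (mono (-1) m)) =
      ((-1 : ℂ) ^ (s.2 * m.1) - (-1 : ℂ) ^ (m.2 * s.1)) * coef s u +
        (m.1 * coef s z₁ + m.2 * coef s z₂) := by
  rw [decompMap_apply, degDer_mono, degDer_mono]
  simp only [map_add, map_sub, mul_smul_comm, map_smul, coef_mul_mono, coef_mono_mul,
    add_sub_cancel_right, neg_one_zpow]
  by_cases hs : InTwo s
  · rw [(hs.2.mul_right m.1).neg_one_zpow, (hs.1.mul_left m.2).neg_one_zpow]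
    simp [pairing, toC]
  · simp [coef_center h₁ hs, coef_center h₂ hs]
    ring

theorem decomp_injective : Function.Injective (decompMap (-1)) := by
  rw [injective_iff_map_eq_zero]
  rintro ⟨⟨u, hu⟩, ⟨z₁, h₁⟩, ⟨z₂, h₂⟩⟩ h
  have key := coef_decomp hu h₁ h₂
  rw [h] at key
  have k1 := key (1, 0)
  have k2 := key (0, 1)
  simp only [ZeroMemClass.coe_zero, LinearMap.zero_apply, map_zero, mul_one, mul_zero, zero_mul,
    one_mul, zpow_zero, Int.cast_one, Int.cast_zero, add_zero, zero_add] at k1 k2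
  have hz : ∀ s, coef s z₁ = 0 ∧ coef s z₂ = 0 ∧ coef s u = 0 := by
    intro s
    by_cases hs : InTwo s
    · have hus := coef_commutatorSpan hu hs
      have k1 := k1 s
      have k2 := k2 s
      rw [hus] at k1 k2
      exact ⟨by linear_combination -k1, by linear_combination -k2, hus⟩
    · have c1 := coef_center h₁ hs
      have c2 := coef_center h₂ hs
      refine ⟨c1, c2, ?_⟩
      have k1 := k1 s
      have k2 := k2 s
      rw [c1] at k1
      rw [c2] at k2
      by_cases h : Even s.2
      · have h' : ¬ Even s.1 := fun e => hs ⟨e, h⟩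
        rw [(Int.not_even_iff_odd.mp h').neg_one_zpow] at k2
        linear_combination -(1 / 2 : ℂ) * k2
      · rw [(Int.not_even_iff_odd.mp h).neg_one_zpow] at k1
        linear_combination (1 / 2 : ℂ) * k1
  have e0 : u = 0 := by ext s; simpa using (hz s).2.2
  have e1 : z₁ = 0 := by ext s; simpa using (hz s).1
  have e2 : z₂ = 0 := by ext s; simpa using (hz s).2.1
  subst e0 e1 e2
  rfl

theorem decomp_surjective : Function.Surjective (decompMap (-1)) := by
  intro d
  obtain ⟨D, hD⟩ : ∃ D : ℤ × ℤ → ℤ × ℤ → ℂ, ∀ s m, D s m = coef (s + m) (d.1 (mono (-1) m)) :=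
    ⟨fun s m => coef (s + m) (d.1 (mono (-1) m)), fun _ _ => rfl⟩
  have fin : ∀ m, (fun s => D s m).support.Finite := by
    intro m
    have h : (Function.support fun k => coef k (d.1 (mono (-1) m))).Finite :=
      (Finsupp.hasFiniteSupport (M := ℂ) (d.1 (mono (-1) m)))
    refine (h.preimage (f := fun s => s + m) (add_left_injective m).injOn).subset ?_
    intro s hs
    simpa [hD] using hs
  have addD : ∀ s m n, (-1 : ℂ) ^ (m.2 * n.1) * D s (m + n) =
      (-1 : ℂ) ^ ((s.2 + m.2) * n.1) * D s m + (-1 : ℂ) ^ (m.2 * (s.1 + n.1)) * D s n := by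
    intro s m n
    have h := congrArg (coef (s + (m + n))) (derivation_mul d (mono (-1) m) (mono (-1) n))
    rw [mono_mul_mono, map_smul, map_smul, map_add, coef_mul_mono, coef_mono_mul] at h
    rw [hD, hD, hD]
    have e1 : s + (m + n) - n = s + m := by abel
    have e2 : s + (m + n) - m = s + n := by abel
    rw [e1, e2] at h
    simpa only [neg_one_zpow, smul_eq_mul, Prod.snd_add, Prod.fst_add] using h
  have addD' : ∀ s m n, D s (m + n) =
      (-1 : ℂ) ^ (s.2 * n.1) * D s m + (-1 : ℂ) ^ (m.2 * s.1) * D s n := by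
    intro s m n
    have h := addD s m n
    have h0 : (-1 : ℂ) ^ (m.2 * n.1) ≠ 0 := zpow_ne_zero _ (by norm_num)
    apply mul_left_cancel₀ h0
    rw [h, add_mul, mul_add m.2, zpow_add₀ (by norm_num), zpow_add₀ (by norm_num)]
    ring
  have hev : ∀ s m, InTwo s → D s m = m.1 * D s (1, 0) + m.2 * D s (0, 1) := by
    intro s m hs
    have h1 : ∀ m n, D s (m + n) = D s m + D s n := by
      intro m n
      rw [addD' s m n, (hs.2.mul_right n.1).neg_one_zpow, (hs.1.mul_left m.2).neg_one_zpow,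
        one_mul, one_mul]
    let F : ℤ × ℤ →+ ℂ := AddMonoidHom.mk' (D s) h1
    have e : m = m.1 • ((1, 0) : ℤ × ℤ) + m.2 • ((0, 1) : ℤ × ℤ) := by
      ext <;> simp
    have h2 : F m = m.1 • F (1, 0) + m.2 • F (0, 1) := by
      conv_lhs => rw [e]
      rw [map_add, map_zsmul, map_zsmul]
    simpa [F] using h2
  have hodd : ∀ s m n, D s m * ((-1 : ℂ) ^ (s.2 * n.1) - (-1 : ℂ) ^ (n.2 * s.1)) =
      D s n * ((-1 : ℂ) ^ (s.2 * m.1) - (-1 : ℂ) ^ (m.2 * s.1)) := by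
    intro s m n
    have h1 := addD' s m n
    have h2 := addD' s n m
    rw [add_comm n m] at h2
    linear_combination h2 - h1
  classical
  obtain ⟨u, hu⟩ : ∃ u : QTorus (-1), ∀ s, coef s u =
      if InTwo s then 0 else if Even s.2 then (1 / 2) * D s (0, 1) else -(1 / 2) * D s (1, 0) := by
    apply exists_coef
    refine ((fin (0, 1)).union (fin (1, 0))).subset ?_
    intro s hs
    by_contra hn
    simp only [Set.mem_union, Function.mem_support, not_or, not_not] at hn
    apply hs
    simp [hn.1, hn.2]
  have hz : ∀ e, ∃ z : QTorus (-1), ∀ s, coef s z = if InTwo s then D s e else 0 := by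
    intro e
    apply exists_coef
    refine (fin e).subset ?_
    intro s hs hn
    apply hs
    have hn : D s e = 0 := hn
    simp [hn]
  obtain ⟨z₁, hz₁⟩ := hz (1, 0)
  obtain ⟨z₂, hz₂⟩ := hz (0, 1)
  have mu : u ∈ commutatorSpan (QTorus (-1)) := by
    apply mem_of_forall_coef
    intro m hm
    apply mono_mem_commutatorSpan
    intro h
    rw [hu, if_pos h] at hm
    exact hm rfl
  have mz : ∀ z : QTorus (-1), (∀ s, ¬ InTwo s → coef s z = 0) →
      z ∈ Subalgebra.center ℂ (QTorus (-1)) := by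
    intro z hz
    apply mem_of_forall_coef (S := Subalgebra.toSubmodule (Subalgebra.center ℂ (QTorus (-1))))
    intro m hm
    apply mono_mem_center
    by_contra h
    exact hm (hz m h)
  have m1 := mz z₁ (fun s hs => by rw [hz₁, if_neg hs])
  have m2 := mz z₂ (fun s hs => by rw [hz₂, if_neg hs])
  refine ⟨(⟨u, mu⟩, ⟨z₁, m1⟩, ⟨z₂, m2⟩), ?_⟩
  apply Subtype.ext
  apply hom_ext
  intro m
  ext k
  obtain ⟨s, rfl⟩ : ∃ s, k = s + m := ⟨k - m, by abel⟩
  rw [coef_decomp, ← hD, hu, hz₁, hz₂]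
  by_cases hs : InTwo s
  · simp only [if_pos hs, hev s m hs]
    ring
  · simp only [if_neg hs]
    by_cases h : Even s.2
    · have h' : ¬ Even s.1 := fun e => hs ⟨e, h⟩
      have k := hodd s m (0, 1)
      simp only [mul_zero, one_mul, zpow_zero, (Int.not_even_iff_odd.mp h').neg_one_zpow] at k
      rw [if_pos h]
      linear_combination -(1 / 2 : ℂ) * k
    · have k := hodd s m (1, 0)
      simp only [mul_one, zero_mul, zpow_zero, (Int.not_even_iff_odd.mp h).neg_one_zpow] at k
      rw [if_neg h]
      linear_combination (1 / 2 : ℂ) * k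

/-- The decomposition of `Der ℂ_q` at `q = -1` as `ad ℂ_q' ⊕ Z ∂₁ ⊕ Z ∂₂`. -/
def decomp :
    (commutatorSpan (QTorus (-1)) × Subalgebra.center ℂ (QTorus (-1)) ×
      Subalgebra.center ℂ (QTorus (-1))) ≃ₗ[ℂ] derivationAlgebra (QTorus (-1)) :=
  LinearEquiv.ofBijective (decompMap (-1)) ⟨decomp_injective, decomp_surjective⟩

end QTorus

/-- The Lie algebra `Der ℂ_q` at `q = -1`. -/
abbrev DerCq : Type := derivationAlgebra (QTorus (-1))

/-- The underlying space of `A_{a,α,b}`, with basis `v_k`, `k ∈ ℤ²`. -/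
def ModA (_a : Fin 2) (_α : ℂ × ℂ) (_b : ℂ) : Type := QTorus (-1)

namespace ModA

open QTorus

variable {a : Fin 2} {α : ℂ × ℂ} {b : ℂ}

instance : AddCommGroup (ModA a α b) := inferInstanceAs (AddCommGroup (QTorus (-1)))
instance : Module ℂ (ModA a α b) := inferInstanceAs (Module ℂ (QTorus (-1)))

/-- The basis vector `v_k`. -/
def v (a : Fin 2) (α : ℂ × ℂ) (b : ℂ) (k : ℤ × ℤ) : ModA a α b := mono (-1) k

/-- The action of a derivation `d` on `A_{a,α,b}`, through the decomposition
`d = ad u + z₁ ∂₁ + z₂ ∂₂`. Its values on the basis are computed in `inner_v` and `central_v`. -/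
def act (a : Fin 2) (α : ℂ × ℂ) (b : ℂ) : DerCq →ₗ[ℂ] ModA a α b →ₗ[ℂ] ModA a α b :=
  actionMap (-1) ((a : ℕ) : ℂ) α b ∘ₗ decomp.symm.toLinearMap

instance : LieRingModule DerCq (ModA a α b) where
  bracket d y := act a α b d y
  add_lie d d' y := by rw [map_add]; rfl
  lie_add d y y' := map_add _ _ _
  leibniz_lie d d' y := by
    have ha : ((a : ℕ) : ℂ) * ((a : ℕ) : ℂ) = ((a : ℕ) : ℂ) := by
      fin_cases a <;> simp
    obtain ⟨r, hr, h⟩ := action_bracket (q := -1) ((a : ℕ) : ℂ) ha α b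
      (decomp.symm d) (decomp.symm d')
    have e1 : decompMap (-1) (decomp.symm d) = d := decomp.apply_symm_apply d
    have e2 : decompMap (-1) (decomp.symm d') = d' := decomp.apply_symm_apply d'
    rw [e1, e2] at hr
    have e3 : decomp.symm ⁅d, d'⁆ = r := by
      rw [LinearEquiv.symm_apply_eq]; exact hr.symm
    have e4 : act a α b ⁅d, d'⁆ y = actionMap (-1) ((a : ℕ) : ℂ) α b r y := by
      rw [← e3]; rfl
    rw [e4, h y]
    exact (sub_add_cancel _ _).symm

instance : LieModule ℂ DerCq (ModA a α b) where
  smul_lie c d y := by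
    change act a α b (c • d) y = c • act a α b d y
    rw [map_smul]; rfl
  lie_smul c d y := map_smul (act a α b d) c y

theorem lie_def (d : DerCq) (y : ModA a α b) : ⁅d, y⁆ = act a α b d y := rfl

/-- `x^m v_k = (q^(m₂ k₁) - a q^(m₁ k₂)) v_(m+k)` for `m ∉ 2ℤ²`, `q = -1`. -/
theorem inner_v {m : ℤ × ℤ} (hm : ¬ InTwo m) (k : ℤ × ℤ) :
    ⁅(innerDer (mono (-1) m) : DerCq), v a α b k⁆ =
      ((-1 : ℂ) ^ (m.2 * k.1) - (a : ℕ) * (-1 : ℂ) ^ (m.1 * k.2)) • v a α b (m + k) := by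
  have e : decomp.symm (innerDer (mono (-1) m)) =
      (⟨mono (-1) m, mono_mem_commutatorSpan hm⟩, 0, 0) := by
    rw [LinearEquiv.symm_apply_eq]
    apply Subtype.ext
    apply LinearMap.ext
    intro y
    refine Eq.trans ?_ (decompMap_apply _ _ _ _).symm
    simp [innerDer_apply]
  have e' : ⁅(innerDer (mono (-1) m) : DerCq), v a α b k⁆ =
      actionMap (-1) ((a : ℕ) : ℂ) α b (⟨mono (-1) m, mono_mem_commutatorSpan hm⟩, 0, 0)
        (mono (-1) k) := by rw [← e]; rfl
  rw [e']
  simp only [actionMap, LinearMap.mk₂_apply, mono_mul_mono, neg_one_zpow]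
  simp [sub_smul, smul_smul, mul_comm m.1, add_comm k m]
  rfl

/-- `(x^n ∂) v_k = ⟨∂, α + k + b n⟩ v_(n+k)` for `n ∈ 2ℤ²`. -/
theorem central_v {n : ℤ × ℤ} (hn : InTwo n) (c : ℂ × ℂ) (k : ℤ × ℤ) :
    ⁅(centralSMul (degDer (-1) c) ⟨mono (-1) n, mono_mem_center hn⟩ : DerCq), v a α b k⁆ =
      pairing c (α + toC k + b • toC n) • v a α b (n + k) := by
  have e : decomp.symm (centralSMul (degDer (-1) c) ⟨mono (-1) n, mono_mem_center hn⟩) =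
      (0, c.1 • ⟨mono (-1) n, mono_mem_center hn⟩, c.2 • ⟨mono (-1) n, mono_mem_center hn⟩) := by
    rw [LinearEquiv.symm_apply_eq]
    apply Subtype.ext
    apply hom_ext
    intro y
    refine Eq.trans ?_ (decompMap_apply _ _ _ _).symm
    simp [centralSMul_apply, degDer_mono, smul_smul, ← add_smul, pairing, mul_comm]
  have e' : ⁅(centralSMul (degDer (-1) c) ⟨mono (-1) n, mono_mem_center hn⟩ : DerCq), v a α b k⁆ =
      actionMap (-1) ((a : ℕ) : ℂ) α b
        (0, c.1 • ⟨mono (-1) n, mono_mem_center hn⟩, c.2 • ⟨mono (-1) n, mono_mem_center hn⟩)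
        (mono (-1) k) := by rw [← e]; rfl
  rw [e']
  have h1 : (-1 : ℂ) ^ (n.2 * k.1) = 1 := (hn.2.mul_right _).neg_one_zpow
  simp only [actionMap, LinearMap.mk₂_apply, Subalgebra.coe_smul, map_smul, degDer_mono,
    smul_mul_assoc, mul_smul_comm, add_mul, mono_mul_mono, neg_one_zpow, h1, one_smul]
  simp only [Submodule.coe_zero, zero_mul, mul_zero, smul_zero, sub_zero, zero_add, smul_smul,
    ← add_smul]
  refine congrArg (fun r : ℂ => r • mono (-1) (n + k)) ?_
  simp [pairing, toC]
  ring

theorem span_eq : (Submodule.span ℂ {y | ∃ k : ℤ × ℤ, ¬ InTwo k ∧ y = mono (-1) k} :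
    Submodule ℂ (QTorus (-1))) = commutatorSpan (QTorus (-1)) := by
  apply le_antisymm
  · rw [Submodule.span_le]
    rintro y ⟨k, hk, rfl⟩
    exact mono_mem_commutatorSpan hk
  · intro y hy
    apply mem_of_forall_coef
    intro m hm
    exact Submodule.subset_span ⟨m, fun h => hm (coef_commutatorSpan hy h), rfl⟩

theorem center_mul_commutatorSpan {z y : QTorus (-1)}
    (hz : z ∈ Subalgebra.center ℂ (QTorus (-1))) (hy : y ∈ commutatorSpan (QTorus (-1))) :
    z * y ∈ commutatorSpan (QTorus (-1)) := by
  induction hy using Submodule.span_induction with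
  | zero => simp
  | add x y _ _ hx hy => rw [mul_add]; exact add_mem hx hy
  | smul c x _ hx => rw [mul_smul_comm]; exact Submodule.smul_mem _ _ hx
  | mem w hw =>
    obtain ⟨x, y, rfl⟩ := hw
    have e : z * (x * y - y * x) = (z * x) * y - y * (z * x) := by
      rw [mul_sub, ← mul_assoc, ← mul_assoc, ← mul_assoc, center_comm hz y]
    rw [e]
    exact commutator_mem _ _

theorem act_commutatorSpan (α : ℂ × ℂ) (b : ℂ) (d : DerCq) {y : QTorus (-1)}
    (hy : y ∈ commutatorSpan (QTorus (-1))) :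
    (act 1 α b d y : QTorus (-1)) ∈ commutatorSpan (QTorus (-1)) := by
  change actionMap (-1) (((1 : Fin 2) : ℕ) : ℂ) α b (decomp.symm d) y ∈ _
  obtain ⟨⟨u, hu⟩, ⟨z₁, h₁⟩, ⟨z₂, h₂⟩⟩ := decomp.symm d
  simp only [actionMap, LinearMap.mk₂_apply, Fin.val_one, Nat.cast_one, one_smul]
  refine add_mem (add_mem (commutator_mem _ _) (add_mem ?_ ?_)) ?_
  · exact center_mul_commutatorSpan h₁ (derivation_commutatorSpan _ hy)
  · exact center_mul_commutatorSpan h₂ (derivation_commutatorSpan _ hy)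
  · refine center_mul_commutatorSpan ?_ hy
    exact add_mem (add_mem (Subalgebra.smul_mem _ h₁ _) (Subalgebra.smul_mem _ h₂ _))
      (Subalgebra.smul_mem _ (add_mem (derivation_center _ h₁) (derivation_center _ h₂)) _)

/-- The submodule `A'_{1,α,b}` of `A_{1,α,b}`, the span of the `v_k` with `k ∉ 2ℤ²`. -/
def prime (α : ℂ × ℂ) (b : ℂ) : LieSubmodule ℂ DerCq (ModA 1 α b) where
  __ := Submodule.span ℂ {y | ∃ k : ℤ × ℤ, ¬ InTwo k ∧ y = v 1 α b k}
  lie_mem := by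
    intro d y hy
    have hy : y ∈ (Submodule.span ℂ {y | ∃ k : ℤ × ℤ, ¬ InTwo k ∧ y = mono (-1) k} :
      Submodule ℂ (QTorus (-1))) := hy
    rw [span_eq] at hy
    change (act 1 α b d y : QTorus (-1)) ∈
      (Submodule.span ℂ {y | ∃ k : ℤ × ℤ, ¬ InTwo k ∧ y = mono (-1) k} :
      Submodule ℂ (QTorus (-1)))
    rw [span_eq]
    exact act_commutatorSpan α b d hy

end ModA

section Modules

variable (V : Type*) [AddCommGroup V] [Module ℂ V] [LieRingModule DerCq V] [LieModule ℂ DerCq V]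

/-- The weight space of weight `lam` for `H = ℂ ∂₁ ⊕ ℂ ∂₂`: the vectors `x` with
`∂ x = ⟨∂, lam⟩ x` for all `∂ ∈ H`, where `H*` is identified with `ℂ²`. -/
def weightSpace (lam : ℂ × ℂ) : Submodule ℂ V where
  carrier := {x | ∀ c : ℂ × ℂ, ⁅(QTorus.degDer (-1) c : DerCq), x⁆ = pairing c lam • x}
  add_mem' := by
    intro x y hx hy c
    rw [lie_add, hx c, hy c, smul_add]
  zero_mem' := by intro c; simp
  smul_mem' := by
    intro r x hx c
    rw [lie_smul, hx c, smul_comm]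

/-- `V` is a module of the intermediate series: it is the direct sum of its weight spaces, all of
which have dimension at most one. -/
structure IsIntermediateSeries : Prop where
  isInternal : DirectSum.IsInternal (weightSpace V)
  rank_le_one : ∀ lam : ℂ × ℂ, Module.rank ℂ (weightSpace V lam) ≤ 1

/-- `V` is isomorphic to a sub-quotient `Q / P` of `M`, where `P ⊆ Q ⊆ M` are submodules. -/
def IsSubquotient (M : Type*) [AddCommGroup M] [Module ℂ M] [LieRingModule DerCq M]
    [LieModule ℂ DerCq M] : Prop :=
  ∃ (Q : LieSubmodule ℂ DerCq M) (P : LieSubmodule ℂ DerCq Q), Nonempty (V ≃ₗ⁅ℂ, DerCq⁆ (Q ⧸ P))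

end Modules

end

/-! Start with a nonzero weight `lam` of V. Inside one coset of 2ℤ² in `lam` + ℤ² only W matters.
After a choice of weight vectors its action is a family of vectors `g p k` in ℂ², constrained by the
bracket relations (`StructureRel`). The target is g p k = wt k + b·2p, the formula for tensor
densities. The divergence-free fields, x^{2p}∂ with ⟨∂, 2p⟩ = 0, see only symp (2p) (g p k). Along a
line in direction p this number is nonzero when 2p and the weight are independent, and opposite
steps multiply to the square of the density value. Parallelogram relations read in both directions
make the ratios to the density values multiplicative (`triangle_of_ne_zero`). They are therefore a
coboundary (`exists_gauge`), and rescaling turns them into 1. Then g p k - wt k is a multiple of 2p,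
and the multiple is constant (`exists_spin_eq`). All of this stays away from weight 0, where the
formula need not hold; generic choices (`genericFilter`) avoid the degenerate positions.

The ad x^m join at most four such cosets. Their relations with W force the density parameters of
joined cosets to agree, the exceptional jump from 0 to 1 being ruled out by irreducibility
(`exists_param`), and make the constants depend only on classes modulo 2ℤ² (`eq_of_parity`). A
finite problem remains. At q = -1 the classes multiply like a basis of M_2(ℂ) up to signs, so the
three nonzero classes act as sl_2, graded by (ℤ/2)², with graded pieces of dimension at most one. If
the action is nonzero and all four classes occur, a Casimir argument yields E_i² = ±1 and E_i E_k =
±E_{i+k}: this is the left regular module, giving A_0. If the action is nonzero and a class is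
missing, it is the adjoint module, giving A'_1. If the action is zero, a single class occurs and the
inner derivations act trivially.

To compare V with a model M without knowing the weight 0 part, take the submodule of V × M generated
by pairs of matching vectors of nonzero weight. Derivations of nonzero degree are sums of brackets
of other degrees (`derGrade_le_span_lie`), so this submodule adds to the pairs only vectors of
weight 0 (`exists_lieSubmodule_of_weightVectors`). Irreducibility makes it the graph of a surjection
from a submodule of M onto V (`exists_hom_of_matching`). In the two nontrivial cases some ad x^m
enters and leaves weight 0 with nonzero coefficient, which upgrades the surjection to an
isomorphism. A module whose only weight is 0 is one-dimensional and trivial, and is found inside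
A_{1,0,0}. -/

noncomputable section

open QTorus

/-! ### Homogeneous generators of the derivation algebra and their brackets -/

/-- The symplectic form on `ℂ²`. -/
def symp (x y : ℂ × ℂ) : ℂ := x.1 * y.2 - x.2 * y.1

/-- The vector `2p ∈ ℂ²`, for `p ∈ ℤ²`. -/
def dbl (p : ℤ × ℤ) : ℂ × ℂ := toC (p + p)

theorem toC_add (p r : ℤ × ℤ) : toC (p + r) = toC p + toC r := by
  ext <;> simp [toC]

theorem toC_neg (p : ℤ × ℤ) : toC (-p) = -toC p := by
  ext <;> simp [toC]

@[simp] theorem toC_zero : toC 0 = 0 := by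
  ext <;> simp [toC]

theorem toC_injective : Function.Injective toC := by
  intro p r h
  simp only [toC, Prod.mk.injEq, Int.cast_inj] at h
  exact Prod.ext h.1 h.2

theorem toC_eq_zero {p : ℤ × ℤ} : toC p = 0 ↔ p = 0 :=
  ⟨fun h => toC_injective (h.trans toC_zero.symm), fun h => h ▸ toC_zero⟩

theorem dbl_add (p r : ℤ × ℤ) : dbl (p + r) = dbl p + dbl r := by
  simp only [dbl, toC_add]; abel

theorem dbl_neg (p : ℤ × ℤ) : dbl (-p) = -dbl p := by
  simp only [dbl, toC_add, toC_neg]; abel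

theorem dbl_sub (p r : ℤ × ℤ) : dbl (p - r) = dbl p - dbl r := by
  rw [sub_eq_add_neg, dbl_add, dbl_neg, sub_eq_add_neg]

@[simp] theorem dbl_zero : dbl 0 = 0 := by simp [dbl]

theorem add_self_eq_zero_iff {p : ℤ × ℤ} : p + p = 0 ↔ p = 0 := by
  constructor
  · intro h
    have h1 := congrArg Prod.fst h
    have h2 := congrArg Prod.snd h
    simp only [Prod.fst_add, Prod.snd_add, Prod.fst_zero, Prod.snd_zero] at h1 h2
    exact Prod.ext (by simp; omega) (by simp; omega)
  · rintro rfl; simp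

theorem dbl_eq_zero {p : ℤ × ℤ} : dbl p = 0 ↔ p = 0 := by
  rw [dbl, toC_eq_zero, add_self_eq_zero_iff]

theorem inTwo_add_self (p : ℤ × ℤ) : InTwo (p + p) := ⟨⟨p.1, rfl⟩, ⟨p.2, rfl⟩⟩

theorem exists_add_self {m : ℤ × ℤ} (h : InTwo m) : ∃ p, m = p + p := by
  obtain ⟨⟨i, hi⟩, ⟨j, hj⟩⟩ := h
  exact ⟨(i, j), Prod.ext hi hj⟩

/-- The inner derivation `ad x^m`. -/
def adMono (m : ℤ × ℤ) : DerCq := innerDer (mono (-1) m)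

/-- The derivation `x^(2p) ∂` for `∂ ∈ H`. -/
def evenDer (p : ℤ × ℤ) (a : ℂ × ℂ) : DerCq :=
  centralSMul (degDer (-1) a) ⟨mono (-1) (p + p), mono_mem_center (inTwo_add_self p)⟩

theorem adMono_apply (m k : ℤ × ℤ) :
    (adMono m).1 (mono (-1) k) =
      ((-1 : ℂ) ^ (m.2 * k.1) - (-1 : ℂ) ^ (m.1 * k.2)) • mono (-1) (m + k) := by
  rw [adMono, innerDer_apply, mono_mul_mono, mono_mul_mono, add_comm k m, ← sub_smul,
    neg_one_zpow, neg_one_zpow, mul_comm k.2]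

theorem evenDer_apply (p : ℤ × ℤ) (a : ℂ × ℂ) (k : ℤ × ℤ) :
    (evenDer p a).1 (mono (-1) k) = pairing a (toC k) • mono (-1) (p + p + k) := by
  have h : Even ((p + p).2 * k.1) := (inTwo_add_self p).2.mul_right _
  rw [evenDer, centralSMul_apply, degDer_mono, mul_smul_comm]
  simp only [mono_mul_mono, h.neg_one_zpow, Units.val_one, one_smul]

theorem der_ext {d d' : DerCq} (h : ∀ k, d.1 (mono (-1) k) = d'.1 (mono (-1) k)) : d = d' :=
  Subtype.ext (hom_ext h)

theorem lie_der_apply (d d' : DerCq) (x : QTorus (-1)) :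
    (⁅d, d'⁆ : DerCq).1 x = d.1 (d'.1 x) - d'.1 (d.1 x) := rfl

theorem pairing_add_right (a x y : ℂ × ℂ) : pairing a (x + y) = pairing a x + pairing a y := by
  simp [pairing]; ring

theorem pairing_smul_right (a : ℂ × ℂ) (c : ℂ) (x : ℂ × ℂ) :
    pairing a (c • x) = c * pairing a x := by
  simp [pairing]; ring

theorem pairing_neg_right (a x : ℂ × ℂ) : pairing a (-x) = -pairing a x := by
  simp [pairing]; ring

theorem pairing_sub_right (a x y : ℂ × ℂ) : pairing a (x - y) = pairing a x - pairing a y := by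
  simp [pairing]; ring

@[simp] theorem pairing_zero_right (a : ℂ × ℂ) : pairing a 0 = 0 := by simp [pairing]

theorem evenDer_zero (a : ℂ × ℂ) : evenDer 0 a = degDer (-1) a := by
  apply der_ext
  intro k
  rw [evenDer_apply, degDer_mono]
  simp

theorem evenDer_add (p : ℤ × ℤ) (a b : ℂ × ℂ) :
    evenDer p (a + b) = evenDer p a + evenDer p b := by
  apply der_ext
  intro k
  change _ = (evenDer p a).1 _ + (evenDer p b).1 _
  rw [evenDer_apply, evenDer_apply, evenDer_apply, ← add_smul]
  congr 1
  simp [pairing]; ring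

theorem evenDer_smul (p : ℤ × ℤ) (c : ℂ) (a : ℂ × ℂ) :
    evenDer p (c • a) = c • evenDer p a := by
  apply der_ext
  intro k
  change _ = c • (evenDer p a).1 _
  rw [evenDer_apply, evenDer_apply, smul_smul]
  congr 1
  simp [pairing]; ring

/-- The structure constants of `ad ℂ_q'`. -/
def adSign (m k : ℤ × ℤ) : ℂ := (-1 : ℂ) ^ (m.2 * k.1) - (-1 : ℂ) ^ (m.1 * k.2)

theorem adMono_even (p : ℤ × ℤ) : adMono (p + p) = 0 := by
  apply der_ext
  intro k
  rw [adMono_apply, ((inTwo_add_self p).2.mul_right _).neg_one_zpow,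
    ((inTwo_add_self p).1.mul_right _).neg_one_zpow]
  simp

theorem lie_adMono_adMono (m k : ℤ × ℤ) :
    (⁅adMono m, adMono k⁆ : DerCq) = adSign m k • adMono (m + k) := by
  apply Subtype.ext
  apply LinearMap.ext
  intro x
  have h : mono (-1) m * mono (-1) k - mono (-1) k * mono (-1) m =
      adSign m k • mono (-1) (m + k) := by
    rw [mono_mul_mono, mono_mul_mono, add_comm k m, ← sub_smul, neg_one_zpow, neg_one_zpow,
      mul_comm k.2, adSign]
  have e : (adSign m k • adMono (m + k)).1 x =
      (adSign m k • mono (-1) (m + k)) * x - x * (adSign m k • mono (-1) (m + k)) := by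
    change adSign m k • (adMono (m + k)).1 x = _
    rw [adMono, innerDer_apply, smul_sub, smul_mul_assoc, mul_smul_comm]
  refine Eq.trans ?_ e.symm
  rw [lie_der_apply, ← h]
  simp only [adMono, innerDer_apply]
  noncomm_ring

theorem lie_evenDer_adMono (p : ℤ × ℤ) (a : ℂ × ℂ) (m : ℤ × ℤ) :
    (⁅evenDer p a, adMono m⁆ : DerCq) = pairing a (toC m) • adMono (m + (p + p)) := by
  apply der_ext
  intro k
  have e : (pairing a (toC m) • adMono (m + (p + p))).1 (mono (-1) k) =
    pairing a (toC m) • (adMono (m + (p + p))).1 (mono (-1) k) := rfl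
  refine Eq.trans ?_ e.symm
  have h1 : (-1 : ℂ) ^ ((m + (p + p)).2 * k.1) = (-1 : ℂ) ^ (m.2 * k.1) := by
    rw [Prod.snd_add, add_mul, zpow_add₀ (by norm_num),
      ((inTwo_add_self p).2.mul_right _).neg_one_zpow, mul_one]
  have h2 : (-1 : ℂ) ^ ((m + (p + p)).1 * k.2) = (-1 : ℂ) ^ (m.1 * k.2) := by
    rw [Prod.fst_add, add_mul, zpow_add₀ (by norm_num),
      ((inTwo_add_self p).1.mul_right _).neg_one_zpow, mul_one]
  have h3 : (-1 : ℂ) ^ (m.2 * (p + p + k).1) = (-1 : ℂ) ^ (m.2 * k.1) := by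
    rw [Prod.fst_add, mul_add, zpow_add₀ (by norm_num),
      ((inTwo_add_self p).1.mul_left _).neg_one_zpow, one_mul]
  have h4 : (-1 : ℂ) ^ (m.1 * (p + p + k).2) = (-1 : ℂ) ^ (m.1 * k.2) := by
    rw [Prod.snd_add, mul_add, zpow_add₀ (by norm_num),
      ((inTwo_add_self p).2.mul_left _).neg_one_zpow, one_mul]
  have h5 : m + (p + p + k) = m + (p + p) + k := by abel
  have h6 : p + p + (m + k) = m + (p + p) + k := by abel
  simp only [lie_der_apply, adMono_apply, evenDer_apply, map_smul, smul_smul, h1, h2, h3, h4, h5,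
    h6, ← sub_smul, toC_add, pairing_add_right]
  congr 1
  ring

theorem lie_evenDer_evenDer (p : ℤ × ℤ) (a : ℂ × ℂ) (r : ℤ × ℤ) (b : ℂ × ℂ) :
    (⁅evenDer p a, evenDer r b⁆ : DerCq) =
      evenDer (p + r) (pairing a (dbl r) • b - pairing b (dbl p) • a) := by
  apply der_ext
  intro k
  have h5 : p + p + (r + r + k) = p + r + (p + r) + k := by abel
  have h6 : r + r + (p + p + k) = p + r + (p + r) + k := by abel
  simp only [lie_der_apply, evenDer_apply, map_smul, smul_smul, h5, h6, ← sub_smul]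
  congr 1
  simp [pairing, dbl, toC]
  ring

/-- The decomposition into inner derivations and central multiples of ∂₁, ∂₂ reduces the claim to
monomials in each of the three arguments. -/
theorem der_span (P : Submodule ℂ DerCq) (h1 : ∀ m, adMono m ∈ P) (h2 : ∀ p a, evenDer p a ∈ P)
    (d : DerCq) : d ∈ P := by
  have hi : ∀ u : QTorus (-1), innerDer u ∈ P := by
    intro u
    induction u using induct with
    | h0 => simp
    | hadd x y hx hy => rw [map_add]; exact add_mem hx hy
    | hmono c m => rw [map_smul]; exact P.smul_mem _ (h1 m)
  have hc : ∀ (a : ℂ × ℂ) (z : Subalgebra.center ℂ (QTorus (-1))),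
      centralSMul (degDer (-1) a) z ∈ P := by
    intro a z
    -- Monomial-by-monomial membership is available only for subspaces of the quantum torus itself,
    -- so the preimage of `P` in the center is pushed forward there.
    have hz : z.1 ∈ (P.comap (centralSMul (degDer (-1) a))).map
        (Subalgebra.center ℂ (QTorus (-1))).val.toLinearMap := by
      apply mem_of_forall_coef
      intro m hm
      have hm' : InTwo m := by
        by_contra h
        exact hm (coef_center z.2 h)
      obtain ⟨p, rfl⟩ := exists_add_self hm'
      exact ⟨⟨mono (-1) (p + p), mono_mem_center (inTwo_add_self p)⟩, h2 p a, rfl⟩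
    obtain ⟨z', hz', e⟩ := hz
    have e' : z' = z := Subtype.ext e
    exact e' ▸ hz'
  obtain ⟨⟨u, z₁, z₂⟩, rfl⟩ := decomp_surjective d
  exact add_mem (hi u) (add_mem (hc _ z₁) (hc _ z₂))

/-- The homogeneous component of degree `d` of `Der ℂ_q`. -/
def derGrade (d : ℤ × ℤ) : Submodule ℂ DerCq :=
  Submodule.span ℂ ({adMono d} ∪ {X | ∃ p a, d = p + p ∧ X = evenDer p a})

theorem adMono_mem (m : ℤ × ℤ) : adMono m ∈ derGrade m :=
  Submodule.subset_span (Or.inl rfl)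

theorem evenDer_mem (p : ℤ × ℤ) (a : ℂ × ℂ) : evenDer p a ∈ derGrade (p + p) :=
  Submodule.subset_span (Or.inr ⟨p, a, rfl, rfl⟩)

theorem derGrade_induction {d : ℤ × ℤ} (P : Submodule ℂ DerCq) (h1 : adMono d ∈ P)
    (h2 : ∀ p a, d = p + p → evenDer p a ∈ P) : derGrade d ≤ P := by
  rw [derGrade, Submodule.span_le]
  rintro X (rfl | ⟨p, a, hd, rfl⟩)
  · exact h1
  · exact h2 p a hd

theorem lie_mem_derGrade {d e : ℤ × ℤ} {X Y : DerCq} (hX : X ∈ derGrade d) (hY : Y ∈ derGrade e) :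
    (⁅X, Y⁆ : DerCq) ∈ derGrade (d + e) := by
  induction hX using Submodule.span_induction with
  | zero => rw [zero_lie]; exact zero_mem _
  | add x y _ _ hx hy => rw [add_lie]; exact add_mem hx hy
  | smul c x _ hx => rw [smul_lie]; exact Submodule.smul_mem _ _ hx
  | mem X hX =>
    induction hY using Submodule.span_induction with
    | zero => rw [lie_zero]; exact zero_mem _
    | add x y _ _ hx hy => rw [lie_add]; exact add_mem hx hy
    | smul c x _ hx => rw [lie_smul]; exact Submodule.smul_mem _ _ hx
    | mem Y hY =>
      rcases hX with rfl | ⟨p, a, rfl, rfl⟩ <;> rcases hY with rfl | ⟨r, b, rfl, rfl⟩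
      · rw [lie_adMono_adMono]; exact Submodule.smul_mem _ _ (adMono_mem _)
      · rw [← lie_skew, lie_evenDer_adMono]
        exact neg_mem (Submodule.smul_mem _ _ (adMono_mem _))
      · rw [lie_evenDer_adMono, add_comm (p + p)]
        exact Submodule.smul_mem _ _ (adMono_mem _)
      · rw [lie_evenDer_evenDer]
        have e : p + p + (r + r) = p + r + (p + r) := by abel
        rw [e]; exact evenDer_mem _ _

theorem der_span_derGrade (P : Submodule ℂ DerCq) (h : ∀ d, derGrade d ≤ P) (X : DerCq) : X ∈ P :=
  der_span P (fun m => h m (adMono_mem m)) (fun p a => h _ (evenDer_mem p a)) X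

theorem exists_pairing_ne_zero {x : ℂ × ℂ} (hx : x ≠ 0) : ∃ a, pairing a x ≠ 0 := by
  by_contra! h
  apply hx
  have h1 := h (1, 0)
  have h2 := h (0, 1)
  simp only [pairing, one_mul, zero_mul, add_zero, zero_add] at h1 h2
  exact Prod.ext h1 h2

/-- For independent x and y the lines in H annihilating x and annihilating y span H; the two
components come from Cramer's rule. -/
theorem exists_decomp {x y : ℂ × ℂ} (h : symp x y ≠ 0) (a : ℂ × ℂ) :
    ∃ b c, a = b + c ∧ pairing b x = 0 ∧ pairing c y = 0 := by
  have h' : x.1 * y.2 - x.2 * y.1 ≠ 0 := h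
  refine ⟨(-(pairing a y / symp x y) * x.2, (pairing a y / symp x y) * x.1),
    ((pairing a x / symp x y) * y.2, -(pairing a x / symp x y) * y.1), ?_, ?_, ?_⟩
  · have hz : symp x y = x.1 * y.2 - x.2 * y.1 := rfl
    rw [hz]
    ext
    · simp only [pairing, Prod.fst_add]
      rw [div_mul_eq_mul_div, neg_mul, div_mul_eq_mul_div, ← neg_div, ← add_div, eq_div_iff h']
      ring
    · simp only [pairing, Prod.snd_add]
      rw [div_mul_eq_mul_div, neg_mul, div_mul_eq_mul_div, ← neg_div, ← add_div, eq_div_iff h']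
      ring
  · simp only [pairing]; ring
  · simp only [pairing]; ring

/-- Every homogeneous derivation of nonzero degree `d` is a sum of brackets of homogeneous
derivations of degrees different from `0` and `d`. -/
theorem derGrade_le_span_lie {d : ℤ × ℤ} (hd : d ≠ 0) :
    derGrade d ≤ Submodule.span ℂ {X | ∃ d₁ d₂ X₁ X₂, d₁ + d₂ = d ∧ d₁ ≠ 0 ∧ d₂ ≠ 0 ∧
      X₁ ∈ derGrade d₁ ∧ X₂ ∈ derGrade d₂ ∧ X = (⁅X₁, X₂⁆ : DerCq)} := by
  apply derGrade_induction
  · by_cases ht : InTwo d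
    · obtain ⟨p, rfl⟩ := exists_add_self ht
      rw [adMono_even]; exact zero_mem _
    · have h2 : d - ((1, 0) + (1, 0)) ≠ 0 := by
        intro h
        apply ht
        rw [sub_eq_zero.mp h]
        exact inTwo_add_self _
      obtain ⟨a, ha⟩ := exists_pairing_ne_zero (fun h => h2 (toC_eq_zero.mp h))
      -- Split off the even degree 2(1,0): a field x^{2(1,0)}∂ that sees the remaining degree brings
      -- `adMono` up to degree d. The remainder is nonzero because d is not even.
      have e : adMono d = (pairing a (toC (d - ((1, 0) + (1, 0)))))⁻¹ •
          (⁅evenDer (1, 0) a, adMono (d - ((1, 0) + (1, 0)))⁆ : DerCq) := by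
        rw [lie_evenDer_adMono, smul_smul, inv_mul_cancel₀ ha, one_smul, sub_add_cancel]
      rw [e]
      refine Submodule.smul_mem _ _ (Submodule.subset_span
        ⟨_, _, _, _, ?_, ?_, h2, evenDer_mem _ _, adMono_mem _, rfl⟩)
      · abel
      · simp
  · rintro p a rfl
    have hp : p ≠ 0 := fun h => hd (by simp [h])
    have hr : ∃ r : ℤ × ℤ, p.1 * r.2 - p.2 * r.1 ≠ 0 := by
      by_contra! h
      have h1 := h (1, 0)
      have h2 := h (0, 1)
      apply hp
      ext
      · simpa using h2
      · simpa using h1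
    obtain ⟨r, hr⟩ := hr
    have hs : symp (dbl r) (dbl (p - r)) ≠ 0 := by
      have e : symp (dbl r) (dbl (p - r)) = ((-4 * (p.1 * r.2 - p.2 * r.1) : ℤ) : ℂ) := by
        simp [symp, dbl, toC]; ring
      rw [e, Int.cast_ne_zero]
      exact mul_ne_zero (by norm_num) hr
    have hr0 : r ≠ 0 := by rintro rfl; simp at hr
    have hpr : p - r ≠ 0 := by
      intro h
      rw [sub_eq_zero] at h
      subst h
      apply hr; ring
    have hmem : ∀ b c, evenDer p (pairing b (dbl (p - r)) • c - pairing c (dbl r) • b) ∈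
        Submodule.span ℂ {X | ∃ d₁ d₂ X₁ X₂, d₁ + d₂ = p + p ∧ d₁ ≠ 0 ∧ d₂ ≠ 0 ∧
          X₁ ∈ derGrade d₁ ∧ X₂ ∈ derGrade d₂ ∧ X = (⁅X₁, X₂⁆ : DerCq)} := by
      intro b c
      refine Submodule.subset_span ⟨_, _, _, _, ?_, ?_, ?_, evenDer_mem r b,
        evenDer_mem (p - r) c, ?_⟩
      · abel
      · rwa [Ne, add_self_eq_zero_iff]
      · rwa [Ne, add_self_eq_zero_iff]
      · rw [lie_evenDer_evenDer]; congr 1; abel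
    -- In the bracket of x^{2r}∂ and x^{2(p-r)}∂' one of the two terms disappears if ∂' kills 2r, or
    -- if ∂ kills 2(p-r). Splitting the direction accordingly leaves nonzero multiples of the two
    -- wanted fields.
    obtain ⟨b, c, rfl, hb, hc⟩ := exists_decomp hs a
    obtain ⟨b', hb'⟩ := exists_pairing_ne_zero (x := dbl (p - r))
      (fun h => hpr (dbl_eq_zero.mp h))
    obtain ⟨c', hc'⟩ := exists_pairing_ne_zero (x := dbl r) (fun h => hr0 (dbl_eq_zero.mp h))
    rw [evenDer_add]
    apply add_mem
    · have h := hmem b' b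
      rw [hb, zero_smul, sub_zero, evenDer_smul] at h
      exact (Submodule.smul_mem_iff _ hb').mp h
    · have h := hmem c c'
      rw [hc, zero_smul, zero_sub, ← neg_smul, evenDer_smul] at h
      exact (Submodule.smul_mem_iff _ (neg_ne_zero.mpr hc')).mp h

end

/-! ### Generic positions, and divergence-free steps along a line -/

noncomputable section

open QTorus Filter

/-- A filter on `ℤ²` along which affine functionals are eventually nonzero. -/
def genericFilter : Filter (ℤ × ℤ) := Filter.map (fun s : ℕ => ((s : ℤ), (s : ℤ) ^ 2)) atTop

instance : NeBot genericFilter := by unfold genericFilter; infer_instance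

theorem symp_self (x : ℂ × ℂ) : symp x x = 0 := by simp [symp]; ring

theorem symp_swap (x y : ℂ × ℂ) : symp x y = -symp y x := by simp [symp]; ring

theorem symp_add_left (x y z : ℂ × ℂ) : symp (x + y) z = symp x z + symp y z := by
  simp [symp]; ring

theorem symp_add_right (x y z : ℂ × ℂ) : symp x (y + z) = symp x y + symp x z := by
  simp [symp]; ring

theorem symp_neg_left (x y : ℂ × ℂ) : symp (-x) y = -symp x y := by
  simp [symp]; ring

theorem symp_neg_right (x y : ℂ × ℂ) : symp x (-y) = -symp x y := by
  simp [symp]; ring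

theorem symp_sub_left (x y z : ℂ × ℂ) : symp (x - y) z = symp x z - symp y z := by
  simp [symp]; ring

theorem symp_sub_right (x y z : ℂ × ℂ) : symp x (y - z) = symp x y - symp x z := by
  simp [symp]; ring

theorem symp_smul_left (c : ℂ) (x y : ℂ × ℂ) : symp (c • x) y = c * symp x y := by
  simp [symp]; ring

theorem symp_smul_right (c : ℂ) (x y : ℂ × ℂ) : symp x (c • y) = c * symp x y := by
  simp [symp]; ring

theorem left_ne_zero_of_symp {x y : ℂ × ℂ} (h : symp x y ≠ 0) : x ≠ 0 := by
  rintro rfl; simp [symp] at h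

theorem right_ne_zero_of_symp {x y : ℂ × ℂ} (h : symp x y ≠ 0) : y ≠ 0 := by
  rintro rfl; simp [symp] at h

/-- The element of `H` with `⟨rot x, y⟩ = symp x y`. -/
def rot (x : ℂ × ℂ) : ℂ × ℂ := (-x.2, x.1)

theorem pairing_rot (x y : ℂ × ℂ) : pairing (rot x) y = symp x y := by
  simp [pairing, rot, symp]; ring

/-- On the parabola (s, s²) the functional becomes a polynomial of degree at most 2 in s, whose
coefficients are c and, up to factors ±2, the coordinates of w. It is not the zero polynomial, so it
has finitely many roots. -/
theorem eventually_affine_ne_zero {c : ℂ} {w : ℂ × ℂ} (h : c ≠ 0 ∨ w ≠ 0) :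
    ∀ᶠ p in genericFilter, c + symp (dbl p) w ≠ 0 := by
  rw [genericFilter, Filter.eventually_map]
  let P : Polynomial ℂ := Polynomial.C c + Polynomial.C (2 * w.2) * Polynomial.X -
    Polynomial.C (2 * w.1) * Polynomial.X ^ 2
  have hP : P ≠ 0 := by
    intro h0
    have h1 : P.coeff 0 = 0 := by rw [h0]; simp
    have h2 : P.coeff 1 = 0 := by rw [h0]; simp
    have h3 : P.coeff 2 = 0 := by rw [h0]; simp
    simp only [P, Polynomial.coeff_add, Polynomial.coeff_sub, Polynomial.coeff_C_mul,
      Polynomial.coeff_X, Polynomial.coeff_X_pow, Polynomial.coeff_C] at h1 h2 h3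
    norm_num at h1 h2 h3
    rcases h with h | h
    · exact h h1
    · exact h (Prod.ext h3 h2)
  have hfin : {s : ℕ | P.IsRoot (s : ℂ)}.Finite :=
    (P.finite_setOfPred_isRoot hP).preimage Nat.cast_injective.injOn
  have hev : ∀ᶠ s : ℕ in atTop, s ∉ {s : ℕ | P.IsRoot (s : ℂ)} := by
    rw [← Nat.cofinite_eq_atTop]
    exact hfin.compl_mem_cofinite
  filter_upwards [hev] with s hs h0
  apply hs
  simp only [Polynomial.IsRoot, P, Polynomial.eval_sub, Polynomial.eval_add,
    Polynomial.eval_mul, Polynomial.eval_C, Polynomial.eval_X, Polynomial.eval_pow]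
  rw [← h0]
  simp [symp, dbl, toC]
  ring

/-- A variant of `eventually_affine_ne_zero` for a functional given in another form. -/
theorem eventually_ne_zero_of_eq {f : ℤ × ℤ → ℂ} (c : ℂ) (w : ℂ × ℂ) (h : c ≠ 0 ∨ w ≠ 0)
    (hf : ∀ p, f p = c + symp (dbl p) w) : ∀ᶠ p in genericFilter, f p ≠ 0 := by
  filter_upwards [eventually_affine_ne_zero h] with p hp
  rwa [hf]

/-- The weights `lam + 2k`. -/
def wt (lam : ℂ × ℂ) (k : ℤ × ℤ) : ℂ × ℂ := lam + dbl k

variable {lam : ℂ × ℂ}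

theorem wt_add (k p : ℤ × ℤ) : wt lam (k + p) = wt lam k + dbl p := by
  rw [wt, wt, dbl_add, add_assoc]

/-- Transversality of 2p to the weight is thus a property of the whole line k + ℤp; when it holds,
no weight on that line is 0 and the relations apply all along it. -/
theorem symp_wt_add (p k : ℤ × ℤ) : symp (dbl p) (wt lam (k + p)) = symp (dbl p) (wt lam k) := by
  rw [wt_add, symp_add_right, symp_self, add_zero]

theorem eventually_symp_wt {v : ℂ × ℂ} (hv : v ≠ 0) (u : ℂ × ℂ) :
    ∀ᶠ t in genericFilter, symp (wt lam t - u) v ≠ 0 :=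
  eventually_ne_zero_of_eq (symp (lam - u) v) v (Or.inr hv) fun p => by
    rw [wt, ← symp_add_left]; congr 1; abel

theorem eventually_symp_wt' {v : ℂ × ℂ} (hv : v ≠ 0) :
    ∀ᶠ t in genericFilter, symp (wt lam t) v ≠ 0 := by
  simpa using eventually_symp_wt (lam := lam) hv 0

theorem pairing_ext {x y : ℂ × ℂ} (h : ∀ a, pairing a x = pairing a y) : x = y := by
  have h1 := h (1, 0)
  have h2 := h (0, 1)
  simp only [pairing, one_mul, zero_mul, add_zero, zero_add] at h1 h2
  exact Prod.ext h1 h2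

/-- The Lie relations for `⟨a, g p k⟩` as structure constants of the action of `x^(2p) ∂_a`
from the weight `lam + 2k` to the weight `lam + 2k + 2p`, away from the weight `0`. -/
structure StructureRel (lam : ℂ × ℂ) (g : ℤ × ℤ → ℤ × ℤ → ℂ × ℂ) : Prop where
  zero : ∀ k, wt lam k ≠ 0 → g 0 k = wt lam k
  rel : ∀ p r k, wt lam k ≠ 0 → wt lam (k + p) ≠ 0 → wt lam (k + r) ≠ 0 →
    wt lam (k + p + r) ≠ 0 → ∀ a b,
    pairing a (g p (k + r)) * pairing b (g r k) - pairing b (g r (k + p)) * pairing a (g p k) =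
      pairing a (dbl r) * pairing b (g (p + r) k) - pairing b (dbl p) * pairing a (g (p + r) k)

namespace StructureRel

variable {g : ℤ × ℤ → ℤ × ℤ → ℂ × ℂ}

/-- The bracket of x^{2p}∂_a and x^{-2p}∂_b lies in H, where the action is known from the weight.
This identity of tensors in a and b is the only input on opposite steps. -/
theorem tensor (h : StructureRel lam g) {p k : ℤ × ℤ} (hk : symp (dbl p) (wt lam k) ≠ 0)
    (a b : ℂ × ℂ) :
    pairing a (g p k) * pairing b (g (-p) (k + p)) -
      pairing b (g (-p) (k + p + p)) * pairing a (g p (k + p)) =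
      -pairing a (dbl p) * pairing b (wt lam (k + p)) -
        pairing b (dbl p) * pairing a (wt lam (k + p)) := by
  have h1 : symp (dbl p) (wt lam (k + p)) ≠ 0 := by rwa [symp_wt_add]
  have h2 : symp (dbl p) (wt lam (k + p + p)) ≠ 0 := by rwa [symp_wt_add]
  have e : k + p + -p = k := by abel
  have e' : k + p + p + -p = k + p := by abel
  have := h.rel p (-p) (k + p) (right_ne_zero_of_symp h1) (right_ne_zero_of_symp h2)
    (by rw [e]; exact right_ne_zero_of_symp hk) (by rw [e']; exact right_ne_zero_of_symp h1) a b
  rwa [e, add_neg_cancel, h.zero _ (right_ne_zero_of_symp h1), dbl_neg, pairing_neg_right] at this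

/-- Contraction with the direction that annihilates 2p: the steps by p enter only through their
divergence-free part, and one term on the right drops out. -/
theorem tensor_left (h : StructureRel lam g) {p k : ℤ × ℤ} (hk : symp (dbl p) (wt lam k) ≠ 0)
    (b : ℂ × ℂ) :
    symp (dbl p) (g p k) * pairing b (g (-p) (k + p)) -
      symp (dbl p) (g p (k + p)) * pairing b (g (-p) (k + p + p)) =
      -symp (dbl p) (wt lam k) * pairing b (dbl p) := by
  have := h.tensor hk (rot (dbl p)) b
  simp only [pairing_rot, symp_wt_add, symp_self] at this
  linear_combination this

theorem tensor_right (h : StructureRel lam g) {p k : ℤ × ℤ} (hk : symp (dbl p) (wt lam k) ≠ 0)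
    (a : ℂ × ℂ) :
    symp (dbl p) (g (-p) (k + p)) * pairing a (g p k) -
      symp (dbl p) (g (-p) (k + p + p)) * pairing a (g p (k + p)) =
      -symp (dbl p) (wt lam k) * pairing a (dbl p) := by
  have := h.tensor hk a (rot (dbl p))
  simp only [pairing_rot, symp_wt_add, symp_self] at this
  linear_combination this

/-- Write x_i and Y_i for the divergence-free constant of the step p and the vector of the step -p
at position i on the line. If some x vanishes, two consecutive relations `tensor_left` make the two
preceding Y parallel to 2p. The divergence-free parts of these Y are then 0, and `tensor_right`
equates 0 with a nonzero multiple of 2p. -/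
theorem symp_ne_zero (h : StructureRel lam g) {p k : ℤ × ℤ}
    (hk : symp (dbl p) (wt lam k) ≠ 0) : symp (dbl p) (g p k) ≠ 0 := by
  have hn : dbl p ≠ 0 := left_ne_zero_of_symp hk
  -- The supposed zero is placed two steps after j, so that relations are available at both
  -- preceding positions.
  suffices H : ∀ j, symp (dbl p) (wt lam j) ≠ 0 → symp (dbl p) (g p (j + p + p)) ≠ 0 by
    have hj : symp (dbl p) (wt lam (k - p - p)) ≠ 0 := by
      rwa [← symp_wt_add, ← symp_wt_add, sub_add_cancel, sub_add_cancel]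
    have := H _ hj
    rwa [sub_add_cancel, sub_add_cancel] at this
  intro j hj h0
  have hj1 : symp (dbl p) (wt lam (j + p)) ≠ 0 := by rwa [symp_wt_add]
  have r1 := h.tensor_left hj
  have r1' := h.tensor_left hj1
  have r2 := h.tensor_right hj (rot (rot (dbl p)))
  simp only [symp_wt_add, h0, zero_mul, sub_zero] at r1 r1' r2
  obtain ⟨b, hb⟩ := exists_pairing_ne_zero hn
  have hx1 : symp (dbl p) (g p (j + p)) ≠ 0 := by
    intro e
    have := r1' b
    rw [e, zero_mul] at this
    exact mul_ne_zero (neg_ne_zero.mpr hj) hb this.symm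
  have hx0 : symp (dbl p) (g p j) ≠ 0 := by
    intro e
    have h1 := r1' b
    have h2 := r1 b
    rw [e, zero_mul, h1] at h2
    apply mul_ne_zero (mul_ne_zero two_ne_zero hj) hb
    linear_combination h2
  have hy2 : symp (dbl p) (g (-p) (j + p + p)) = 0 := by
    have h1 := r1' (rot (dbl p))
    rw [pairing_rot, pairing_rot, symp_self, mul_zero] at h1
    exact (mul_eq_zero.mp h1).resolve_left hx1
  have hy1 : symp (dbl p) (g (-p) (j + p)) = 0 := by
    have h1 := r1 (rot (dbl p))
    rw [pairing_rot, pairing_rot, pairing_rot, symp_self, mul_zero, hy2, mul_zero, sub_zero] at h1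
    exact (mul_eq_zero.mp h1).resolve_left hx0
  have r2 := h.tensor_right hj b
  rw [hy1, hy2, zero_mul, zero_mul, sub_zero] at r2
  exact mul_ne_zero (neg_ne_zero.mpr hj) hb r2.symm

/-- The commutator of two fields of degree 2p gives symp (g p (k+p)) (g p k) = symp (2p) (g (2p) k).
Pairing `tensor_right` with g p k through `symp` turns the left side into a multiple of a single
step constant. -/
theorem double_step (h : StructureRel lam g) {p k : ℤ × ℤ}
    (hk : symp (dbl p) (wt lam k) ≠ 0) :
    symp (dbl p) (g (-p) (k + p + p)) * symp (dbl p) (g (p + p) k) =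
      symp (dbl p) (wt lam k) * symp (dbl p) (g p k) := by
  have h1 : symp (dbl p) (wt lam (k + p)) ≠ 0 := by rwa [symp_wt_add]
  have h2 : symp (dbl p) (wt lam (k + p + p)) ≠ 0 := by rwa [symp_wt_add]
  have e := h.rel p p k (right_ne_zero_of_symp hk) (right_ne_zero_of_symp h1)
    (right_ne_zero_of_symp h1) (right_ne_zero_of_symp h2) (1, 0) (0, 1)
  have r1 := h.tensor_right hk (1, 0)
  have r2 := h.tensor_right hk (0, 1)
  simp only [pairing, one_mul, zero_mul, add_zero, zero_add] at e r1 r2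
  rw [symp.eq_1 (dbl p) (g (p + p) k), symp.eq_1 (dbl p) (g p k)]
  rw [← e]
  linear_combination (-(g p k).2) * r1 + (g p k).1 * r2

/-- The product of two opposite steps. -/
theorem symp_mul_symp (h : StructureRel lam g) {p k : ℤ × ℤ}
    (hk : symp (dbl p) (wt lam k) ≠ 0) :
    symp (dbl p) (g p k) * symp (dbl p) (g (-p) (k + p)) = symp (dbl p) (wt lam k) ^ 2 := by
  have hn : dbl p ≠ 0 := left_ne_zero_of_symp hk
  have h1 : symp (dbl p) (wt lam (k + p)) ≠ 0 := by rwa [symp_wt_add]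
  have h2 : symp (dbl p) (wt lam (k + p + p)) ≠ 0 := by rwa [symp_wt_add]
  have h3 : symp (dbl p) (wt lam (k + p + p + p)) ≠ 0 := by rwa [symp_wt_add]
  obtain ⟨b, hb⟩ := exists_pairing_ne_zero hn
  have e : k + p + -p = k := by abel
  have e1 : k + p + (p + p) = k + p + p + p := by abel
  have e2 : k + p + (p + p) + -p = k + p + p := by abel
  have e3 : p + p + -p = p := by abel
  -- Opposite steps determine the product only up to its being constant along the line; a bracket of
  -- degrees 4p and -2p supplies its actual value.
  have t := h.rel (p + p) (-p) (k + p) (right_ne_zero_of_symp h1)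
    (by rw [e1]; exact right_ne_zero_of_symp h3) (by rw [e]; exact right_ne_zero_of_symp hk)
    (by rw [e2]; exact right_ne_zero_of_symp h2) (rot (dbl p)) b
  rw [e, e1, e3, pairing_rot, pairing_rot, pairing_rot, dbl_neg, symp_neg_right, symp_self,
    dbl_add, pairing_add_right, pairing_rot] at t
  have d0 := h.double_step hk
  have d1 := h.double_step h1
  have r1 := h.tensor_left hk b
  have r1' := h.tensor_left h1 b
  have s0 := h.tensor_left hk (rot (dbl p))
  have s1 := h.tensor_left h1 (rot (dbl p))
  rw [pairing_rot, pairing_rot, pairing_rot, symp_self] at s0 s1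
  simp only [symp_wt_add] at d0 d1 r1 r1' s0 s1
  have hx := h.symp_ne_zero h1
  -- Let C be the constant product along the line and s the transversality number. By `double_step`
  -- the double steps are s·x_i·x_{i+1}/C. Inserted in `t` and compared with the sum of two
  -- `tensor_left` relations, this gives s²/C = 1. The combination below is this computation cleared
  -- of denominators.
  apply mul_left_cancel₀ (mul_ne_zero hx hb)
  linear_combination (1 / 2 : ℂ) * (symp (dbl p) (g p k) * symp (dbl p) (g (-p) (k + p))) * t
    - (1 / 2 : ℂ) * (pairing b (g (-p) (k + p)) * symp (dbl p) (g (p + p) k)) * s0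
    - (1 / 2 : ℂ) * pairing b (g (-p) (k + p)) * symp (dbl p) (g p (k + p)) * d0
    + (1 / 2 : ℂ) * (pairing b (g (-p) (k + p + p + p)) * symp (dbl p) (g (p + p) (k + p)))
      * (s0 + s1)
    + (1 / 2 : ℂ) * pairing b (g (-p) (k + p + p + p)) * symp (dbl p) (g p (k + p + p)) * d1
    - (1 / 2 : ℂ) * symp (dbl p) (wt lam k) * symp (dbl p) (g p (k + p)) * (r1 + r1')

end StructureRel
end

/-! ### The ratios of divergence-free steps to density values form a coboundary -/

noncomputable section

open QTorus Filter
variable {lam : ℂ × ℂ}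
-- The two equations are interchanged by inverting P and Q. Eliminating P leaves (1 - Q)² = 0 up to
-- nonzero factors, so the trivial solution is a double root and the only one.
theorem eq_one_of_triangle {A B P Q : ℂ} (hB : B ≠ 0) (hA : A ≠ 0) (hAB : A - B ≠ 0) (hP : P ≠ 0)
    (hQ : Q ≠ 0) (h1 : A * P - B * Q = A - B) (h2 : A * P⁻¹ - B * Q⁻¹ = A - B) : P = 1 := by
  have h3 : A * Q - B * P = (A - B) * (P * Q) := by
    rw [← h2]
    field_simp
  have h4 : (A - B) * B * (1 - Q) ^ 2 = 0 := by
    linear_combination (-A) * h3 - (B - (-(A - B) * Q)) * h1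
  have h5 : Q = 1 := by
    have := (mul_eq_zero.mp h4).resolve_left (mul_ne_zero hAB hB)
    linear_combination -(pow_eq_zero_iff two_ne_zero).mp this
  subst h5
  apply mul_left_cancel₀ hA
  linear_combination h1

/-- The structure constant of the divergence-free step from `k` to `l`, relative to its value
in the modules of tensor densities. -/
def stepRatio (lam : ℂ × ℂ) (g : ℤ × ℤ → ℤ × ℤ → ℂ × ℂ) (k l : ℤ × ℤ) : ℂ :=
  symp (dbl (l - k)) (g (l - k) k) / symp (wt lam l) (wt lam k)

theorem wt_sub (k l : ℤ × ℤ) : dbl (l - k) = wt lam l - wt lam k := by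
  rw [dbl_sub, wt, wt]; abel

theorem symp_dbl_sub (k l : ℤ × ℤ) :
    symp (dbl (l - k)) (wt lam k) = symp (wt lam l) (wt lam k) := by
  rw [wt_sub (lam := lam), symp_sub_left, symp_self, sub_zero]

namespace StructureRel

variable {g : ℤ × ℤ → ℤ × ℤ → ℂ × ℂ}

theorem stepRatio_ne_zero (h : StructureRel lam g) {k l : ℤ × ℤ}
    (hkl : symp (wt lam l) (wt lam k) ≠ 0) : stepRatio lam g k l ≠ 0 :=
  div_ne_zero (h.symp_ne_zero (by rwa [symp_dbl_sub])) hkl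

theorem stepRatio_mul_stepRatio (h : StructureRel lam g) {k l : ℤ × ℤ}
    (hkl : symp (wt lam l) (wt lam k) ≠ 0) : stepRatio lam g k l * stepRatio lam g l k = 1 := by
  have h1 := h.symp_mul_symp (p := l - k) (k := k) (by rwa [symp_dbl_sub])
  have e : k + (l - k) = l := by abel
  rw [symp_dbl_sub, e] at h1
  have h2 : symp (wt lam k) (wt lam l) = -symp (wt lam l) (wt lam k) := symp_swap _ _
  have e' : k - l = -(l - k) := by abel
  rw [stepRatio, stepRatio, h2, e', dbl_neg, symp_neg_left, neg_div_neg_eq, div_mul_div_comm, h1,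
    ← sq, div_self (pow_ne_zero 2 hkl)]

/-- The relation between divergence-free steps around a parallelogram. -/
theorem parallelogram (h : StructureRel lam g) {k l m n : ℤ × ℤ} (hn : k + m = l + n)
    (hkl : symp (wt lam l) (wt lam k) ≠ 0) (hkn : symp (wt lam n) (wt lam k) ≠ 0)
    (hlm : symp (wt lam m) (wt lam l) ≠ 0) (hnm : symp (wt lam m) (wt lam n) ≠ 0)
    (hkm : symp (wt lam m) (wt lam k) ≠ 0) :
    symp (wt lam m) (wt lam l) * symp (wt lam l) (wt lam k) *
        (stepRatio lam g l m * stepRatio lam g k l) -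
      symp (wt lam m) (wt lam n) * symp (wt lam n) (wt lam k) *
        (stepRatio lam g n m * stepRatio lam g k n) =
      (symp (wt lam m) (wt lam l) * symp (wt lam l) (wt lam k) -
        symp (wt lam m) (wt lam n) * symp (wt lam n) (wt lam k)) * stepRatio lam g k m := by
  obtain rfl : n = k + m - l := by rw [hn]; abel
  have e1 : m - (k + m - l) = l - k := by abel
  have e2 : k + m - l - k = m - l := by abel
  have e3 : k + (m - l) = k + m - l := by abel
  have e4 : k + (l - k) = l := by abel
  have e5 : k + (m - l) + (l - k) = m := by abel
  have e6 : m - l + (l - k) = m - k := by abel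
  -- Divergence-free fields are closed under the bracket: those of degrees 2p and 2r give symp (2p)
  -- (2r) times the one of degree 2p + 2r. Here the two orders of applying them are the two ways
  -- around the parallelogram and the bracket is its diagonal.
  have t := h.rel (m - l) (l - k) k (right_ne_zero_of_symp hkl)
    (by rw [e3]; exact left_ne_zero_of_symp hkn) (by rw [e4]; exact left_ne_zero_of_symp hkl)
    (by rw [e5]; exact left_ne_zero_of_symp hkm) (rot (dbl (m - l))) (rot (dbl (l - k)))
  rw [e3, e4, e6] at t
  simp only [pairing_rot] at t
  have hw : wt lam (k + m - l) = wt lam k + wt lam m - wt lam l := by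
    simp only [wt, dbl_add, dbl_sub]; abel
  have q1 : symp (wt lam m) (wt lam l) * stepRatio lam g l m = symp (dbl (m - l)) (g (m - l) l) :=
    mul_div_cancel₀ _ hlm
  have q2 : symp (wt lam l) (wt lam k) * stepRatio lam g k l = symp (dbl (l - k)) (g (l - k) k) :=
    mul_div_cancel₀ _ hkl
  have q3 : symp (wt lam m) (wt lam (k + m - l)) * stepRatio lam g (k + m - l) m =
      symp (dbl (l - k)) (g (l - k) (k + m - l)) := by
    rw [← e1]; exact mul_div_cancel₀ _ hnm
  have q4 : symp (wt lam (k + m - l)) (wt lam k) * stepRatio lam g k (k + m - l) =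
      symp (dbl (m - l)) (g (m - l) k) := by
    rw [← e2]; exact mul_div_cancel₀ _ hkn
  have q5 : symp (wt lam m) (wt lam k) * stepRatio lam g k m = symp (dbl (m - k)) (g (m - k) k) :=
    mul_div_cancel₀ _ hkm
  have q6 : symp (dbl (m - l)) (dbl (l - k)) * symp (wt lam m) (wt lam k) =
      symp (wt lam m) (wt lam l) * symp (wt lam l) (wt lam k) -
        symp (wt lam m) (wt lam (k + m - l)) * symp (wt lam (k + m - l)) (wt lam k) := by
    rw [wt_sub (lam := lam), wt_sub (lam := lam), hw]
    simp only [symp, Prod.fst_add, Prod.fst_sub, Prod.snd_add, Prod.snd_sub]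
    ring
  have q7 : dbl (m - k) = dbl (m - l) + dbl (l - k) := by rw [← dbl_add, e6]
  have q8 : symp (dbl (m - k)) (g (m - k) k) =
      symp (dbl (m - l)) (g (m - k) k) + symp (dbl (l - k)) (g (m - k) k) := by
    rw [q7, symp_add_left]
  have q9 : symp (dbl (l - k)) (dbl (m - l)) = -symp (dbl (m - l)) (dbl (l - k)) := symp_swap _ _
  rw [q9] at t
  rw [← q6]
  have q10 : symp (dbl (m - l)) (dbl (l - k)) * symp (wt lam m) (wt lam k) * stepRatio lam g k m =
      symp (dbl (m - l)) (dbl (l - k)) *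
        (symp (dbl (m - l)) (g (m - k) k) + symp (dbl (l - k)) (g (m - k) k)) := by
    rw [mul_assoc, q5, q8]
  rw [q10, mul_mul_mul_comm (symp (wt lam m) (wt lam l)),
    mul_mul_mul_comm (symp (wt lam m) (wt lam (k + m - l))), q1, q2, q3, q4]
  linear_combination t

/-- Let P and Q be the two path ratios from k to m through l and through n, divided by the ratio of
the diagonal. The parallelogram read from k to m is a linear equation in P and Q; read from m to k
it is the same equation in P⁻¹ and Q⁻¹, because opposite steps have inverse ratios. Then
`eq_one_of_triangle` applies. -/
theorem triangle_of_ne_zero (h : StructureRel lam g) {k l m n : ℤ × ℤ} (hn : k + m = l + n)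
    (hkl : symp (wt lam l) (wt lam k) ≠ 0) (hkn : symp (wt lam n) (wt lam k) ≠ 0)
    (hlm : symp (wt lam m) (wt lam l) ≠ 0) (hnm : symp (wt lam m) (wt lam n) ≠ 0)
    (hkm : symp (wt lam m) (wt lam k) ≠ 0) (hlk : symp (wt lam m - wt lam l) (wt lam l - wt lam k) ≠ 0) :
    stepRatio lam g k l * stepRatio lam g l m = stepRatio lam g k m := by
  have p1 := h.parallelogram hn hkl hkn hlm hnm hkm
  have sw : ∀ {x y : ℂ × ℂ}, symp x y ≠ 0 → symp y x ≠ 0 := by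
    intro x y hxy
    rw [symp_swap]
    exact neg_ne_zero.mpr hxy
  have p2 := h.parallelogram (k := m) (l := l) (m := k) (n := n) (by rw [add_comm, hn])
    (sw hlm) (sw hnm) (sw hkl) (sw hkn) (sw hkm)
  have hinv : ∀ {i j : ℤ × ℤ}, symp (wt lam j) (wt lam i) ≠ 0 →
      stepRatio lam g j i = (stepRatio lam g i j)⁻¹ := fun hij =>
    (inv_eq_of_mul_eq_one_right (h.stepRatio_mul_stepRatio hij)).symm
  rw [hinv hkl, hinv hlm, hinv hkn, hinv hnm, hinv hkm] at p2
  have n1 := h.stepRatio_ne_zero hkl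
  have n2 := h.stepRatio_ne_zero hlm
  have n3 := h.stepRatio_ne_zero hkn
  have n4 := h.stepRatio_ne_zero hnm
  have n5 := h.stepRatio_ne_zero hkm
  have hC : symp (wt lam m) (wt lam l) * symp (wt lam l) (wt lam k) -
        symp (wt lam m) (wt lam n) * symp (wt lam n) (wt lam k) ≠ 0 := by
    have hw : wt lam n = wt lam k + wt lam m - wt lam l := by
      obtain rfl : n = k + m - l := by rw [hn]; abel
      simp only [wt, dbl_add, dbl_sub]; abel
    have e : symp (wt lam m) (wt lam l) * symp (wt lam l) (wt lam k) -
        symp (wt lam m) (wt lam n) * symp (wt lam n) (wt lam k) =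
        symp (wt lam m - wt lam l) (wt lam l - wt lam k) * symp (wt lam m) (wt lam k) := by
      rw [hw]
      simp only [symp, Prod.fst_add, Prod.fst_sub, Prod.snd_add, Prod.snd_sub]
      ring
    rw [e]
    exact mul_ne_zero hlk hkm
  have key := eq_one_of_triangle (P := stepRatio lam g l m * stepRatio lam g k l / stepRatio lam g k m)
    (Q := stepRatio lam g n m * stepRatio lam g k n / stepRatio lam g k m)
    (mul_ne_zero hnm hkn) (mul_ne_zero hlm hkl) hC
    (div_ne_zero (mul_ne_zero n2 n1) n5) (div_ne_zero (mul_ne_zero n4 n3) n5)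
    (by
      rw [← mul_div_assoc, ← mul_div_assoc, ← sub_div, div_eq_iff n5]
      exact p1)
    (by
      rw [symp_swap (wt lam k), symp_swap (wt lam l) (wt lam m), symp_swap (wt lam k) (wt lam n),
        symp_swap (wt lam n) (wt lam m)] at p2
      have p3 : (stepRatio lam g k m)⁻¹ * stepRatio lam g k m = 1 := inv_mul_cancel₀ n5
      rw [inv_div, inv_div, div_eq_mul_inv, div_eq_mul_inv, mul_inv, mul_inv]
      linear_combination (stepRatio lam g k m) * p2 + (symp (wt lam m) (wt lam l) *
        symp (wt lam l) (wt lam k) - symp (wt lam m) (wt lam n) * symp (wt lam n) (wt lam k)) * p3)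
  rw [div_eq_one_iff_eq n5] at key
  rw [mul_comm]; exact key

/-- For fixed k and l each nondegeneracy condition on t, including those on the fourth vertex k + t
- l, is a nonzero affine condition. -/
theorem eventually_triangle (h : StructureRel lam g) {k l : ℤ × ℤ}
    (hkl : symp (wt lam l) (wt lam k) ≠ 0) :
    ∀ᶠ t in genericFilter, stepRatio lam g k l * stepRatio lam g l t = stepRatio lam g k t := by
  have hk : wt lam k ≠ 0 := right_ne_zero_of_symp hkl
  have hl : wt lam l ≠ 0 := left_ne_zero_of_symp hkl
  have hd : wt lam l - wt lam k ≠ 0 := by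
    intro e
    rw [sub_eq_zero] at e
    rw [e, symp_self] at hkl
    exact hkl rfl
  have hw : ∀ t, wt lam (k + t - l) = wt lam t - (wt lam l - wt lam k) := by
    intro t; simp only [wt, dbl_add, dbl_sub]; abel
  filter_upwards [eventually_symp_wt (lam := lam) hk (wt lam l - wt lam k),
    eventually_symp_wt' (lam := lam) hl, eventually_symp_wt' (lam := lam) hd,
    eventually_symp_wt' (lam := lam) hk, eventually_symp_wt (lam := lam) hd (wt lam l)]
    with t h1 h2 h3 h4 h5
  refine h.triangle_of_ne_zero (n := k + t - l) (by abel) hkl ?_ h2 ?_ h4 h5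
  · rw [hw]; exact h1
  · rw [hw, symp_sub_right, symp_self, zero_sub]
    exact neg_ne_zero.mpr h3

/-- The ratios of the divergence-free steps form a coboundary. -/
theorem exists_gauge (h : StructureRel lam g) (k₀ : ℤ × ℤ) (hk₀ : wt lam k₀ ≠ 0) :
    ∃ σ : ℤ × ℤ → ℂ, (∀ k, σ k ≠ 0) ∧ ∀ k l, symp (wt lam l) (wt lam k) ≠ 0 →
      σ k * stepRatio lam g k l = σ l := by
  -- The gauge at k compares the steps from k₀ and from k to a common far vertex; the triangle
  -- identity makes the comparison independent of a generic vertex, so k₀ and k themselves need not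
  -- be in general position.
  have hex : ∀ k, ∃ s : ℂ, s ≠ 0 ∧ (wt lam k ≠ 0 →
      ∀ᶠ t in genericFilter, stepRatio lam g k₀ t = s * stepRatio lam g k t) := by
    intro k
    by_cases hk : wt lam k = 0
    · exact ⟨1, one_ne_zero, fun h => absurd hk h⟩
    · obtain ⟨t', h1, h2⟩ := ((eventually_symp_wt' (lam := lam) hk₀).and
        (eventually_symp_wt' (lam := lam) hk)).exists
      refine ⟨stepRatio lam g k₀ t' / stepRatio lam g k t',
        div_ne_zero (h.stepRatio_ne_zero h1) (h.stepRatio_ne_zero h2), fun _ => ?_⟩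
      filter_upwards [h.eventually_triangle h1, h.eventually_triangle h2] with t h3 h4
      rw [← h3, ← h4, ← mul_assoc, div_mul_cancel₀ _ (h.stepRatio_ne_zero h2)]
  choose σ h0 hσ using hex
  refine ⟨σ, h0, fun k l hkl => ?_⟩
  have hk : wt lam k ≠ 0 := right_ne_zero_of_symp hkl
  have hl : wt lam l ≠ 0 := left_ne_zero_of_symp hkl
  obtain ⟨t, h1, h2, h3, h4⟩ := ((hσ k hk).and ((hσ l hl).and ((h.eventually_triangle hkl).and
    (eventually_symp_wt' (lam := lam) hl)))).exists
  apply mul_right_cancel₀ (h.stepRatio_ne_zero h4)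
  rw [← h2, h1, ← h3, mul_assoc]

/-- This is the effect on the constants of rescaling the weight vectors by σ; both composites and
the bracket term acquire the same factor σ k / σ (k + p + r). -/
theorem gauge (h : StructureRel lam g) {σ : ℤ × ℤ → ℂ} (hσ : ∀ k, σ k ≠ 0) :
    StructureRel lam (fun p k => (σ k / σ (k + p)) • g p k) := by
  refine ⟨fun k hk => ?_, fun p r k h1 h2 h3 h4 a b => ?_⟩
  · rw [add_zero, div_self (hσ k), one_smul, h.zero k hk]
  · have e : k + r + p = k + p + r := by abel
    have e' : k + (p + r) = k + p + r := by abel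
    have := h.rel p r k h1 h2 h3 h4 a b
    simp only [pairing_smul_right, e, e']
    have n1 := hσ (k + p)
    have n2 := hσ (k + r)
    have n3 := hσ (k + p + r)
    have s1 : σ (k + r) / σ (k + p + r) * (σ k / σ (k + r)) = σ k / σ (k + p + r) := by
      field_simp
    have s2 : σ (k + p) / σ (k + p + r) * (σ k / σ (k + p)) = σ k / σ (k + p + r) := by
      field_simp
    linear_combination (σ k / σ (k + p + r)) * this +
      pairing a (g p (k + r)) * pairing b (g r k) * s1 -
      pairing b (g r (k + p)) * pairing a (g p k) * s2

end StructureRel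
end

/-! ### The density parameter is constant -/

noncomputable section

open QTorus Filter
variable {lam : ℂ × ℂ}

/-- The coefficient `β` with `g p k = lam + 2k + β 2p`, if there is one. -/
def spin (lam : ℂ × ℂ) (g : ℤ × ℤ → ℤ × ℤ → ℂ × ℂ) (p k : ℤ × ℤ) : ℂ :=
  symp (g p k) (wt lam k) / symp (dbl p) (wt lam k)

/-- Structure constants in which the divergence-free steps are those of tensor densities. -/
structure NormalizedRel (lam : ℂ × ℂ) (g : ℤ × ℤ → ℤ × ℤ → ℂ × ℂ) : Prop
    extends StructureRel lam g where
  norm : ∀ p k, symp (dbl p) (wt lam k) ≠ 0 → symp (dbl p) (g p k) = symp (dbl p) (wt lam k)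

theorem StructureRel.exists_normalizedRel {g : ℤ × ℤ → ℤ × ℤ → ℂ × ℂ} (h : StructureRel lam g)
    (k₀ : ℤ × ℤ) (hk₀ : wt lam k₀ ≠ 0) :
    ∃ σ : ℤ × ℤ → ℂ, (∀ k, σ k ≠ 0) ∧
      NormalizedRel lam (fun p k => (σ k / σ (k + p)) • g p k) := by
  obtain ⟨σ, hσ, H⟩ := h.exists_gauge k₀ hk₀
  refine ⟨σ, hσ, h.gauge hσ, fun p k hpk => ?_⟩
  have e : symp (wt lam (k + p)) (wt lam k) = symp (dbl p) (wt lam k) := by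
    rw [wt_add, symp_add_left, symp_self, zero_add]
  have := H k (k + p) (by rwa [e])
  rw [stepRatio, e, add_sub_cancel_left, mul_div_assoc', div_eq_iff hpk] at this
  rw [symp_smul_right, div_mul_eq_mul_div, this, mul_div_assoc, mul_div_cancel₀ _ (hσ _)]

namespace NormalizedRel

variable {g : ℤ × ℤ → ℤ × ℤ → ℂ × ℂ}

/-- After normalization g p k - wt k is symplectically orthogonal to 2p, hence a multiple of 2p;
pairing with the weight identifies the multiple. -/
theorem eq_spin (h : NormalizedRel lam g) {p k : ℤ × ℤ} (hpk : symp (dbl p) (wt lam k) ≠ 0) :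
    g p k = wt lam k + spin lam g p k • dbl p := by
  have h1 := h.norm p k hpk
  have h2 : spin lam g p k * symp (dbl p) (wt lam k) = symp (g p k) (wt lam k) :=
    div_mul_cancel₀ _ hpk
  have e1 : symp (dbl p) (wt lam k) * (g p k).1 = symp (dbl p) (wt lam k) *
      ((wt lam k).1 + spin lam g p k * (dbl p).1) := by
    have : symp (dbl p) (wt lam k) * (spin lam g p k * (dbl p).1) =
      symp (g p k) (wt lam k) * (dbl p).1 := by rw [← h2]; ring
    rw [mul_add, this]
    simp only [symp] at h1 ⊢
    linear_combination ((wt lam k).1) * h1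
  have e2 : symp (dbl p) (wt lam k) * (g p k).2 = symp (dbl p) (wt lam k) *
      ((wt lam k).2 + spin lam g p k * (dbl p).2) := by
    have : symp (dbl p) (wt lam k) * (spin lam g p k * (dbl p).2) =
      symp (g p k) (wt lam k) * (dbl p).2 := by rw [← h2]; ring
    rw [mul_add, this]
    simp only [symp] at h1 ⊢
    linear_combination ((wt lam k).2) * h1
  exact Prod.ext (mul_left_cancel₀ hpk e1) (mul_left_cancel₀ hpk e2)

/-- With the density form inserted, `tensor_left` and `tensor_right` each say that a parameter is
unchanged along the line in direction p, one for the backward steps and one for the forward steps.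
-/
theorem spin_add_and_neg (h : NormalizedRel lam g) {p k : ℤ × ℤ}
    (hpk : symp (dbl p) (wt lam k) ≠ 0) :
    spin lam g p (k + p) = spin lam g p k ∧ spin lam g (-p) (k + p) = spin lam g p k := by
  have h1 : symp (dbl p) (wt lam (k + p)) ≠ 0 := by rwa [symp_wt_add]
  have h2 : symp (dbl p) (wt lam (k + p + p)) ≠ 0 := by rwa [symp_wt_add]
  have h1' : symp (dbl (-p)) (wt lam (k + p)) ≠ 0 := by
    rw [dbl_neg, symp_neg_left]; exact neg_ne_zero.mpr h1
  have h2' : symp (dbl (-p)) (wt lam (k + p + p)) ≠ 0 := by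
    rw [dbl_neg, symp_neg_left]; exact neg_ne_zero.mpr h2
  obtain ⟨b, hb⟩ := exists_pairing_ne_zero (left_ne_zero_of_symp hpk)
  have tl := h.tensor_left hpk b
  have tr := h.tensor_right hpk b
  -- Both slots are contracted with the direction killing the weight at k + p, so that the right
  -- side vanishes; what remains compares the parameters of forward and backward steps.
  have t := h.tensor hpk (rot (wt lam (k + p))) (rot (wt lam (k + p)))
  rw [h.eq_spin hpk, h.eq_spin h1, h.eq_spin h1', h.eq_spin h2'] at tl tr t
  simp only [wt_add, dbl_neg, pairing_rot, pairing_add_right, pairing_smul_right,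
    pairing_neg_right, symp_self, symp_add_left, symp_add_right, symp_smul_right,
    symp_neg_right] at tl tr t
  have c1 : spin lam g (-p) (k + p) = spin lam g (-p) (k + p + p) := by
    apply mul_left_cancel₀ (mul_ne_zero hpk hb)
    linear_combination -tl
  have c2 : spin lam g p k = spin lam g p (k + p) := by
    apply mul_left_cancel₀ (mul_ne_zero hpk hb)
    linear_combination tr
  refine ⟨c2.symm, ?_⟩
  rw [← c1, ← c2, symp_swap (wt lam k)] at t
  apply mul_left_cancel₀ (pow_ne_zero 2 hpk)
  linear_combination t

theorem symp_neg_ne_zero {p k : ℤ × ℤ} (hpk : symp (dbl p) (wt lam k) ≠ 0) :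
    symp (dbl (-p)) (wt lam k) ≠ 0 := by
  rw [dbl_neg, symp_neg_left]
  exact neg_ne_zero.mpr hpk

theorem spin_neg (h : NormalizedRel lam g) {p k : ℤ × ℤ}
    (hpk : symp (dbl p) (wt lam k) ≠ 0) : spin lam g (-p) k = spin lam g p k := by
  have h1 : symp (dbl (-p)) (wt lam (k + p)) ≠ 0 := symp_neg_ne_zero (by rwa [symp_wt_add])
  have h2 := (h.spin_add_and_neg h1).1
  rw [add_neg_cancel_right] at h2
  rw [h2]
  exact (h.spin_add_and_neg hpk).2

theorem spin_rel (h : NormalizedRel lam g) {p r k : ℤ × ℤ}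
    (hp : symp (dbl p) (wt lam k) ≠ 0) (hr : symp (dbl r) (wt lam k) ≠ 0)
    (hpr : symp (dbl p) (wt lam (k + r)) ≠ 0) (hrp : symp (dbl r) (wt lam (k + p)) ≠ 0)
    (hs : symp (dbl (p + r)) (wt lam k) ≠ 0) :
    (symp (dbl p) (wt lam k) + symp (dbl p) (dbl r)) * spin lam g r k -
      symp (dbl p) (wt lam k) * spin lam g r (k + p) =
      symp (dbl p) (dbl r) * spin lam g (p + r) k := by
  obtain ⟨b, hb⟩ := exists_pairing_ne_zero (left_ne_zero_of_symp hr)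
  have hz : wt lam (k + p + r) ≠ 0 := by
    rw [← symp_wt_add] at hrp
    exact right_ne_zero_of_symp hrp
  have t := h.rel p r k (right_ne_zero_of_symp hp) (right_ne_zero_of_symp hrp)
    (right_ne_zero_of_symp hpr) hz (rot (dbl p)) b
  rw [h.eq_spin hr, h.eq_spin hp, h.eq_spin hpr, h.eq_spin hrp, h.eq_spin hs] at t
  simp only [wt_add, dbl_add, pairing_rot, pairing_add_right, pairing_smul_right, symp_self]
    at t
  apply mul_right_cancel₀ hb
  linear_combination t

/-- Consider the parallelogram at k with sides p and r. The parameters of its four sides and of its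
diagonal from k satisfy four relations `spin_rel`: two from the pair p, r, and two from going back
from the diagonal along -r and -p. For generic r eliminating the other three leaves the equality of
the two sides at k. -/
theorem eventually_spin_eq (h : NormalizedRel lam g) {p k : ℤ × ℤ}
    (hp : symp (dbl p) (wt lam k) ≠ 0) :
    ∀ᶠ r in genericFilter, spin lam g p k = spin lam g r k := by
  have hk := right_ne_zero_of_symp hp
  have hn := left_ne_zero_of_symp hp
  have hkp : wt lam (k + p) ≠ 0 := by
    rw [← symp_wt_add] at hp
    exact right_ne_zero_of_symp hp
  filter_upwards [eventually_affine_ne_zero (c := 0) (Or.inr hk),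
    eventually_affine_ne_zero (c := 0) (Or.inr hn),
    eventually_affine_ne_zero (c := 0) (Or.inr hkp),
    eventually_affine_ne_zero (c := symp (dbl p) (wt lam k)) (Or.inr hk),
    eventually_affine_ne_zero (c := symp (dbl p) (wt lam k)) (w := - dbl p)
      (Or.inr (neg_ne_zero.mpr hn)),
    eventually_affine_ne_zero (c := symp (dbl p) (wt lam k)) (w := wt lam k + dbl p)
      (Or.inl hp),
    eventually_affine_ne_zero (c := symp (dbl p) (wt lam k)) (w := wt lam k - dbl p)
      (Or.inl hp)] with r h1 h2 h3 h4 h5 h6 h7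
  simp only [zero_add] at h1 h2 h3
  have hD : symp (dbl p) (dbl r) = -symp (dbl r) (dbl p) := symp_swap _ _
  have w1 : symp (dbl p) (wt lam (k + r)) ≠ 0 := by
    rw [wt_add, symp_add_right, hD, ← symp_neg_right]
    exact h5
  have w2 : symp (dbl (p + r)) (wt lam k) ≠ 0 := by
    rw [dbl_add, symp_add_left]
    exact h4
  have er : k + (p + r) + -r = k + p := by abel
  have ep : k + (p + r) + -p = k + r := by abel
  have er' : p + r + -r = p := by abel
  have ep' : p + r + -p = r := by abel
  have w3 : symp (dbl (p + r)) (wt lam (k + -r)) ≠ 0 := by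
    convert h6 using 1
    simp only [wt_add, dbl_add, dbl_neg, symp_add_left, symp_add_right, symp_neg_right, symp_self,
      hD]
    ring
  have w4 : symp (dbl (p + r)) (wt lam (k + -p)) ≠ 0 := by
    convert h7 using 1
    simp only [wt_add, dbl_add, dbl_neg, symp_add_left, symp_neg_right, symp_self,
      symp_sub_right, symp_add_right]
    ring
  have w5 : symp (dbl (-r)) (wt lam (k + (p + r))) ≠ 0 := by
    rw [← add_assoc]
    exact symp_neg_ne_zero (by rwa [symp_wt_add])
  have w6 : symp (dbl (-p)) (wt lam (k + (p + r))) ≠ 0 := by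
    rw [add_comm p, ← add_assoc]
    exact symp_neg_ne_zero (by rwa [symp_wt_add])
  have er : p + r + -r = p := by abel
  have ep : p + r + -p = r := by abel
  have s1 := h.spin_rel hp h1 w1 h3 w2
  have s2 := h.spin_rel h1 hp h3 w1 (by rwa [add_comm])
  have s3 := h.spin_rel w2 (symp_neg_ne_zero h1) w3 w5 (by rwa [er])
  have s4 := h.spin_rel w2 (symp_neg_ne_zero hp) w4 w6 (by rwa [ep])
  have n1 : spin lam g (-r) (k + (p + r)) = spin lam g r (k + p) := by
    rw [← add_assoc]; exact (h.spin_add_and_neg h3).2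
  have n2 : spin lam g (-p) (k + (p + r)) = spin lam g p (k + r) := by
    rw [add_comm p, ← add_assoc]; exact (h.spin_add_and_neg w1).2
  rw [er, h.spin_neg h1, n1] at s3
  rw [ep, h.spin_neg hp, n2] at s4
  rw [add_comm r p] at s2
  simp only [dbl_add, dbl_neg, symp_add_left, symp_neg_right, symp_self, hD] at s1 s2 s3 s4
  have w2' : symp (dbl p) (wt lam k) + symp (dbl r) (wt lam k) ≠ 0 := h4
  apply mul_left_cancel₀ (mul_ne_zero h2 w2')
  linear_combination ((symp (dbl p) (wt lam k) + symp (dbl r) (wt lam k)) / 2) * (s1 + s2)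
    - (symp (dbl p) (wt lam k) / 2) * s3 - (symp (dbl r) (wt lam k) / 2) * s4

/-- All the coefficients `spin` agree. -/
theorem exists_spin_eq (h : NormalizedRel lam g) : ∃ b, ∀ p k, symp (dbl p) (wt lam k) ≠ 0 →
    spin lam g p k = b := by
  have key : ∀ k l t : ℤ × ℤ, symp (wt lam l) (wt lam k) ≠ 0 → symp (wt lam t) (wt lam k) ≠ 0 →
      spin lam g (l - k) k = spin lam g (t - k) k := by
    intro k l t hl ht
    rw [← symp_dbl_sub] at hl ht
    obtain ⟨r, h1, h2⟩ := ((h.eventually_spin_eq hl).and (h.eventually_spin_eq ht)).exists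
    rw [h1, h2]
  have sw : ∀ k l : ℤ × ℤ, symp (wt lam l) (wt lam k) ≠ 0 →
      spin lam g (l - k) k = spin lam g (k - l) l := by
    intro k l hl
    rw [← symp_dbl_sub] at hl
    have := (h.spin_add_and_neg hl).2
    rw [add_sub_cancel, neg_sub] at this
    exact this.symm
  have all : ∀ k l k' l' : ℤ × ℤ, symp (wt lam l) (wt lam k) ≠ 0 →
      symp (wt lam l') (wt lam k') ≠ 0 → spin lam g (l - k) k = spin lam g (l' - k') k' := by
    intro k l k' l' hl hl'
    have hk := right_ne_zero_of_symp hl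
    have hk' := right_ne_zero_of_symp hl'
    -- Two arbitrary steps are linked through a vertex t transverse to both starting points: all
    -- steps leaving one vertex agree, and a step agrees with its reverse.
    obtain ⟨t, h1, h2⟩ := ((eventually_symp_wt' (lam := lam) hk).and
      (eventually_symp_wt' (lam := lam) hk')).exists
    have h1' : symp (wt lam k) (wt lam t) ≠ 0 := by
      rw [symp_swap]; exact neg_ne_zero.mpr h1
    have h2' : symp (wt lam k') (wt lam t) ≠ 0 := by
      rw [symp_swap]; exact neg_ne_zero.mpr h2
    rw [key k l t hl h1, key k' l' t hl' h2, sw k t h1, sw k' t h2, key t k k' h1' h2']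
  by_cases hex : ∃ p₀ k₀, symp (dbl p₀) (wt lam k₀) ≠ 0
  · obtain ⟨p₀, k₀, h₀⟩ := hex
    refine ⟨spin lam g p₀ k₀, fun p k hpk => ?_⟩
    have e : ∀ q j : ℤ × ℤ, j + q - j = q := fun q j => by abel
    have := all k (k + p) k₀ (k₀ + p₀) (by rwa [← symp_dbl_sub, e]) (by rwa [← symp_dbl_sub, e])
    rwa [e, e] at this
  · push Not at hex
    exact ⟨0, fun p k hpk => absurd (hex p k) hpk⟩

/-- The structure constants are those of tensor densities. -/
theorem exists_eq (h : NormalizedRel lam g) : ∃ b : ℂ, ∀ p k, wt lam k ≠ 0 → wt lam (k + p) ≠ 0 →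
    g p k = wt lam k + b • dbl p := by
  obtain ⟨b, hb⟩ := h.exists_spin_eq
  have H : ∀ p k, symp (dbl p) (wt lam k) ≠ 0 → g p k = wt lam k + b • dbl p := by
    intro p k hpk
    rw [h.eq_spin hpk, hb p k hpk]
  refine ⟨b, fun p k hk hkp => ?_⟩
  by_cases hp : p = 0
  · subst hp
    rw [h.zero k hk]; simp
  have hn : dbl p ≠ 0 := fun e => hp (dbl_eq_zero.mp e)
  by_cases hpk : symp (dbl p) (wt lam k) = 0
  swap
  · exact H p k hpk
  -- For 2p parallel to the weight the step has no parameter of its own; it is recovered from the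
  -- bracket of two transverse steps r and p - r, for which the formula is known.
  obtain ⟨r, h1, h2, h3⟩ := ((eventually_affine_ne_zero (c := 0) (Or.inr hk)).and
    ((eventually_affine_ne_zero (c := 0) (Or.inr hkp)).and
    (eventually_affine_ne_zero (c := 0) (Or.inr hn)))).exists
  rw [zero_add] at h1 h2 h3
  have e : p - r + r = p := by abel
  have w1 : symp (dbl (p - r)) (wt lam k) ≠ 0 := by
    rw [dbl_sub, symp_sub_left, hpk, zero_sub]; exact neg_ne_zero.mpr h1
  have w2 : symp (dbl (p - r)) (wt lam (k + r)) ≠ 0 := by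
    convert neg_ne_zero.mpr h2 using 1
    simp only [wt_add, dbl_sub, symp_sub_left, symp_add_right, symp_self, hpk]
    rw [symp_swap (dbl p)]; ring
  have w3 : symp (dbl r) (wt lam (k + (p - r))) ≠ 0 := by
    convert h2 using 1
    simp only [wt_add, dbl_sub, symp_add_right, symp_sub_right, symp_self]
    ring
  have hz : k + (p - r) + r = k + p := by abel
  have t := h.rel (p - r) r k hk (right_ne_zero_of_symp w3) (right_ne_zero_of_symp w2)
    (by rwa [hz])
  rw [e, H _ _ h1, H _ _ w1, H _ _ w2, H _ _ w3] at t
  set d := g p k - (wt lam k + b • dbl p) with hd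
  have hg : g p k = wt lam k + b • dbl p + d := by rw [hd]; abel
  -- The defect d satisfies 2r ⊗ d = d ⊗ (2p - 2r). Since 2r and 2p - 2r are independent, d must be
  -- 0.
  have t' : ∀ a c, pairing a (dbl r) * pairing c d = pairing c (dbl p - dbl r) * pairing a d := by
    intro a c
    have := t a c
    rw [hg] at this
    simp only [wt_add, dbl_sub, pairing_add_right, pairing_smul_right, pairing_sub_right] at this ⊢
    linear_combination -this
  have hd0 : d = 0 := by
    apply pairing_ext
    intro c
    have t1 := t' (rot (dbl r)) c
    have t2 := t' (rot (dbl p)) c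
    rw [pairing_rot, pairing_rot, symp_self, zero_mul] at t1
    obtain ⟨c', hc'⟩ := exists_pairing_ne_zero (x := dbl p - dbl r) (by
      intro e
      rw [sub_eq_zero] at e
      rw [e, symp_self] at h3
      exact h3 rfl)
    have t3 := t' (rot (dbl r)) c'
    rw [pairing_rot, pairing_rot, symp_self, zero_mul] at t3
    have t4 : symp (dbl r) d = 0 := (mul_eq_zero.mp t3.symm).resolve_left hc'
    have t5 := t' (rot (dbl r - dbl p)) (rot (dbl r))
    simp only [pairing_rot, symp_sub_left, symp_self, symp_sub_right, t4] at t5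
    have t6 : symp (dbl p) d = 0 := by
      apply mul_left_cancel₀ h3
      linear_combination t5
    rw [pairing_rot, pairing_rot, t6, mul_zero] at t2
    have h3' : symp (dbl p) (dbl r) ≠ 0 := by rw [symp_swap]; exact neg_ne_zero.mpr h3
    rw [pairing_zero_right]
    exact (mul_eq_zero.mp t2).resolve_left h3'
  rw [hg, hd0, add_zero]

end NormalizedRel
end

/-! ### Cosets of 2ℤ² carry tensor density modules -/

noncomputable section

open QTorus Filter

section WittModules

variable {V : Type*} [AddCommGroup V] [Module ℂ V] [LieRingModule DerCq V] [LieModule ℂ DerCq V]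

theorem mem_weightSpace {mu : ℂ × ℂ} {x : V} :
    x ∈ weightSpace V mu ↔ ∀ a, ⁅evenDer 0 a, x⁆ = pairing a mu • x := by
  simp only [evenDer_zero]
  exact Iff.rfl

theorem lie_degree {d : ℤ × ℤ} {X : DerCq} (hX : X ∈ derGrade d) (a : ℂ × ℂ) :
    (⁅evenDer 0 a, X⁆ : DerCq) = pairing a (toC d) • X := by
  induction hX using Submodule.span_induction with
  | zero => rw [lie_zero, smul_zero]
  | add x y _ _ hx hy => rw [lie_add, hx, hy, smul_add]
  | smul c x _ hx => rw [lie_smul, hx, smul_comm]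
  | mem X hX =>
    rcases hX with rfl | ⟨p, b, rfl, rfl⟩
    · rw [lie_evenDer_adMono, add_zero, add_zero]
    · rw [lie_evenDer_evenDer, zero_add, dbl_zero, pairing_zero_right, zero_smul, sub_zero,
        evenDer_smul, dbl]

theorem lie_mem_weightSpace {d : ℤ × ℤ} {X : DerCq} (hX : X ∈ derGrade d) {mu : ℂ × ℂ} {x : V}
    (hx : x ∈ weightSpace V mu) : ⁅X, x⁆ ∈ weightSpace V (mu + toC d) := by
  rw [mem_weightSpace] at hx ⊢
  intro a
  rw [leibniz_lie, hx a, lie_degree hX, smul_lie, lie_smul, ← add_smul, pairing_add_right, add_comm]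

theorem exists_generator {mu : ℂ × ℂ} (hr : Module.rank ℂ (weightSpace V mu) ≤ 1) :
    ∃ v ∈ weightSpace V mu, ∀ x ∈ weightSpace V mu, ∃ c : ℂ, x = c • v := by
  obtain ⟨v, hv⟩ := rank_le_one_iff.mp hr
  refine ⟨v, v.2, fun x hx => ?_⟩
  obtain ⟨c, hc⟩ := hv ⟨x, hx⟩
  exact ⟨c, (congrArg Subtype.val hc).symm⟩

/-- When the target generator is 0 any vector would serve; fixing G = 0 in that case is what later
lets a vanishing weight space contradict the relations. -/
theorem exists_structure_constants {k p : ℤ × ℤ} {lam : ℂ × ℂ} {v v' : V}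
    (hv : v ∈ weightSpace V (wt lam k))
    (hv' : ∀ x ∈ weightSpace V (wt lam (k + p)), ∃ c : ℂ, x = c • v') :
    ∃ G : ℂ × ℂ, (∀ a, ⁅evenDer p a, v⁆ = pairing a G • v') ∧ (v' = 0 → G = 0) := by
  by_cases h0 : v' = 0
  · refine ⟨0, fun a => ?_, fun _ => rfl⟩
    obtain ⟨c, hc⟩ := hv' _ (by rw [wt_add]; exact lie_mem_weightSpace (evenDer_mem p a) hv)
    rw [hc, h0, smul_zero, smul_zero]
  · have H : ∀ a, ∃ c : ℂ, ⁅evenDer p a, v⁆ = c • v' := fun a =>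
      hv' _ (by rw [wt_add]; exact lie_mem_weightSpace (evenDer_mem p a) hv)
    obtain ⟨c₁, h₁⟩ := H (1, 0)
    obtain ⟨c₂, h₂⟩ := H (0, 1)
    refine ⟨(c₁, c₂), fun a => ?_, fun h => absurd h h0⟩
    have e : a = a.1 • ((1, 0) : ℂ × ℂ) + a.2 • ((0, 1) : ℂ × ℂ) := by ext <;> simp
    conv_lhs => rw [e]
    rw [evenDer_add, add_lie, evenDer_smul, evenDer_smul, smul_lie, smul_lie, h₁, h₂, smul_smul,
      smul_smul, ← add_smul]
    rfl

/-- A coset of `2ℤ²` in the weights of a module with weight multiplicities at most one, containing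
a nonzero weight, carries a basis on which `W` acts as on tensor densities, away from the
weight `0`. -/
theorem exists_density_basis (hr : ∀ mu, Module.rank ℂ (weightSpace V mu) ≤ 1) (lam : ℂ × ℂ)
    (k₀ : ℤ × ℤ) (hk₀ : wt lam k₀ ≠ 0) (hne : weightSpace V (wt lam k₀) ≠ ⊥) :
    ∃ (b : ℂ) (w : ℤ × ℤ → V), ∀ k, wt lam k ≠ 0 → w k ≠ 0 ∧ w k ∈ weightSpace V (wt lam k) ∧
      ∀ p a, wt lam (k + p) ≠ 0 →
        ⁅evenDer p a, w k⁆ = pairing a (wt lam k + b • dbl p) • w (k + p) := by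
  choose v hv hgen using fun k => exists_generator (hr (wt lam k))
  choose g hg hg0 using fun p k => exists_structure_constants (p := p) (hv k) (hgen (k + p))
  have rel : ∀ p r k, v (k + p + r) ≠ 0 → ∀ a b,
      pairing a (g p (k + r)) * pairing b (g r k) - pairing b (g r (k + p)) * pairing a (g p k) =
      pairing a (dbl r) * pairing b (g (p + r) k) - pairing b (dbl p) * pairing a (g (p + r) k) := by
    intro p r k h a b
    have e : k + r + p = k + p + r := by abel
    have e' : k + (p + r) = k + p + r := by abel
    have t := leibniz_lie (evenDer p a) (evenDer r b) (v k)
    rw [lie_evenDer_evenDer, hg, hg, hg, lie_smul, lie_smul, hg, hg, smul_smul, smul_smul, e, e',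
      ← add_smul] at t
    have t' := smul_left_injective ℂ h t
    simp only [pairing, Prod.fst_sub, Prod.snd_sub, Prod.smul_fst, Prod.smul_snd, smul_eq_mul]
      at t' ⊢
    linear_combination t'
  have zero : ∀ k, v k ≠ 0 → g 0 k = wt lam k := by
    intro k h
    apply pairing_ext
    intro a
    have t := hg 0 k a
    rw [mem_weightSpace.mp (hv k) a, add_zero] at t
    exact (smul_left_injective ℂ h t).symm
  -- If the target vanished, `g p k` would be 0 and the relation for p and -p would equate a rank
  -- one tensor with minus the symmetric product of 2p and the weight, which has rank two when they
  -- are independent.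
  have step : ∀ k p, v k ≠ 0 → symp (dbl p) (wt lam k) ≠ 0 → v (k + p) ≠ 0 := by
    intro k p hk hpk h
    have t := rel p (-p) k (by rwa [add_neg_cancel_right])
    rw [hg0 p k h, add_neg_cancel, zero k hk, dbl_neg] at t
    simp only [pairing_zero_right, mul_zero, sub_zero, pairing_neg_right] at t
    obtain ⟨b, hb⟩ := exists_pairing_ne_zero (left_ne_zero_of_symp hpk)
    have t1 := t (rot (dbl p)) b
    have t2 := t (rot (dbl p)) (rot (dbl p))
    have t3 := t b (rot (dbl p))
    simp only [pairing_rot, symp_self] at t1 t2 t3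
    have t2' : symp (dbl p) (g p (k + -p)) * symp (dbl p) (g (-p) k) = 0 := by
      linear_combination t2
    rcases mul_eq_zero.mp t2' with h0 | h0
    · rw [h0] at t1
      apply mul_ne_zero hb hpk
      linear_combination t1
    · rw [h0] at t3
      apply mul_ne_zero hb hpk
      linear_combination t3
  have hv0 : v k₀ ≠ 0 := by
    intro h
    apply hne
    rw [eq_bot_iff]
    intro x hx
    obtain ⟨c, hc⟩ := hgen k₀ x hx
    rw [hc, h, smul_zero]
    exact zero_mem _
  have full : ∀ k, wt lam k ≠ 0 → v k ≠ 0 := by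
    intro k hk
    -- Every nonzero weight of the coset is reached from k₀ in two transverse steps through a
    -- generic intermediate point, even if it is collinear with the weight at k₀.
    obtain ⟨p, h1, h2⟩ := ((eventually_affine_ne_zero (c := 0) (Or.inr hk₀)).and
      (eventually_affine_ne_zero (c := symp (dbl (k - k₀)) (wt lam k₀)) (w := -wt lam k)
        (Or.inr (neg_ne_zero.mpr hk)))).exists
    rw [zero_add] at h1
    have h3 := step _ _ hv0 h1
    have e : k₀ + p + (k - k₀ - p) = k := by abel
    rw [← e]
    apply step _ _ h3
    convert h2 using 1
    have e2 : wt lam k = wt lam k₀ + dbl (k - k₀) := by rw [← wt_add, add_sub_cancel]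
    rw [dbl_sub (k - k₀) p, wt_add, e2]
    simp only [symp_sub_left, symp_add_right, symp_self, symp_neg_right]
    rw [symp_swap (dbl (k - k₀)) (dbl p)]
    ring
  have hrel : StructureRel lam g :=
    ⟨fun k hk => zero k (full k hk), fun p r k _ _ _ h => rel p r k (full _ h)⟩
  obtain ⟨σ, hσ, hn⟩ := hrel.exists_normalizedRel k₀ hk₀
  obtain ⟨b, hb⟩ := hn.exists_eq
  refine ⟨b, fun k => σ k • v k, fun k hk => ⟨smul_ne_zero (hσ k) (full k hk),
    Submodule.smul_mem _ _ (hv k), fun p a hp => ?_⟩⟩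
  have t := congrArg (pairing a) (hb p k hk hp)
  simp only [pairing_smul_right] at t
  rw [lie_smul, hg, ← t, smul_smul, smul_smul]
  congr 1
  have := hσ (k + p)
  field_simp

end WittModules
end

/-! ### Submodules determined by their nonzero weights -/

noncomputable section

open QTorus Filter

/-- The weights `lam + k`. -/
def latWt (lam : ℂ × ℂ) (k : ℤ × ℤ) : ℂ × ℂ := lam + toC k

theorem latWt_add (lam : ℂ × ℂ) (k d : ℤ × ℤ) : latWt lam (k + d) = latWt lam k + toC d := by
  rw [latWt, latWt, toC_add, add_assoc]

theorem latWt_injective (lam : ℂ × ℂ) : Function.Injective (latWt lam) := by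
  intro k l h
  exact toC_injective (add_left_cancel h)

section Modules

variable {M : Type*} [AddCommGroup M] [Module ℂ M] [LieRingModule DerCq M] [LieModule ℂ DerCq M]

theorem forall_lie_mem_of_derGrade {P P' : Submodule ℂ M}
    (h : ∀ d, ∀ X ∈ derGrade d, ∀ x ∈ P, ⁅X, x⁆ ∈ P') (X : DerCq) {x : M} (hx : x ∈ P) :
    ⁅X, x⁆ ∈ P' := by
  have := der_span_derGrade
    { carrier := {X | ∀ x ∈ P, ⁅X, x⁆ ∈ P'}
      add_mem' := fun hX hY x hx => by rw [add_lie]; exact add_mem (hX x hx) (hY x hx)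
      zero_mem' := fun x _ => by rw [zero_lie]; exact zero_mem _
      smul_mem' := fun c X hX x hx => by rw [smul_lie]; exact P'.smul_mem _ (hX x hx) }
    (fun d X hX => h d X hX) X
  exact this x hx

/-- Weight vectors `u k` of weights `lam + k ≠ 0` that the homogeneous derivations permute up to
scalars, as long as the weight `0` is not met, span a submodule together with vectors of
weight `0`. -/
theorem exists_lieSubmodule_of_weightVectors {lam : ℂ × ℂ} {u : ℤ × ℤ → M}
    (hu : ∀ k, latWt lam k ≠ 0 → u k ∈ weightSpace M (latWt lam k))
    (hX : ∀ k d X, latWt lam k ≠ 0 → latWt lam (k + d) ≠ 0 → X ∈ derGrade d →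
      ∃ c : ℂ, ⁅X, u k⁆ = c • u (k + d)) :
    ∃ R : LieSubmodule ℂ DerCq M, (∀ k, latWt lam k ≠ 0 → u k ∈ R) ∧
      ∀ P : Submodule ℂ M, (∀ k, latWt lam k ≠ 0 → u k ∈ P) → weightSpace M 0 ≤ P →
        R.toSubmodule ≤ P := by
  -- The submodule is N + Z: N is spanned by the given vectors, and Z by their images in weight 0,
  -- about which nothing is assumed.
  obtain ⟨N, hN⟩ : ∃ N, N = Submodule.span ℂ {x | ∃ k, latWt lam k ≠ 0 ∧ x = u k} := ⟨_, rfl⟩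
  obtain ⟨Z, hZ⟩ : ∃ Z, Z = Submodule.span ℂ {x | ∃ k d X, latWt lam k ≠ 0 ∧
    latWt lam (k + d) = 0 ∧ X ∈ derGrade d ∧ x = ⁅X, u k⁆} := ⟨_, rfl⟩
  have memN : ∀ k, latWt lam k ≠ 0 → u k ∈ N := fun k hk => by
    rw [hN]; exact Submodule.subset_span ⟨k, hk, rfl⟩
  have memZ : ∀ k d X, latWt lam k ≠ 0 → latWt lam (k + d) = 0 → X ∈ derGrade d →
      ⁅X, u k⁆ ∈ Z := fun k d X h1 h2 h3 => by
    rw [hZ]; exact Submodule.subset_span ⟨k, d, X, h1, h2, h3, rfl⟩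
  -- For e ≠ d, applying Y first does not land in weight 0, so Y X u = [Y, X] u + X Y u is computed
  -- by the hypothesis.
  have key : ∀ k d X e Y, latWt lam k ≠ 0 → latWt lam (k + d) = 0 → X ∈ derGrade d →
      e ≠ 0 → e ≠ d → Y ∈ derGrade e → ∃ c : ℂ, ⁅Y, ⁅X, u k⁆⁆ = c • u (k + d + e) := by
    intro k d X e Y hk hd hXd he hed hY
    have h1 : latWt lam (k + e) ≠ 0 := by
      intro h
      exact hed (add_left_cancel (latWt_injective lam (h.trans hd.symm)))
    have h2 : latWt lam (k + d + e) ≠ 0 := by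
      rw [latWt_add, hd, zero_add]
      exact fun h => he (toC_eq_zero.mp h)
    have e1 : k + (e + d) = k + d + e := by abel
    have e2 : k + e + d = k + d + e := by abel
    obtain ⟨c₁, hc₁⟩ := hX k e Y hk h1 hY
    obtain ⟨c₂, hc₂⟩ := hX (k + e) d X h1 (by rwa [e2]) hXd
    obtain ⟨c₃, hc₃⟩ := hX k (e + d) ⁅Y, X⁆ hk (by rwa [e1]) (lie_mem_derGrade hY hXd)
    refine ⟨c₃ + c₁ * c₂, ?_⟩
    rw [leibniz_lie, hc₁, lie_smul, hc₂, hc₃, e1, e2, smul_smul, add_smul]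
  have lieN : ∀ d, ∀ X ∈ derGrade d, ∀ x ∈ N, ⁅X, x⁆ ∈ N ⊔ Z := by
    intro d X hXd x hx
    rw [hN] at hx
    induction hx using Submodule.span_induction with
    | zero => rw [lie_zero]; exact zero_mem _
    | add x y _ _ hx hy => rw [lie_add]; exact add_mem hx hy
    | smul c x _ hx => rw [lie_smul]; exact Submodule.smul_mem _ _ hx
    | mem x hx =>
      obtain ⟨k, hk, rfl⟩ := hx
      by_cases h0 : latWt lam (k + d) = 0
      · exact Submodule.mem_sup_right (memZ k d X hk h0 hXd)
      · obtain ⟨c, hc⟩ := hX k d X hk h0 hXd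
        rw [hc]
        exact Submodule.mem_sup_left (N.smul_mem _ (memN _ h0))
  have lieZ : ∀ d, ∀ X ∈ derGrade d, ∀ x ∈ Z, ⁅X, x⁆ ∈ N ⊔ Z := by
    intro e Y hY x hx
    rw [hZ] at hx
    induction hx using Submodule.span_induction with
    | zero => rw [lie_zero]; exact zero_mem _
    | add x y _ _ hx hy => rw [lie_add]; exact add_mem hx hy
    | smul c x _ hx => rw [lie_smul]; exact Submodule.smul_mem _ _ hx
    | mem x hx =>
      obtain ⟨k, d, X, hk, hd, hXd, rfl⟩ := hx
      have target : ∀ e, e ≠ 0 → latWt lam (k + d + e) ≠ 0 := by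
        intro e he
        rw [latWt_add, hd, zero_add]
        exact fun h => he (toC_eq_zero.mp h)
      by_cases he : e = 0
      · subst he
        obtain ⟨c, hc⟩ := hX k 0 Y hk (by rwa [add_zero]) hY
        rw [add_zero] at hc
        rw [leibniz_lie, hc, lie_smul]
        have := lie_mem_derGrade hY hXd
        rw [zero_add] at this
        exact Submodule.mem_sup_right (add_mem (memZ k d _ hk hd this)
          (Z.smul_mem _ (memZ k d X hk hd hXd)))
      by_cases hed : e = d
      -- When Y has the same degree as X both orders meet weight 0. Here Y is replaced by brackets
      -- of derivations of degrees other than 0 and d, to each of which `key` applies.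
      · subst hed
        have hY' := derGrade_le_span_lie he hY
        apply Submodule.mem_sup_left
        clear hY
        induction hY' using Submodule.span_induction with
        | zero => rw [zero_lie]; exact zero_mem _
        | add x y _ _ hx hy => rw [add_lie]; exact add_mem hx hy
        | smul c x _ hx => rw [smul_lie]; exact Submodule.smul_mem _ _ hx
        | mem Y hY =>
          obtain ⟨d₁, d₂, X₁, X₂, rfl, h1, h2, hX₁, hX₂, rfl⟩ := hY
          have h1' : d₁ ≠ d₁ + d₂ := fun h => h2 (by simpa using h)
          have h2' : d₂ ≠ d₁ + d₂ := fun h => h1 (by simpa using h)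
          have aux : ∀ a b (A B : DerCq), a ≠ 0 → b ≠ 0 → b ≠ d₁ + d₂ → a + b = d₁ + d₂ →
              A ∈ derGrade a → B ∈ derGrade b → ⁅A, ⁅B, ⁅X, u k⁆⁆⁆ ∈ N := by
            intro a b A B ha hb hb' hab hA hB
            obtain ⟨c, hc⟩ := key k _ X b B hk hd hXd hb hb' hB
            have e1 : k + (d₁ + d₂) + b + a = k + (d₁ + d₂) + (d₁ + d₂) := by rw [← hab]; abel
            obtain ⟨c', hc'⟩ := hX (k + (d₁ + d₂) + b) a A (target b hb)
              (by rw [e1]; exact target _ he) hA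
            rw [hc, lie_smul, hc', e1]
            exact N.smul_mem _ (N.smul_mem _ (memN _ (target _ he)))
          rw [lie_lie]
          exact sub_mem (aux d₁ d₂ X₁ X₂ h1 h2 h2' rfl hX₁ hX₂)
            (aux d₂ d₁ X₂ X₁ h2 h1 h1' (add_comm _ _) hX₂ hX₁)
      · obtain ⟨c, hc⟩ := key k d X e Y hk hd hXd he hed hY
        rw [hc]
        exact Submodule.mem_sup_left (N.smul_mem _ (memN _ (target e he)))
  have lieNZ : ∀ d, ∀ X ∈ derGrade d, ∀ x ∈ N ⊔ Z, ⁅X, x⁆ ∈ N ⊔ Z := by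
    intro d X hXd x hx
    obtain ⟨y, hy, z, hz, rfl⟩ := Submodule.mem_sup.mp hx
    rw [lie_add]
    exact add_mem (lieN d X hXd y hy) (lieZ d X hXd z hz)
  refine ⟨{ N ⊔ Z with lie_mem := fun {X x} hx => forall_lie_mem_of_derGrade lieNZ X hx },
    fun k hk => Submodule.mem_sup_left (memN k hk), fun P h1 h2 => ?_⟩
  change N ⊔ Z ≤ P
  rw [sup_le_iff]
  constructor
  · rw [hN, Submodule.span_le]
    rintro x ⟨k, hk, rfl⟩
    exact h1 k hk
  · rw [hZ, Submodule.span_le]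
    rintro x ⟨k, d, X, hk, hd, hXd, rfl⟩
    apply h2
    rw [← hd, latWt_add]
    exact lie_mem_weightSpace hXd (hu k hk)

/-- Independence of the weight spaces keeps x out of the sum of the others, so a functional
separates it from them. It plays the role of a coordinate along x. -/
theorem exists_weight_functional (hM : DirectSum.IsInternal (weightSpace M)) {mu : ℂ × ℂ} {x : M}
    (hx : x ∈ weightSpace M mu) (hx0 : x ≠ 0) :
    ∃ f : M →ₗ[ℂ] ℂ, f x = 1 ∧ ∀ nu ≠ mu, ∀ y ∈ weightSpace M nu, f y = 0 := by
  have hd := hM.submodule_iSupIndep mu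
  have hn : x ∉ ⨆ j, ⨆ (_ : j ≠ mu), weightSpace M j := by
    intro h
    exact hx0 ((Submodule.disjoint_def.mp hd) x hx h)
  obtain ⟨f, hf, hle⟩ := Submodule.exists_le_ker_of_notMem hn
  refine ⟨(f x)⁻¹ • f, ?_, fun nu hnu y hy => ?_⟩
  · rw [LinearMap.smul_apply, smul_eq_mul, inv_mul_cancel₀ hf]
  · have : y ∈ LinearMap.ker f := hle (le_iSup₂_of_le (f := fun j (_ : j ≠ mu) => weightSpace M j)
      nu hnu le_rfl hy)
    rw [LinearMap.smul_apply, LinearMap.mem_ker.mp this, smul_zero]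

end Modules

/-! ### Graphs in V × M and the comparison of modules -/

section Correspondence

variable {V M : Type*} [AddCommGroup V] [Module ℂ V] [LieRingModule DerCq V] [LieModule ℂ DerCq V]
  [AddCommGroup M] [Module ℂ M] [LieRingModule DerCq M] [LieModule ℂ DerCq M]

instance : LieRingModule DerCq (V × M) where
  bracket d x := (⁅d, x.1⁆, ⁅d, x.2⁆)
  add_lie _ _ _ := Prod.ext (add_lie _ _ _) (add_lie _ _ _)
  lie_add _ _ _ := Prod.ext (lie_add _ _ _) (lie_add _ _ _)
  leibniz_lie _ _ _ := Prod.ext (leibniz_lie _ _ _) (leibniz_lie _ _ _)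

instance : LieModule ℂ DerCq (V × M) where
  smul_lie _ _ _ := Prod.ext (smul_lie _ _ _) (smul_lie _ _ _)
  lie_smul _ _ _ := Prod.ext (lie_smul _ _ _) (lie_smul _ _ _)

theorem lie_prod (d : DerCq) (x : V) (y : M) : ⁅d, (x, y)⁆ = (⁅d, x⁆, ⁅d, y⁆) := rfl

theorem mem_weightSpace_prod {mu : ℂ × ℂ} {x : V} {y : M} :
    (x, y) ∈ weightSpace (V × M) mu ↔ x ∈ weightSpace V mu ∧ y ∈ weightSpace M mu := by
  simp only [mem_weightSpace, lie_prod, Prod.smul_mk, Prod.mk.injEq, forall_and]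

/-- A submodule of `V × M` that is the graph of a map from a submodule of `M` onto `V`. -/
theorem exists_hom_of_correspondence (R : LieSubmodule ℂ DerCq (V × M))
    (h0 : ∀ x, (x, 0) ∈ R → x = 0) (h1 : ∀ x, ∃ y, (x, y) ∈ R) :
    ∃ (Q : LieSubmodule ℂ DerCq M) (φ : Q →ₗ⁅ℂ, DerCq⁆ V), Function.Surjective φ ∧
      (∀ y, y ∈ Q ↔ ∃ x, (x, y) ∈ R) ∧ ∀ y : Q, (φ y, (y : M)) ∈ R := by
  let Q : LieSubmodule ℂ DerCq M :=
    { carrier := {y | ∃ x, (x, y) ∈ R}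
      add_mem' := by
        rintro y y' ⟨x, hx⟩ ⟨x', hx'⟩
        exact ⟨x + x', add_mem hx hx'⟩
      zero_mem' := ⟨0, zero_mem R⟩
      smul_mem' := by
        rintro c y ⟨x, hx⟩
        exact ⟨c • x, R.smul_mem c hx⟩
      lie_mem := by
        rintro d y ⟨x, hx⟩
        exact ⟨⁅d, x⁆, R.lie_mem hx⟩ }
  choose f hf using fun y : Q => y.2
  have uniq : ∀ x x' y, (x, y) ∈ R → (x', y) ∈ R → x = x' := by
    intro x x' y hx hx'
    have := sub_mem hx hx'
    rw [Prod.mk_sub_mk, sub_self] at this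
    exact sub_eq_zero.mp (h0 _ this)
  refine ⟨Q, { toFun := f, map_add' := ?_, map_smul' := ?_, map_lie' := ?_ }, ?_, fun y => Iff.rfl,
    hf⟩
  · intro y y'
    exact uniq _ _ _ (hf _) (add_mem (hf y) (hf y'))
  · intro c y
    exact uniq _ _ _ (hf _) (R.smul_mem c (hf y))
  · intro d y
    exact uniq _ _ _ (hf _) (R.lie_mem (x := d) (hf y))
  · intro x
    obtain ⟨y, hy⟩ := h1 x
    exact ⟨⟨y, ⟨x, hy⟩⟩, uniq _ _ _ (hf ⟨y, ⟨x, hy⟩⟩) hy⟩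

theorem isSubquotient_of_surjective {Q : LieSubmodule ℂ DerCq M} (φ : Q →ₗ⁅ℂ, DerCq⁆ V)
    (hφ : Function.Surjective φ) : IsSubquotient V M := by
  let e : (Q ⧸ φ.ker) ≃ₗ[ℂ] V := (φ : Q →ₗ[ℂ] V).quotKerEquivOfSurjective hφ
  have he : ∀ y : Q, e (LieSubmodule.Quotient.mk' φ.ker y) = φ y := fun y => rfl
  have hlie : ∀ (d : DerCq) (x : Q ⧸ φ.ker), e ⁅d, x⁆ = ⁅d, e x⁆ := by
    intro d x
    obtain ⟨y, rfl⟩ := LieSubmodule.Quotient.surjective_mk' φ.ker x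
    rw [← LieModuleHom.map_lie, he, he, LieModuleHom.map_lie]
  refine ⟨Q, φ.ker, ⟨{
    toFun := e.symm
    map_add' := e.symm.map_add
    map_smul' := e.symm.map_smul
    map_lie' := ?_
    invFun := e
    left_inv := e.right_inv
    right_inv := e.left_inv }⟩⟩
  intro d x
  apply e.injective
  refine (e.apply_symm_apply _).trans ?_
  rw [hlie]
  exact congrArg (fun y => ⁅d, y⁆) (e.apply_symm_apply x).symm

theorem nonempty_equiv_of_bijective (φ : M →ₗ⁅ℂ, DerCq⁆ V) (hφ : Function.Bijective φ) :
    Nonempty (V ≃ₗ⁅ℂ, DerCq⁆ M) := by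
  let e : M ≃ₗ[ℂ] V := LinearEquiv.ofBijective (φ : M →ₗ[ℂ] V) hφ
  refine ⟨{
    toFun := e.symm
    map_add' := e.symm.map_add
    map_smul' := e.symm.map_smul
    map_lie' := ?_
    invFun := e
    left_inv := e.right_inv
    right_inv := e.left_inv }⟩
  intro d x
  apply e.injective
  refine (e.apply_symm_apply _).trans ?_
  refine Eq.trans ?_ (φ.map_lie d (e.symm x)).symm
  exact congrArg (fun y => ⁅d, y⁆) (e.apply_symm_apply x).symm

/-- An irreducible module `V` and a module `M` with matching families of weight vectors of
nonzero weights: `V` is a quotient of a submodule of `M`. -/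
theorem exists_hom_of_matching (hirr : LieModule.IsIrreducible ℂ DerCq V)
    (hV : DirectSum.IsInternal (weightSpace V)) {lam : ℂ × ℂ} {w : ℤ × ℤ → V} {v : ℤ × ℤ → M}
    {f : ℤ × ℤ → M →ₗ[ℂ] ℂ}
    (hw : ∀ k, latWt lam k ≠ 0 → w k ∈ weightSpace V (latWt lam k))
    (hv : ∀ k, latWt lam k ≠ 0 → v k ∈ weightSpace M (latWt lam k))
    (hX : ∀ k d X, latWt lam k ≠ 0 → latWt lam (k + d) ≠ 0 → X ∈ derGrade d →
      ∃ c : ℂ, ⁅X, w k⁆ = c • w (k + d) ∧ ⁅X, v k⁆ = c • v (k + d))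
    (hf : ∀ k, w k ≠ 0 → f k (v k) = 1)
    (hf0 : ∀ k, ∀ nu ≠ latWt lam k, ∀ y ∈ weightSpace M nu, f k y = 0)
    (k₁ : ℤ × ℤ) (hk₁ : latWt lam k₁ ≠ 0) (hwk₁ : w k₁ ≠ 0) :
    ∃ (Q : LieSubmodule ℂ DerCq M) (φ : Q →ₗ⁅ℂ, DerCq⁆ V), Function.Surjective φ ∧
      (∀ k, latWt lam k ≠ 0 → v k ∈ Q) ∧
      ∀ y : Q, φ y = 0 → ∀ k, latWt lam k ≠ 0 → w k ≠ 0 → f k y = 0 := by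
  obtain ⟨R, hR, hRle⟩ := exists_lieSubmodule_of_weightVectors (M := V × M) (lam := lam)
    (u := fun k => (w k, v k)) (fun k hk => mem_weightSpace_prod.mpr ⟨hw k hk, hv k hk⟩)
    (by
      intro k d X hk hd hXd
      obtain ⟨c, h1, h2⟩ := hX k d X hk hd hXd
      exact ⟨c, Prod.ext h1 h2⟩)
  -- The coordinates along w k in V and along v k in M agree on every generating pair, and both
  -- vanish in weight 0; hence they agree on the whole of R.
  have hπ : ∀ k, latWt lam k ≠ 0 → w k ≠ 0 → ∃ π : V →ₗ[ℂ] ℂ, π (w k) = 1 ∧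
      ∀ x y, (x, y) ∈ R → π x = f k y := by
    intro k hk hwk
    obtain ⟨π, h1, h2⟩ := exists_weight_functional hV (hw k hk) hwk
    refine ⟨π, h1, fun x y hxy => ?_⟩
    have hle := hRle (LinearMap.ker (π ∘ₗ LinearMap.fst ℂ V M - f k ∘ₗ LinearMap.snd ℂ V M)) ?_ ?_
    · have := LinearMap.mem_ker.mp (hle hxy)
      exact sub_eq_zero.mp this
    · intro l hl
      rw [LinearMap.mem_ker]
      change π (w l) - f k (v l) = 0
      by_cases hlk : l = k
      · subst hlk; rw [h1, hf l hwk, sub_self]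
      · have hne : latWt lam l ≠ latWt lam k := fun h => hlk (latWt_injective lam h)
        rw [h2 _ hne _ (hw l hl), hf0 k _ hne _ (hv l hl), sub_self]
    · rintro ⟨x', y'⟩ hxy'
      obtain ⟨hx', hy'⟩ := mem_weightSpace_prod.mp hxy'
      rw [LinearMap.mem_ker]
      change π x' - f k y' = 0
      rw [h2 _ hk.symm _ hx', hf0 k _ hk.symm _ hy', sub_self]
  -- The part of R inside V × 0 is a submodule of V. It cannot be all of V, since the coordinate
  -- along w k₁ vanishes on it.
  have h0 : ∀ x, (x, 0) ∈ R → x = 0 := by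
    let K : LieSubmodule ℂ DerCq V :=
      { carrier := {x | (x, (0 : M)) ∈ R}
        add_mem' := by
          intro x x' hx hx'
          have := add_mem (S := LieSubmodule ℂ DerCq (V × M)) (s := R) hx hx'
          rwa [Prod.mk_add_mk, add_zero] at this
        zero_mem' := zero_mem R
        smul_mem' := by
          intro c x hx
          have := R.smul_mem c hx
          rwa [Prod.smul_mk, smul_zero] at this
        lie_mem := by
          intro d x hx
          have := R.lie_mem (x := d) hx
          rwa [lie_prod, lie_zero] at this }
    rcases hirr.eq_bot_or_eq_top K with hK | hK
    · intro x hx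
      have : x ∈ K := hx
      rwa [hK, LieSubmodule.mem_bot] at this
    · exfalso
      have : w k₁ ∈ K := by rw [hK]; exact LieSubmodule.mem_top _
      obtain ⟨π, h1, h2⟩ := hπ k₁ hk₁ hwk₁
      have h3 := h2 _ _ this
      rw [h1, map_zero] at h3
      exact one_ne_zero h3
  -- The projection of R to V contains w k₁ ≠ 0, so by irreducibility it is onto.
  have h1 : ∀ x, ∃ y, (x, y) ∈ R := by
    let K : LieSubmodule ℂ DerCq V :=
      { carrier := {x | ∃ y, (x, y) ∈ R}
        add_mem' := by
          rintro x x' ⟨y, hy⟩ ⟨y', hy'⟩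
          exact ⟨y + y', add_mem hy hy'⟩
        zero_mem' := ⟨0, zero_mem R⟩
        smul_mem' := by
          rintro c x ⟨y, hy⟩
          exact ⟨c • y, R.smul_mem c hy⟩
        lie_mem := by
          rintro d x ⟨y, hy⟩
          exact ⟨⁅d, y⁆, R.lie_mem hy⟩ }
    rcases hirr.eq_bot_or_eq_top K with hK | hK
    · exfalso
      have : w k₁ ∈ K := ⟨v k₁, hR k₁ hk₁⟩
      rw [hK, LieSubmodule.mem_bot] at this
      exact hwk₁ this
    · intro x
      have : x ∈ K := by rw [hK]; exact LieSubmodule.mem_top _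
      exact this
  obtain ⟨Q, φ, hφ, hQ, hφR⟩ := exists_hom_of_correspondence R h0 h1
  refine ⟨Q, φ, hφ, fun k hk => (hQ _).mpr ⟨_, hR k hk⟩, fun y hy k hk hwk => ?_⟩
  obtain ⟨π, _, h2⟩ := hπ k hk hwk
  rw [← h2 _ _ (hφR y), hy, map_zero]

end Correspondence
end

/-! ### Classes modulo 2ℤ² and the structure constants of the inner derivations -/

noncomputable section

open QTorus Filter

/-- The class of `k` in `ℤ² / 2ℤ²`. -/
def parity (k : ℤ × ℤ) : ZMod 2 × ZMod 2 := ((k.1 : ZMod 2), (k.2 : ZMod 2))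

theorem parity_add (k l : ℤ × ℤ) : parity (k + l) = parity k + parity l := by
  simp [parity]

@[simp] theorem parity_add_self (p : ℤ × ℤ) : parity (p + p) = 0 := by
  rw [parity_add]
  exact CharTwo.add_self_eq_zero _

theorem parity_eq_zero {k : ℤ × ℤ} : parity k = 0 ↔ InTwo k := by
  simp only [parity, Prod.mk_eq_zero, ZMod.intCast_eq_zero_iff_even, InTwo]

theorem parity_eq_iff {k l : ℤ × ℤ} : parity k = parity l ↔ ∃ p, l = k + (p + p) := by
  constructor
  · intro h
    have h1 : parity (l - k) = 0 := by
      have : parity (l - k + k) = parity k := by rw [sub_add_cancel, h]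
      rw [parity_add] at this
      simpa using this
    obtain ⟨p, hp⟩ := exists_add_self (parity_eq_zero.mp h1)
    exact ⟨p, by rw [← hp]; abel⟩
  · rintro ⟨p, rfl⟩
    rw [parity_add, parity_add_self, add_zero]

theorem exists_parity_eq (j : ZMod 2 × ZMod 2) : ∃ k, parity k = j :=
  ⟨((j.1.val : ℤ), (j.2.val : ℤ)), by simp [parity]⟩

theorem latWt_add_self (lam : ℂ × ℂ) (k p : ℤ × ℤ) :
    latWt lam (k + (p + p)) = wt (latWt lam k) p := by
  rw [latWt_add, wt, dbl]

theorem latWt_add_dbl (lam : ℂ × ℂ) (k p : ℤ × ℤ) :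
    latWt lam (k + (p + p)) = latWt lam k + dbl p := latWt_add _ _ _

theorem eventually_latWt_ne_zero (lam : ℂ × ℂ) (k : ℤ × ℤ) :
    ∀ᶠ p in genericFilter, latWt lam (k + (p + p)) ≠ 0 := by
  have h := eventually_symp_wt' (lam := latWt lam k) (v := (1, 0)) (by simp)
  filter_upwards [h] with p hp
  rw [latWt_add_self]
  exact left_ne_zero_of_symp hp

theorem exists_parity_eq_latWt_ne_zero (lam : ℂ × ℂ) (j : ZMod 2 × ZMod 2) :
    ∃ k, parity k = j ∧ latWt lam k ≠ 0 := by
  obtain ⟨k, rfl⟩ := exists_parity_eq j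
  obtain ⟨p, hp⟩ := (eventually_latWt_ne_zero lam k).exists
  exact ⟨_, by rw [parity_add, parity_add_self, add_zero], hp⟩

/-- The structure constants of a module of the intermediate series away from the weight `0`:
`adMono m` maps the basis vector of weight `lam + k` to `e m k` times that of weight `lam + k + m`,
and `W` acts as on tensor densities of parameter `b` on each coset of `2ℤ²` in `T`. -/
structure AdConstants (lam : ℂ × ℂ) (T : ZMod 2 × ZMod 2 → Prop) (b : ZMod 2 × ZMod 2 → ℂ)
    (e : ℤ × ℤ → ℤ × ℤ → ℂ) : Prop where
  even : ∀ p k, e (p + p) k = 0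
  supp : ∀ m k, e m k ≠ 0 → T (parity k) ∧ T (parity (k + m))
  relW : ∀ m k p a, latWt lam k ≠ 0 → latWt lam (k + m) ≠ 0 → latWt lam (k + (p + p)) ≠ 0 →
    latWt lam (k + m + (p + p)) ≠ 0 →
    pairing a (latWt lam (k + m) + b (parity (k + m)) • dbl p) * e m k -
      pairing a (latWt lam k + b (parity k) • dbl p) * e m (k + (p + p)) =
      pairing a (toC m) * e (m + (p + p)) k
  relE : ∀ m l k, latWt lam k ≠ 0 → latWt lam (k + m) ≠ 0 → latWt lam (k + l) ≠ 0 →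
    latWt lam (k + m + l) ≠ 0 →
    e m (k + l) * e l k - e l (k + m) * e m k = adSign m l * e (m + l) k
  conn : ∀ J : ZMod 2 × ZMod 2 → Prop, (∃ j, J j ∧ T j) →
    (∀ m k, latWt lam k ≠ 0 → latWt lam (k + m) ≠ 0 → J (parity k) → e m k ≠ 0 →
      J (parity (k + m))) → ∀ j, T j → J j

section

variable {V : Type*} [AddCommGroup V] [Module ℂ V] [LieRingModule DerCq V] [LieModule ℂ DerCq V]

theorem lie_mem_of_mem_derGrade {d : ℤ × ℤ} {x : V} {N : Submodule ℂ V} (h1 : ⁅adMono d, x⁆ ∈ N)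
    (h2 : ∀ p a, d = p + p → ⁅evenDer p a, x⁆ ∈ N) {X : DerCq} (hX : X ∈ derGrade d) :
    ⁅X, x⁆ ∈ N :=
  derGrade_induction
    { carrier := {X | ⁅X, x⁆ ∈ N}
      add_mem' := fun {X Y} (hX : ⁅X, x⁆ ∈ N) (hY : ⁅Y, x⁆ ∈ N) => by
        change ⁅X + Y, x⁆ ∈ N
        rw [add_lie]; exact add_mem hX hY
      zero_mem' := by
        change ⁅(0 : DerCq), x⁆ ∈ N
        rw [zero_lie]; exact zero_mem _
      smul_mem' := fun c X (hX : ⁅X, x⁆ ∈ N) => by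
        change ⁅c • X, x⁆ ∈ N
        rw [smul_lie]; exact N.smul_mem _ hX } h1 h2 hX

/-- A basis of the weight spaces of nonzero weight in `lam + ℤ²` in which `W` acts as on tensor
densities. -/
theorem exists_weight_basis (hr : ∀ mu, Module.rank ℂ (weightSpace V mu) ≤ 1) (lam : ℂ × ℂ) :
    ∃ (T : ZMod 2 × ZMod 2 → Prop) (b : ZMod 2 × ZMod 2 → ℂ) (w : ℤ × ℤ → V), ∀ k,
      latWt lam k ≠ 0 → w k ∈ weightSpace V (latWt lam k) ∧ (w k ≠ 0 ↔ T (parity k)) ∧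
        (¬ T (parity k) → weightSpace V (latWt lam k) = ⊥) ∧
        ∀ p a, latWt lam (k + (p + p)) ≠ 0 → ⁅evenDer p a, w k⁆ =
          pairing a (latWt lam k + b (parity k) • dbl p) • w (k + (p + p)) := by
  -- A class is counted as soon as one of its nonzero weights occurs; `exists_density_basis` then
  -- shows that all its nonzero weights occur.
  let T : ZMod 2 × ZMod 2 → Prop := fun j =>
    ∃ k, parity k = j ∧ latWt lam k ≠ 0 ∧ weightSpace V (latWt lam k) ≠ ⊥
  choose rep hrep using exists_parity_eq
  have hT : ∀ k, latWt lam k ≠ 0 → ¬ T (parity k) → weightSpace V (latWt lam k) = ⊥ := by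
    intro k hk h
    by_contra hne
    exact h ⟨k, rfl, hk, hne⟩
  have H : ∀ j, ∃ (b : ℂ) (w : ℤ × ℤ → V), ∀ p, wt (latWt lam (rep j)) p ≠ 0 →
      w p ∈ weightSpace V (wt (latWt lam (rep j)) p) ∧ (w p ≠ 0 ↔ T j) ∧
      ∀ q a, wt (latWt lam (rep j)) (p + q) ≠ 0 → ⁅evenDer q a, w p⁆ =
        pairing a (wt (latWt lam (rep j)) p + b • dbl q) • w (p + q) := by
    intro j
    by_cases hj : T j
    · have hj' := hj
      obtain ⟨k, hkj, hk, hne⟩ := hj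
      rw [← hrep j] at hkj
      obtain ⟨p, rfl⟩ := parity_eq_iff.mp hkj.symm
      rw [latWt_add_self] at hk hne
      obtain ⟨b, w, hw⟩ := exists_density_basis hr _ p hk hne
      exact ⟨b, w, fun q hq => ⟨(hw q hq).2.1, iff_of_true (hw q hq).1 hj', (hw q hq).2.2⟩⟩
    · refine ⟨0, 0, fun p _ => ⟨zero_mem _, by simp [hj], fun q a _ => by simp⟩⟩
  choose b w hw using H
  have hhalf : ∀ k, ∃ p, k = rep (parity k) + (p + p) := fun k => parity_eq_iff.mp (hrep _)
  choose half hh using hhalf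
  refine ⟨T, b, fun k => w (parity k) (half k), fun k hk => ?_⟩
  have hk' : wt (latWt lam (rep (parity k))) (half k) ≠ 0 := by
    rwa [← latWt_add_self, ← hh k]
  obtain ⟨h1, h2, h3⟩ := hw _ _ hk'
  rw [← latWt_add_self, ← hh k] at h1 h3
  refine ⟨h1, h2, hT k hk, fun p a hp => ?_⟩
  have e1 : parity (k + (p + p)) = parity k := by rw [parity_add, parity_add_self, add_zero]
  have e2 : half (k + (p + p)) = half k + p := by
    have h4 := hh (k + (p + p))
    rw [e1] at h4
    have h5 : (half (k + (p + p)) - (half k + p)) + (half (k + (p + p)) - (half k + p)) = 0 := by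
      have h6 := hh k
      have h7 : half (k + (p + p)) + half (k + (p + p)) = half k + p + (half k + p) := by
        apply add_left_cancel (a := rep (parity k))
        rw [← h4]
        conv_lhs => rw [h6]
        abel
      calc _ = half (k + (p + p)) + half (k + (p + p)) - (half k + p + (half k + p)) := by abel
        _ = 0 := by rw [h7, sub_self]
    exact sub_eq_zero.mp (add_self_eq_zero_iff.mp h5)
  dsimp only
  rw [e1, e2]
  apply h3
  rw [← e2, ← latWt_add_self]
  have h4 := hh (k + (p + p))
  rw [e1] at h4
  rwa [← h4]

/-- The structure constants of an irreducible module of the intermediate series. -/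
theorem exists_adConstants (hirr : LieModule.IsIrreducible ℂ DerCq V)
    (hV : IsIntermediateSeries V) (lam : ℂ × ℂ) :
    ∃ (T : ZMod 2 × ZMod 2 → Prop) (b : ZMod 2 × ZMod 2 → ℂ) (w : ℤ × ℤ → V)
      (e : ℤ × ℤ → ℤ × ℤ → ℂ), AdConstants lam T b e ∧ ∀ k, latWt lam k ≠ 0 →
        w k ∈ weightSpace V (latWt lam k) ∧ (w k ≠ 0 ↔ T (parity k)) ∧
        (¬ T (parity k) → weightSpace V (latWt lam k) = ⊥) ∧
        (∀ p a, latWt lam (k + (p + p)) ≠ 0 → ⁅evenDer p a, w k⁆ =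
          pairing a (latWt lam k + b (parity k) • dbl p) • w (k + (p + p))) ∧
        ∀ m, latWt lam (k + m) ≠ 0 → ⁅adMono m, w k⁆ = e m k • w (k + m) := by
  obtain ⟨T, b, w, hw⟩ := exists_weight_basis hV.rank_le_one lam
  have hgen : ∀ k, latWt lam k ≠ 0 → ∀ x ∈ weightSpace V (latWt lam k), ∃ c : ℂ, x = c • w k := by
    intro k hk x hx
    obtain ⟨h1, h2, h3, _⟩ := hw k hk
    by_cases hT : T (parity k)
    · obtain ⟨v, _, hv⟩ := exists_generator (hV.rank_le_one (latWt lam k))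
      obtain ⟨c, hc⟩ := hv _ h1
      obtain ⟨d, hd⟩ := hv _ hx
      have hc0 : c ≠ 0 := by
        rintro rfl
        rw [zero_smul] at hc
        exact h2.mpr hT hc
      exact ⟨d * c⁻¹, by rw [hc, smul_smul, mul_assoc, inv_mul_cancel₀ hc0, mul_one, hd]⟩
    · rw [h3 hT, Submodule.mem_bot] at hx
      exact ⟨0, by rw [hx, zero_smul]⟩
  -- The scalar is undetermined when the target vector is 0 or a weight is 0. It is set to 0
  -- whenever the action vanishes or weight 0 is involved, so that a nonzero constant really
  -- witnesses an action between occurring classes.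
  have hE : ∀ m k, ∃ c : ℂ, (latWt lam k ≠ 0 → latWt lam (k + m) ≠ 0 →
      ⁅adMono m, w k⁆ = c • w (k + m)) ∧
      (c ≠ 0 → T (parity k) ∧ T (parity (k + m)) ∧ adMono m ≠ 0) := by
    intro m k
    by_cases hk : latWt lam k ≠ 0 ∧ latWt lam (k + m) ≠ 0
    · obtain ⟨c, hc⟩ := hgen _ hk.2 ⁅adMono m, w k⁆ (by
        rw [latWt_add]; exact lie_mem_weightSpace (adMono_mem m) (hw k hk.1).1)
      by_cases h0 : ⁅adMono m, w k⁆ = 0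
      · exact ⟨0, fun _ _ => by rw [h0, zero_smul], fun h => absurd rfl h⟩
      · refine ⟨c, fun _ _ => hc, fun _ => ⟨(hw k hk.1).2.1.mp ?_, (hw _ hk.2).2.1.mp ?_, ?_⟩⟩
        · intro h; apply h0; rw [h, lie_zero]
        · intro h; apply h0; rw [hc, h, smul_zero]
        · intro h; apply h0; rw [h, zero_lie]
    · exact ⟨0, fun h1 h2 => absurd ⟨h1, h2⟩ hk, fun h => absurd rfl h⟩
  choose e he he0 using hE
  refine ⟨T, b, w, e, ⟨?_, fun m k h => ⟨(he0 m k h).1, (he0 m k h).2.1⟩, ?_, ?_, ?_⟩, fun k hk =>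
    ⟨(hw k hk).1, (hw k hk).2.1, (hw k hk).2.2.1, (hw k hk).2.2.2, fun m hm => he m k hk hm⟩⟩
  · intro p k
    by_contra h
    exact (he0 _ k h).2.2 (adMono_even p)
  · intro m k p a h1 h2 h3 h4
    have e1 : k + (p + p) + m = k + m + (p + p) := by abel
    have e2 : k + (m + (p + p)) = k + m + (p + p) := by abel
    have t := leibniz_lie (evenDer p a) (adMono m) (w k)
    rw [lie_evenDer_adMono, he m k h1 h2, smul_lie, he _ k h1 (by rwa [e2]), lie_smul,
      (hw _ h2).2.2.2 p a h4, (hw _ h1).2.2.2 p a h3, lie_smul, he m _ h3 (by rwa [e1]), e1, e2,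
      smul_smul, smul_smul, smul_smul, ← add_smul] at t
    by_cases hT : T (parity (k + m + (p + p)))
    · have t' := smul_left_injective ℂ ((hw _ h4).2.1.mpr hT) t
      linear_combination t'
    · have z1 : e m k = 0 := by
        by_contra h
        apply hT
        rw [parity_add, parity_add_self, add_zero]
        exact (he0 m k h).2.1
      have z2 : e m (k + (p + p)) = 0 := by
        by_contra h
        apply hT
        rw [← e1]
        exact (he0 m _ h).2.1
      have z3 : e (m + (p + p)) k = 0 := by
        by_contra h
        apply hT
        rw [← e2]
        exact (he0 _ k h).2.1
      rw [z1, z2, z3]; ring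
  · intro m l k h1 h2 h3 h4
    have e1 : k + l + m = k + m + l := by abel
    have e2 : k + (m + l) = k + m + l := by abel
    have t := leibniz_lie (adMono m) (adMono l) (w k)
    rw [lie_adMono_adMono, smul_lie, he l k h1 h3, he m k h1 h2, he _ k h1 (by rwa [e2]), lie_smul,
      lie_smul, he m _ h3 (by rwa [e1]), he l _ h2 h4, e1, e2, smul_smul, smul_smul, smul_smul,
      ← add_smul] at t
    by_cases hT : T (parity (k + m + l))
    · have t' := smul_left_injective ℂ ((hw _ h4).2.1.mpr hT) t
      linear_combination t'
    · have z1 : e m (k + l) = 0 := by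
        by_contra h
        exact hT (e1 ▸ (he0 _ _ h).2.1)
      have z2 : e l (k + m) = 0 := by
        by_contra h
        exact hT (he0 _ _ h).2.1
      have z3 : e (m + l) k = 0 := by
        by_contra h
        exact hT (e2 ▸ (he0 _ _ h).2.1)
      rw [z1, z2, z3]; ring
  · classical
    -- The vectors whose class lies in the closed set J generate a nonzero submodule. If an
    -- occurring class were outside J, the coordinate along one of its vectors would vanish on that
    -- submodule, contradicting irreducibility.
    rintro J ⟨j₀, hJ₀, hT₀⟩ hJ j hTj
    by_contra hJj
    obtain ⟨R, hR, hRle⟩ := exists_lieSubmodule_of_weightVectors (lam := lam)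
      (u := fun k => if J (parity k) then w k else 0)
      (fun k hk => by
        split_ifs
        · exact (hw k hk).1
        · exact zero_mem _)
      (by
        intro k d X hk hd hX
        suffices h : ⁅X, if J (parity k) then w k else 0⁆ ∈
            Submodule.span ℂ {if J (parity (k + d)) then w (k + d) else 0} by
          obtain ⟨c, hc⟩ := Submodule.mem_span_singleton.mp h
          exact ⟨c, hc.symm⟩
        by_cases hk' : J (parity k)
        swap
        · rw [if_neg hk', lie_zero]; exact zero_mem _
        rw [if_pos hk']
        refine lie_mem_of_mem_derGrade ?_ ?_ hX
        · rw [he d k hk hd]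
          by_cases h0 : e d k = 0
          · rw [h0, zero_smul]; exact zero_mem _
          · rw [if_pos (hJ d k hk hd hk' h0)]
            exact Submodule.smul_mem _ _ (Submodule.mem_span_singleton_self _)
        · rintro p a rfl
          rw [(hw k hk).2.2.2 p a hd, if_pos (by rwa [parity_add, parity_add_self, add_zero])]
          exact Submodule.smul_mem _ _ (Submodule.mem_span_singleton_self _))
    obtain ⟨k₀, rfl, hk₀⟩ := exists_parity_eq_latWt_ne_zero lam j₀
    obtain ⟨k, rfl, hk⟩ := exists_parity_eq_latWt_ne_zero lam j
    obtain ⟨f, hf1, hf0⟩ := exists_weight_functional hV.isInternal (hw k hk).1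
      ((hw k hk).2.1.mpr hTj)
    have hle := hRle (LinearMap.ker f) (by
        intro l hl
        split_ifs with hJl
        · refine hf0 _ ?_ _ (hw l hl).1
          intro h
          rw [latWt_injective lam h] at hJl
          exact hJj hJl
        · exact zero_mem _)
      (fun y hy => hf0 0 hk.symm y hy)
    rcases hirr.eq_bot_or_eq_top R with h | h
    · have := hR k₀ hk₀
      rw [if_pos hJ₀, h, LieSubmodule.mem_bot] at this
      exact (hw k₀ hk₀).2.1.mpr hT₀ this
    · have : w k ∈ R := by rw [h]; exact LieSubmodule.mem_top _
      have h2 := LinearMap.mem_ker.mp (hle this)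
      rw [hf1] at h2
      exact one_ne_zero h2

end
end

/-! ### One density parameter, and constants depending only on classes -/

noncomputable section

open QTorus Filter

namespace AdConstants

variable {lam : ℂ × ℂ} {T : ZMod 2 × ZMod 2 → Prop} {b : ZMod 2 × ZMod 2 → ℂ}
  {e : ℤ × ℤ → ℤ × ℤ → ℂ}

theorem parity_shift (k p : ℤ × ℤ) : parity (k + (p + p)) = parity k := by
  rw [parity_add, parity_add_self, add_zero]

theorem ne_zero_of_symp {mu : ℂ × ℂ} {n : ℂ × ℂ} (h : symp n mu ≠ 0) (c : ℂ) : mu + c • n ≠ 0 := by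
  intro h0
  apply h
  have : symp n (mu + c • n) = 0 := by rw [h0]; simp [symp]
  rwa [symp_add_right, symp_smul_right, symp_self, mul_zero, add_zero] at this

theorem latWt_ne_zero_of_symp {k p : ℤ × ℤ} (h : symp (dbl p) (latWt lam k) ≠ 0) :
    latWt lam (k + (p + p)) ≠ 0 := by
  rw [latWt_add_dbl]
  have := ne_zero_of_symp h 1
  rwa [one_smul] at this

/-- The relation between the values of `e m` at `k` and `k + 2p`. -/
theorem shift_right (h : AdConstants lam T b e) {m k p : ℤ × ℤ} (h1 : latWt lam k ≠ 0)
    (h2 : latWt lam (k + m) ≠ 0) (h3 : latWt lam (k + (p + p)) ≠ 0)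
    (h4 : latWt lam (k + m + (p + p)) ≠ 0) :
    (symp (toC m) (latWt lam k) + b (parity (k + m)) * symp (toC m) (dbl p)) * e m k =
      (symp (toC m) (latWt lam k) + b (parity k) * symp (toC m) (dbl p)) * e m (k + (p + p)) := by
  have t := h.relW m k p (rot (toC m)) h1 h2 h3 h4
  simp only [pairing_rot, symp_add_right, symp_smul_right, symp_self, latWt_add] at t ⊢
  linear_combination t

/-- The relation between the values of `e m` and `e (m + 2p)` at `k`. -/
theorem shift_left (h : AdConstants lam T b e) {m k p : ℤ × ℤ} (h1 : latWt lam k ≠ 0)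
    (h2 : latWt lam (k + m) ≠ 0) (h3 : latWt lam (k + (p + p)) ≠ 0)
    (h4 : latWt lam (k + m + (p + p)) ≠ 0) (hm : m ≠ 0) :
    (symp (toC m) (latWt lam k) + b (parity k) * symp (toC m) (dbl p)) * e (m + (p + p)) k =
      (symp (toC m) (latWt lam k) + b (parity k) * symp (toC m) (dbl p) -
        (b (parity k) - b (parity (k + m))) * symp (dbl p) (latWt lam k)) * e m k := by
  have s := h.shift_right h1 h2 h3 h4
  obtain ⟨a, ha⟩ := exists_pairing_ne_zero (x := toC m) (fun h => hm (toC_eq_zero.mp h))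
  have t := h.relW m k p a h1 h2 h3 h4
  apply mul_left_cancel₀ ha
  rw [latWt_add] at t
  simp only [pairing_add_right, pairing_smul_right] at t
  have pl : symp (toC m) (dbl p) * pairing a (latWt lam k) -
      symp (toC m) (latWt lam k) * pairing a (dbl p) =
      -(symp (dbl p) (latWt lam k) * pairing a (toC m)) := by
    simp only [symp, pairing]; ring
  linear_combination (-(symp (toC m) (latWt lam k) + b (parity k) * symp (toC m) (dbl p))) * t
    + (pairing a (latWt lam k) + b (parity k) * pairing a (dbl p)) * s
    + (b (parity k) - b (parity (k + m))) * e m k * pl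

theorem ne_zero_of_apply (h : AdConstants lam T b e) {m k : ℤ × ℤ} (he : e m k ≠ 0) : m ≠ 0 := by
  rintro rfl
  apply he
  have := h.even 0 k
  rwa [add_zero] at this

/-- A nonzero structure constant can be moved to a transverse position. -/
theorem exists_symp_ne_zero (h : AdConstants lam T b e) {m k : ℤ × ℤ} (h1 : latWt lam k ≠ 0)
    (h2 : latWt lam (k + m) ≠ 0) (he : e m k ≠ 0) :
    ∃ m' k', latWt lam k' ≠ 0 ∧ latWt lam (k' + m') ≠ 0 ∧ parity k' = parity k ∧
      parity m' = parity m ∧ e m' k' ≠ 0 ∧ symp (toC m') (latWt lam k') ≠ 0 := by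
  by_cases hz : symp (toC m) (latWt lam k) = 0
  swap
  · exact ⟨m, k, h1, h2, rfl, rfl, he, hz⟩
  have hm := h.ne_zero_of_apply he
  have hm' : toC m ≠ 0 := fun h => hm (toC_eq_zero.mp h)
  -- When m is parallel to the weight, shifting either k or m by a generic 2p restores
  -- transversality. The relation with W shows that the two shifted constants cannot both vanish.
  obtain ⟨p, g1, g2, g3⟩ := ((eventually_affine_ne_zero (c := 0) (Or.inr h1)).and
    ((eventually_affine_ne_zero (c := 0) (Or.inr h2)).and
    (eventually_affine_ne_zero (c := 0) (Or.inr hm')))).exists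
  rw [zero_add] at g1 g2 g3
  have n3 := latWt_ne_zero_of_symp g1
  have n4 := latWt_ne_zero_of_symp g2
  by_cases hr : e m (k + (p + p)) = 0
  · refine ⟨m + (p + p), k, h1, ?_, rfl, parity_shift _ _, ?_, ?_⟩
    · rwa [← add_assoc]
    · intro hl
      obtain ⟨a, ha⟩ := exists_pairing_ne_zero (ne_zero_of_symp g2 (b (parity (k + m))))
      have t := h.relW m k p a h1 h2 n3 n4
      rw [hr, hl, mul_zero, sub_zero, mul_zero] at t
      exact mul_ne_zero ha he t
    · rw [toC_add, symp_add_left, hz, zero_add]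
      exact g1
  · refine ⟨m, k + (p + p), n3, ?_, parity_shift _ _, rfl, hr, ?_⟩
    · rwa [add_right_comm]
    · rw [latWt_add_dbl, symp_add_right, hz, zero_add, symp_swap]
      exact neg_ne_zero.mpr g3

/-- The density parameters of two cosets joined by `adMono m` agree, or are `0` and `1`. -/
theorem param_eq (h : AdConstants lam T b e) {m k : ℤ × ℤ} (h1 : latWt lam k ≠ 0)
    (h2 : latWt lam (k + m) ≠ 0) (he : e m k ≠ 0) :
    b (parity k) = b (parity (k + m)) ∨ (b (parity k) = 0 ∧ b (parity (k + m)) = 1) := by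
  obtain ⟨m', k', h1', h2', ek, em, he', hz⟩ := h.exists_symp_ne_zero h1 h2 he
  have ekm : parity (k + m) = parity (k' + m') := by rw [parity_add, parity_add, ek, em]
  rw [← ek, ekm]
  clear h1 h2 he ek em ekm
  -- Since m' and the weight are independent, this vector vanishes exactly when the parameters are 0
  -- at the source and 1 at the target.
  by_cases hv : (2 * b (parity k')) • toC m' + (1 + (b (parity k') - b (parity (k' + m')))) •
      latWt lam k' = 0
  · right
    have t1 : symp (toC m') ((2 * b (parity k')) • toC m' +
        (1 + (b (parity k') - b (parity (k' + m')))) • latWt lam k') = 0 := by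
      rw [hv]; simp [symp]
    have t2 : symp ((2 * b (parity k')) • toC m' +
        (1 + (b (parity k') - b (parity (k' + m')))) • latWt lam k') (latWt lam k') = 0 := by
      rw [hv]; simp [symp]
    rw [symp_add_right, symp_smul_right, symp_smul_right, symp_self, mul_zero, zero_add] at t1
    rw [symp_add_left, symp_smul_left, symp_smul_left, symp_self, mul_zero, add_zero] at t2
    have t3 := (mul_eq_zero.mp t1).resolve_right hz
    have t4 := (mul_eq_zero.mp t2).resolve_right hz
    have t5 : b (parity k') = 0 := by linear_combination t4 / 2
    exact ⟨t5, by rw [t5] at t3; linear_combination -t3⟩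
  · left
    obtain ⟨p, g1, g2, g3⟩ := ((eventually_affine_ne_zero (c := 0) (Or.inr h1')).and
      ((eventually_affine_ne_zero (c := 0) (Or.inr h2')).and
      (eventually_affine_ne_zero (c := 0) (Or.inr hv)))).exists
    rw [zero_add] at g1 g2 g3
    have n3 := latWt_ne_zero_of_symp g1
    have n4 := latWt_ne_zero_of_symp g2
    have hm := h.ne_zero_of_apply he'
    have s1 := h.shift_left h1' h2' n3 n4 hm
    have n5 : latWt lam (k' + (-p + -p)) ≠ 0 := by
      apply latWt_ne_zero_of_symp
      rw [dbl_neg, symp_neg_left]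
      exact neg_ne_zero.mpr g1
    have e1 : m' + (p + p) + (-p + -p) = m' := by abel
    have e2 : k' + (m' + (p + p)) + (-p + -p) = k' + m' := by abel
    have hm2 : m' + (p + p) ≠ 0 := by
      intro h0
      have : m' = -p + -p := by
        have := eq_neg_of_add_eq_zero_left h0
        rw [this]; abel
      rw [this] at he'
      exact he' (h.even _ _)
    have s2 := h.shift_left (p := -p) h1' (by rwa [← add_assoc]) n5 (by rwa [e2]) hm2
    rw [e1, ← add_assoc k' m', parity_shift, toC_add] at s2
    simp only [symp_add_left, dbl_neg, symp_neg_right, symp_neg_left] at s2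
    have e3 : symp (toC (p + p)) (dbl p) = 0 := symp_self _
    have e4 : symp (toC (p + p)) (latWt lam k') = symp (dbl p) (latWt lam k') := rfl
    rw [e3, e4] at s2
    simp only [symp_add_right, symp_smul_right] at g3
    rw [symp_swap (dbl p) (toC m')] at g3
    -- Shifting m' by 2p and then back by -2p must return the same constant; `shift_left` used twice
    -- turns this into a product of factors, of which only the difference of the parameters can
    -- vanish for generic p.
    have hc : (b (parity k') - b (parity (k' + m'))) * symp (dbl p) (latWt lam k') *
        (2 * b (parity k') * symp (toC m') (dbl p) - symp (dbl p) (latWt lam k') -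
          (b (parity k') - b (parity (k' + m'))) * symp (dbl p) (latWt lam k')) * e m' k' = 0 := by
      linear_combination (-(symp (toC m') (latWt lam k') +
        b (parity k') * symp (toC m') (dbl p))) * s2 - (symp (toC m') (latWt lam k') +
        symp (dbl p) (latWt lam k') - b (parity k') * symp (toC m') (dbl p) +
        (b (parity k') - b (parity (k' + m'))) * symp (dbl p) (latWt lam k')) * s1
    have hc1 := (mul_eq_zero.mp hc).resolve_right he'
    have hc2 := (mul_eq_zero.mp hc1).resolve_right (by
      intro h0
      apply g3
      linear_combination -h0)
    exact sub_eq_zero.mp ((mul_eq_zero.mp hc2).resolve_right g1)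

/-- All the cosets have the same density parameter. -/
theorem exists_param (h : AdConstants lam T b e) :
    ∃ β : ℂ, ∀ j, T j → b j = β := by
  by_cases h0 : ∀ j, T j → b j = 0
  · exact ⟨0, h0⟩
  · push Not at h0
    obtain ⟨j, hj, hb⟩ := h0
    -- The exceptional jump starts from parameter 0. With b j ≠ 0 no jump leaves the set of classes
    -- of parameter b j, which is therefore closed and contains every occurring class.
    refine ⟨b j, h.conn (fun i => b i = b j) ⟨j, rfl, hj⟩ ?_⟩
    intro m k h1 h2 hk he
    rcases h.param_eq h1 h2 he with h3 | ⟨h3, _⟩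
    · rw [← h3, hk]
    · exact absurd (hk.symm.trans h3) hb

theorem const_param (h : AdConstants lam T b e) {β : ℂ} (hβ : ∀ j, T j → b j = β) :
    AdConstants lam T (fun _ => β) e := by
  refine ⟨h.even, h.supp, ?_, h.relE, h.conn⟩
  intro m k p a h1 h2 h3 h4
  by_cases hT : T (parity k) ∧ T (parity (k + m))
  · have := h.relW m k p a h1 h2 h3 h4
    rwa [hβ _ hT.1, hβ _ hT.2] at this
  · have z1 : e m k = 0 := by
      by_contra hn
      exact hT (h.supp m k hn)
    have z2 : e m (k + (p + p)) = 0 := by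
      by_contra hn
      apply hT
      have := h.supp _ _ hn
      rwa [parity_shift, add_right_comm, parity_shift] at this
    have z3 : e (m + (p + p)) k = 0 := by
      by_contra hn
      apply hT
      have := h.supp _ _ hn
      rwa [← add_assoc, parity_shift] at this
    rw [z1, z2, z3]; ring

variable {β : ℂ}

/-- With a common parameter the factors on the two sides of `shift_right` and of `shift_left`
coincide, so they cancel wherever they are nonzero. -/
theorem eq_of_shift (h : AdConstants lam T (fun _ => β) e) {m k p : ℤ × ℤ}
    (hz : symp (toC m) (latWt lam k) + β * symp (toC m) (dbl p) ≠ 0)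
    (h1 : latWt lam k ≠ 0)
    (h2 : latWt lam (k + m) ≠ 0) (h3 : latWt lam (k + (p + p)) ≠ 0)
    (h4 : latWt lam (k + m + (p + p)) ≠ 0) :
    e m (k + (p + p)) = e m k ∧ e (m + (p + p)) k = e m k := by
  have hm : m ≠ 0 := by
    rintro rfl
    apply hz
    simp [symp]
  have t1 := h.shift_right h1 h2 h3 h4
  have t2 := h.shift_left h1 h2 h3 h4 hm
  rw [sub_self, zero_mul, sub_zero] at t2
  exact ⟨(mul_left_cancel₀ hz t1).symm, mul_left_cancel₀ hz t2⟩

/-- The translation s allows two positions that differ by a known even shift to be moved to one and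
the same generic place. The nonvanishing statements keep the moved position transverse, so that a
further move is possible. -/
theorem eventually_eq_of_symp (h : AdConstants lam T (fun _ => β) e) {m k : ℤ × ℤ}
    (h1 : latWt lam k ≠ 0) (h2 : latWt lam (k + m) ≠ 0)
    (hz : symp (toC m) (latWt lam k) ≠ 0) (s : ℤ × ℤ) :
    ∀ᶠ p in genericFilter, latWt lam (k + ((p - s) + (p - s))) ≠ 0 ∧
      latWt lam (k + m + ((p - s) + (p - s))) ≠ 0 ∧
      symp (toC m) (latWt lam (k + ((p - s) + (p - s)))) ≠ 0 ∧
      symp (toC (m + ((p - s) + (p - s)))) (latWt lam k) ≠ 0 ∧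
      e m (k + ((p - s) + (p - s))) = e m k ∧ e (m + ((p - s) + (p - s))) k = e m k := by
  have hm : toC m ≠ 0 := left_ne_zero_of_symp hz
  have f1 : ∀ v : ℂ × ℂ, v ≠ 0 → ∀ᶠ p in genericFilter, symp (dbl (p - s)) v ≠ 0 := fun v hv =>
    eventually_ne_zero_of_eq (-symp (dbl s) v) v (Or.inr hv) fun p => by
      rw [dbl_sub, symp_sub_left]; ring
  have f2 : ∀ c : ℂ, ∀ᶠ p in genericFilter,
      symp (toC m) (latWt lam k) + c * symp (toC m) (dbl (p - s)) ≠ 0 := fun c =>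
    eventually_ne_zero_of_eq (symp (toC m) (latWt lam k) - c * symp (toC m) (dbl s)) (-(c • toC m))
      (by
        by_cases hc : c = 0
        · left; simpa [hc] using hz
        · right; exact neg_ne_zero.mpr (smul_ne_zero hc hm)) fun p => by
      rw [dbl_sub, symp_sub_right, symp_neg_right, symp_smul_right, symp_swap (dbl p)]; ring
  have f3 : ∀ᶠ p in genericFilter,
      symp (toC m) (latWt lam k) + symp (dbl (p - s)) (latWt lam k) ≠ 0 :=
    eventually_ne_zero_of_eq (symp (toC m) (latWt lam k) - symp (dbl s) (latWt lam k)) (latWt lam k)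
      (Or.inr h1) fun p => by rw [dbl_sub, symp_sub_left]; ring
  filter_upwards [f1 _ h1, f1 _ h2, f2 β, f2 1, f3] with p g1 g2 g3 g4 g5
  have n3 := latWt_ne_zero_of_symp g1
  have n4 := latWt_ne_zero_of_symp g2
  obtain ⟨t1, t2⟩ := h.eq_of_shift g3 h1 h2 n3 n4
  refine ⟨n3, n4, ?_, ?_, t1, t2⟩
  · rw [latWt_add_dbl, symp_add_right]
    rwa [one_mul] at g4
  · rw [toC_add, symp_add_left]
    exact g5

/-- First both degrees are moved to a common generic one, then both indices to a common generic one;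
neither move changes the constants. -/
theorem eq_of_symp_ne_zero (h : AdConstants lam T (fun _ => β) e) {m k m' k' : ℤ × ℤ}
    (h1 : latWt lam k ≠ 0) (h2 : latWt lam (k + m) ≠ 0)
    (hz : symp (toC m) (latWt lam k) ≠ 0)
    (h1' : latWt lam k' ≠ 0) (h2' : latWt lam (k' + m') ≠ 0)
    (hz' : symp (toC m') (latWt lam k') ≠ 0)
    (hk : parity k = parity k') (hm : parity m = parity m') : e m k = e m' k' := by
  obtain ⟨s, rfl⟩ := parity_eq_iff.mp hk
  obtain ⟨r, rfl⟩ := parity_eq_iff.mp hm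
  obtain ⟨p, ⟨_, a2, _, a4, _, a6⟩, _, b2, _, b4, _, b6⟩ :=
    ((h.eventually_eq_of_symp h1 h2 hz 0).and (h.eventually_eq_of_symp h1' h2' hz' r)).exists
  have e1 : m + (r + r) + (p - r + (p - r)) = m + (p - 0 + (p - 0)) := by
    rw [sub_zero]; abel
  rw [add_assoc, e1] at b2
  rw [e1] at b4 b6
  rw [add_assoc] at a2
  rw [← a6, ← b6]
  generalize m + (p - 0 + (p - 0)) = m at a2 a4 b2 b4
  obtain ⟨q, ⟨_, _, _, _, c5, _⟩, _, _, _, _, d5, _⟩ :=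
    ((h.eventually_eq_of_symp h1 a2 a4 0).and (h.eventually_eq_of_symp h1' b2 b4 s)).exists
  have e2 : k + (s + s) + (q - s + (q - s)) = k + (q - 0 + (q - 0)) := by
    rw [sub_zero]; abel
  rw [← c5, ← d5, e2]

/-- The structure constants only depend on the classes modulo `2ℤ²`. -/
theorem eq_of_parity (h : AdConstants lam T (fun _ => β) e) {m k m' k' : ℤ × ℤ}
    (h1 : latWt lam k ≠ 0) (h2 : latWt lam (k + m) ≠ 0)
    (h1' : latWt lam k' ≠ 0) (h2' : latWt lam (k' + m') ≠ 0)
    (hk : parity k = parity k') (hm : parity m = parity m') : e m k = e m' k' := by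
  by_cases hm0 : parity m = 0
  · obtain ⟨p, rfl⟩ := exists_add_self (parity_eq_zero.mp hm0)
    obtain ⟨p', rfl⟩ := exists_add_self (parity_eq_zero.mp (hm ▸ hm0))
    rw [h.even, h.even]
  have key : ∀ m k, parity m ≠ 0 → latWt lam k ≠ 0 → latWt lam (k + m) ≠ 0 → ∃ m₁ k₁,
      latWt lam k₁ ≠ 0 ∧ latWt lam (k₁ + m₁) ≠ 0 ∧ symp (toC m₁) (latWt lam k₁) ≠ 0 ∧
      parity k₁ = parity k ∧ parity m₁ = parity m ∧ e m₁ k₁ = e m k := by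
    intro m k hm0 h1 h2
    by_cases hz : symp (toC m) (latWt lam k) = 0
    swap
    · exact ⟨m, k, h1, h2, hz, rfl, rfl, rfl⟩
    have hm' : toC m ≠ 0 := by
      intro h0
      apply hm0
      rw [toC_eq_zero.mp h0]; rfl
    obtain ⟨p, g1, g2, g3⟩ := ((eventually_affine_ne_zero (c := 0) (Or.inr h1)).and
      ((eventually_affine_ne_zero (c := 0) (Or.inr h2)).and
      (eventually_affine_ne_zero (c := 0) (Or.inr hm')))).exists
    rw [zero_add] at g1 g2 g3
    have n3 := latWt_ne_zero_of_symp g1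
    have n4 := latWt_ne_zero_of_symp g2
    have z1 : symp (toC (m + (p + p))) (latWt lam k) ≠ 0 := by
      rw [toC_add, symp_add_left, hz, zero_add]
      exact g1
    have z2 : symp (toC m) (latWt lam (k + (p + p))) ≠ 0 := by
      rw [latWt_add_dbl, symp_add_right, hz, zero_add, symp_swap]
      exact neg_ne_zero.mpr g3
    have n4' : latWt lam (k + (m + (p + p))) ≠ 0 := by rwa [← add_assoc]
    have n4'' : latWt lam (k + (p + p) + m) ≠ 0 := by rwa [add_right_comm]
    have t := h.eq_of_symp_ne_zero h1 n4' z1 n3 n4'' z2 (parity_shift _ _).symm (parity_shift _ _)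
    refine ⟨_, _, h1, n4', z1, rfl, parity_shift _ _, ?_⟩
    -- The constants with m shifted and with k shifted are both transverse, hence equal. The
    -- relation with W then multiplies this common value and `e m k` by the same factor, nonzero for
    -- a suitable direction a.
    obtain ⟨a, ha⟩ := exists_pairing_ne_zero (ne_zero_of_symp g2 β)
    have r := h.relW m k p a h1 h2 n3 n4
    rw [← t] at r
    apply mul_left_cancel₀ ha
    rw [latWt_add] at r ⊢
    simp only [pairing_add_right, pairing_smul_right] at r ⊢
    linear_combination -r
  obtain ⟨m₁, k₁, a1, a2, a3, a4, a5, a6⟩ := key m k hm0 h1 h2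
  obtain ⟨m₂, k₂, b1, b2, b3, b4, b5, b6⟩ := key m' k' (hm ▸ hm0) h1' h2'
  rw [← a6, ← b6]
  exact h.eq_of_symp_ne_zero a1 a2 a3 b1 b2 b3 (a4.trans (hk.trans b4.symm))
    (a5.trans (hm.trans b5.symm))

end AdConstants
end

/-! ### The finite problem: graded representations of sl_2, all classes present -/

noncomputable section

open QTorus Filter

/-- The sign `(-1)^(i₂ j₁)` of classes modulo `2ℤ²`. -/
def classSign (i j : ZMod 2 × ZMod 2) : ℤ := if i.2 * j.1 = 0 then 1 else -1

theorem classSign_parity (m k : ℤ × ℤ) :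
    (classSign (parity m) (parity k) : ℂ) = (-1 : ℂ) ^ (m.2 * k.1) := by
  have e : (parity m).2 * (parity k).1 = ((m.2 * k.1 : ℤ) : ZMod 2) := by simp [parity]
  rw [classSign, e]
  by_cases h : Even (m.2 * k.1)
  · rw [if_pos (ZMod.intCast_eq_zero_iff_even.mpr h), h.neg_one_zpow]; simp
  · rw [if_neg (fun h' => h (ZMod.intCast_eq_zero_iff_even.mp h')),
      (Int.not_even_iff_odd.mp h).neg_one_zpow]; simp

/-- The structure constant `[E i, E j] = classBracket i j • E (i + j)`. -/
def classBracket (i j : ZMod 2 × ZMod 2) : ℤ := classSign i j - classSign j i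

theorem classBracket_parity (m k : ℤ × ℤ) :
    (classBracket (parity m) (parity k) : ℂ) = adSign m k := by
  rw [classBracket, Int.cast_sub, classSign_parity, classSign_parity, adSign, mul_comm k.2]

theorem add_add_self_class : ∀ i j : ZMod 2 × ZMod 2, i + (i + j) = j := by decide

/-- The structure constants of the action of the classes modulo `2ℤ²`: the class `i` maps the
class `j` to the class `i + j`, with coefficient `c i j`. -/
structure ClassConstants (T : ZMod 2 × ZMod 2 → Prop) (c : ZMod 2 × ZMod 2 → ZMod 2 × ZMod 2 → ℂ) :
    Prop where
  zero : ∀ j, c 0 j = 0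
  supp : ∀ i j, c i j ≠ 0 → T j ∧ T (i + j)
  rel : ∀ i l j, c i (l + j) * c l j - c l (i + j) * c i j = classBracket i l * c (i + l) j
  conn : ∀ J : ZMod 2 × ZMod 2 → Prop, (∃ j, J j ∧ T j) →
    (∀ i j, J j → c i j ≠ 0 → J (i + j)) → ∀ j, T j → J j

/-- Every pair of classes has representatives whose source and target weights are nonzero, so the
constants descend; each relation is tested on representatives chosen generically enough to keep all
four weights nonzero. -/
theorem AdConstants.exists_classConstants {lam : ℂ × ℂ} {T : ZMod 2 × ZMod 2 → Prop} {β : ℂ}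
    {e : ℤ × ℤ → ℤ × ℤ → ℂ} (h : AdConstants lam T (fun _ => β) e) :
    ∃ c, ClassConstants T c ∧
      ∀ m k, latWt lam k ≠ 0 → latWt lam (k + m) ≠ 0 → e m k = c (parity m) (parity k) := by
  have hrep : ∀ i j, ∃ m k, parity m = i ∧ parity k = j ∧ latWt lam k ≠ 0 ∧
      latWt lam (k + m) ≠ 0 := by
    intro i j
    obtain ⟨k, rfl, hk⟩ := exists_parity_eq_latWt_ne_zero lam j
    obtain ⟨m, rfl⟩ := exists_parity_eq i
    obtain ⟨p, hp⟩ := (eventually_latWt_ne_zero lam (k + m)).exists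
    exact ⟨m + (p + p), k, parity_shift _ _, rfl, hk, by rwa [← add_assoc]⟩
  choose M K hM hK h1 h2 using hrep
  have hc : ∀ m k, latWt lam k ≠ 0 → latWt lam (k + m) ≠ 0 →
      e m k = e (M (parity m) (parity k)) (K (parity m) (parity k)) := by
    intro m k hk hm
    exact h.eq_of_parity hk hm (h1 _ _) (h2 _ _) (hK _ _).symm (hM _ _).symm
  refine ⟨fun i j => e (M i j) (K i j), ⟨?_, ?_, ?_, ?_⟩, hc⟩
  · intro j
    obtain ⟨p, hp⟩ := exists_add_self (parity_eq_zero.mp (hM 0 j))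
    rw [hp, h.even]
  · intro i j hij
    have := h.supp _ _ hij
    rwa [parity_add, hK, hM, add_comm j i] at this
  · intro i l j
    obtain ⟨k, rfl, hk⟩ := exists_parity_eq_latWt_ne_zero lam j
    obtain ⟨m₀, rfl⟩ := exists_parity_eq i
    obtain ⟨l₀, rfl⟩ := exists_parity_eq l
    obtain ⟨p, hp⟩ := (eventually_latWt_ne_zero lam (k + m₀)).exists
    obtain ⟨m, hm, hkm⟩ : ∃ m, parity m = parity m₀ ∧ latWt lam (k + m) ≠ 0 :=
      ⟨m₀ + (p + p), parity_shift _ _, by rwa [← add_assoc]⟩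
    obtain ⟨q, hq1, hq2⟩ := ((eventually_latWt_ne_zero lam (k + l₀)).and
      (eventually_latWt_ne_zero lam (k + m + l₀))).exists
    obtain ⟨r, hr, hkl, hkml⟩ : ∃ l, parity l = parity l₀ ∧ latWt lam (k + l) ≠ 0 ∧
        latWt lam (k + m + l) ≠ 0 :=
      ⟨l₀ + (q + q), parity_shift _ _, by rwa [← add_assoc], by rwa [← add_assoc]⟩
    have t := h.relE m r k hk hkm hkl hkml
    have hklm : latWt lam (k + r + m) ≠ 0 := by rwa [add_right_comm]
    rw [hc _ _ hkl hklm, hc _ _ hk hkl, hc _ _ hkm hkml, hc _ _ hk hkm,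
      hc (m + r) k hk (by rwa [← add_assoc])] at t
    simp only [parity_add, hm, hr, ← classBracket_parity] at t
    rwa [add_comm (parity k) (parity l₀), add_comm (parity k) (parity m₀)] at t
  · intro J hJ hJc
    refine h.conn J hJ fun m k hk hm hJk hne => ?_
    rw [hc m k hk hm] at hne
    have := hJc _ _ hJk hne
    rwa [parity_add, add_comm]

namespace ClassConstants

variable {T : ZMod 2 × ZMod 2 → Prop} {c : ZMod 2 × ZMod 2 → ZMod 2 × ZMod 2 → ℂ}

theorem ne_zero_left (h : ClassConstants T c) {i j : ZMod 2 × ZMod 2} (hc : c i j ≠ 0) : i ≠ 0 := by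
  rintro rfl
  exact hc (h.zero j)

/-- The double commutator `[E i, [E i, E k]]`. -/
theorem double_commutator (h : ClassConstants T c) {i k : ZMod 2 × ZMod 2} (hi : i ≠ 0) (hk : k ≠ 0)
    (hik : i ≠ k) (j : ZMod 2 × ZMod 2) :
    (c i (i + j) * c i j + c i (i + (k + j)) * c i (k + j) - 4 * classSign i i) * c k j =
      2 * c i (i + (k + j)) * c k (i + j) * c i j := by
  have r1 := h.rel i k j
  have r2 := h.rel i k (i + j)
  have r3 := h.rel i (i + k) j
  rw [add_add_self_class i j, add_left_comm k i j] at r2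
  rw [add_add_self_class i k, add_assoc i k j] at r3
  have s : ∀ i k, i ≠ 0 → k ≠ 0 → i ≠ k →
      classBracket i k * classBracket i (i + k) = 4 * classSign i i := by decide
  have s' : (classBracket i k * classBracket i (i + k) : ℂ) = 4 * classSign i i := by
    exact_mod_cast s i k hi hk hik
  rw [← s']
  linear_combination c i (i + (k + j)) * r1 - c i j * r2 + classBracket i k * r3

/-- This is the commutation of E_k with the Casimir element, the signed sum of the squares of E_i,
E_k and E_{i+k}. The square of E_k commutes with E_k by itself, so only the other two terms appear.
-/
theorem casimir_pair (h : ClassConstants T c) {i k : ZMod 2 × ZMod 2} (hi : i ≠ 0) (hk : k ≠ 0)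
    (hik : i ≠ k) (j : ZMod 2 × ZMod 2) :
    (classSign i i * (c i (i + j) * c i j - c i (i + (k + j)) * c i (k + j)) +
      classSign (i + k) (i + k) * (c (i + k) (i + k + j) * c (i + k) j -
        c (i + k) (i + k + (k + j)) * c (i + k) (k + j))) * c k j = 0 := by
  have e1 : i + k + j = i + (k + j) := add_assoc _ _ _
  have e2 : i + k + (k + j) = i + j := by rw [add_assoc, add_add_self_class]
  have e3 : k + (i + j) = i + (k + j) := add_left_comm _ _ _
  have e4 : k + (i + (k + j)) = i + j := by rw [← e3, add_add_self_class]
  have e5 : k + (i + k) = i := by rw [add_comm i, add_add_self_class]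
  have e6 : i + k + (i + (k + j)) = j := by rw [← e1, add_add_self_class]
  have r1 := h.rel k i j
  have r2 := h.rel k i (i + j)
  have r3 := h.rel k (i + k) j
  have r4 := h.rel k (i + k) (i + (k + j))
  rw [add_comm k i] at r1
  rw [add_add_self_class, e3, add_comm k i] at r2
  rw [e1, e5] at r3
  rw [e6, e4, e5] at r4
  rw [e1, e2]
  have s : ∀ i k, i ≠ 0 → k ≠ 0 → i ≠ k → classSign i i * classBracket k i +
      classSign (i + k) (i + k) * classBracket k (i + k) = 0 := by decide
  have s' : (classSign i i * classBracket k i +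
      classSign (i + k) (i + k) * classBracket k (i + k) : ℂ) = 0 := by
    exact_mod_cast s i k hi hk hik
  linear_combination classSign i i * (c i j * r2 + c i (i + (k + j)) * r1) +
    classSign (i + k) (i + k) * (c (i + k) j * r4 + c (i + k) (i + j) * r3) +
    (c (i + k) (i + j) * c i j + c i (i + (k + j)) * c (i + k) j) * s'

/-- The normalized square of `E i` on the class `j`. -/
def square (c : ZMod 2 × ZMod 2 → ZMod 2 × ZMod 2 → ℂ) (i j : ZMod 2 × ZMod 2) : ℂ :=
  classSign i i * (c i (i + j) * c i j)

theorem square_add (i j : ZMod 2 × ZMod 2) : square c i (i + j) = square c i j := by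
  rw [square, add_add_self_class, square, mul_comm (c i j)]

/-- The Casimir element is constant on the edges of the graph of classes. -/
theorem casimir_eq (h : ClassConstants T c) {k j : ZMod 2 × ZMod 2} (hkj : c k j ≠ 0) :
    square c (1, 0) (k + j) + square c (0, 1) (k + j) + square c (1, 1) (k + j) =
      square c (1, 0) j + square c (0, 1) j + square c (1, 1) j := by
  have key : ∀ i, i ≠ 0 → i ≠ k → square c i (k + j) + square c (i + k) (k + j) +
      square c k (k + j) = square c i j + square c (i + k) j + square c k j := by
    intro i hi hik
    have := (mul_eq_zero.mp (h.casimir_pair hi (h.ne_zero_left hkj) hik j)).resolve_right hkj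
    rw [square_add]
    unfold square
    linear_combination -this
  have hk := h.ne_zero_left hkj
  have cases : ∀ k : ZMod 2 × ZMod 2, k ≠ 0 → k = (1, 0) ∨ k = (0, 1) ∨ k = (1, 1) := by decide
  rcases cases k hk with rfl | rfl | rfl
  · have t := key (0, 1) (by decide) (by decide)
    rw [show ((0, 1) + (1, 0) : ZMod 2 × ZMod 2) = (1, 1) by decide] at t
    linear_combination t
  · have t := key (1, 0) (by decide) (by decide)
    rw [show ((1, 0) + (0, 1) : ZMod 2 × ZMod 2) = (1, 1) by decide] at t
    linear_combination t
  · have t := key (1, 0) (by decide) (by decide)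
    rw [show ((1, 0) + (1, 1) : ZMod 2 × ZMod 2) = (0, 1) by decide] at t
    linear_combination t

/-- The Casimir value is the same on all classes, because the graph of classes is connected and it
is constant along edges. Each square is moreover invariant under translation by its own class, and
the resulting linear system makes every square constant. -/
theorem square_eq (h : ClassConstants T c) (hT : ∀ j, T j) {i : ZMod 2 × ZMod 2} (hi : i ≠ 0)
    (j : ZMod 2 × ZMod 2) : square c i j = square c i 0 := by
  have K := h.conn (fun j => square c (1, 0) j + square c (0, 1) j + square c (1, 1) j =
    square c (1, 0) 0 + square c (0, 1) 0 + square c (1, 1) 0) ⟨0, rfl, hT 0⟩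
    (fun i j hJ hij => (h.casimir_eq hij).trans hJ)
  have k1 := K (1, 0) (hT _)
  have k2 := K (0, 1) (hT _)
  have k3 := K (1, 1) (hT _)
  have q := fun i j => square_add (c := c) i j
  have q1 : square c (1, 0) (1, 0) = square c (1, 0) 0 := q (1, 0) 0
  have q2 : square c (1, 0) (1, 1) = square c (1, 0) (0, 1) := q (1, 0) (0, 1)
  have q3 : square c (0, 1) (0, 1) = square c (0, 1) 0 := q (0, 1) 0
  have q4 : square c (0, 1) (1, 1) = square c (0, 1) (1, 0) := q (0, 1) (1, 0)
  have q5 : square c (1, 1) (1, 1) = square c (1, 1) 0 := q (1, 1) 0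
  have q6 : square c (1, 1) (0, 1) = square c (1, 1) (1, 0) := q (1, 1) (1, 0)
  rw [q1] at k1
  rw [q3, q6] at k2
  rw [q2, q4, q5] at k3
  have a1 : square c (1, 0) (0, 1) = square c (1, 0) 0 := by
    linear_combination (k2 + k3 - k1) / 2
  have a2 : square c (0, 1) (1, 0) = square c (0, 1) 0 := by
    linear_combination (k1 + k3 - k2) / 2
  have a3 : square c (1, 1) (1, 0) = square c (1, 1) 0 := by
    linear_combination (k1 + k2 - k3) / 2
  have ci : ∀ k : ZMod 2 × ZMod 2, k ≠ 0 → k = (1, 0) ∨ k = (0, 1) ∨ k = (1, 1) := by decide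
  have cj : ∀ k : ZMod 2 × ZMod 2, k = 0 ∨ k = (1, 0) ∨ k = (0, 1) ∨ k = (1, 1) := by decide
  rcases ci i hi with rfl | rfl | rfl <;> rcases cj j with rfl | rfl | rfl | rfl <;>
    simp only [q1, q2, q3, q4, q5, q6, a1, a2, a3]

/-- With E_i² equal to its sign times a, the double commutator at l and at i + l is a pair of linear
equations for `c k l` and `c k (i + l)`. It forces (2a - 4)² = 4a² as soon as `c k l` is nonzero,
that is a = 1. -/
theorem square_eq_one (h : ClassConstants T c) (hT : ∀ j, T j) (hc : ∃ i j, c i j ≠ 0)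
    {i : ZMod 2 × ZMod 2} (hi : i ≠ 0) (j : ZMod 2 × ZMod 2) : square c i j = 1 := by
  have hs : ∀ i, (classSign i i : ℂ) * classSign i i = 1 := by
    intro i
    have : ∀ i, classSign i i * classSign i i = 1 := by decide
    exact_mod_cast this i
  -- E_i is a multiple of the commutator of the other two generators, so E_i cannot be the only one
  -- acting nontrivially.
  obtain ⟨k, l, hk, hkl⟩ : ∃ k l, k ≠ i ∧ c k l ≠ 0 := by
    by_contra! hn
    obtain ⟨i', j', hc⟩ := hc
    by_cases hi' : i' = i
    swap
    · exact hc (hn _ _ hi')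
    subst hi'
    have s : ∀ i, i ≠ 0 → ∃ k, k ≠ i ∧ i + k ≠ i ∧ classBracket k (i + k) ≠ 0 ∧
        k + (i + k) = i := by decide
    obtain ⟨k, h1, h2, h3, h4⟩ := s i' hi
    have r := h.rel k (i' + k) j'
    rw [hn k _ h1, hn k _ h1, h4, zero_mul, mul_zero, sub_zero, eq_comm] at r
    exact mul_ne_zero (Int.cast_ne_zero.mpr h3) hc r
  have hk0 := h.ne_zero_left hkl
  have r1 := h.double_commutator hi hk0 (Ne.symm hk) l
  have r2 := h.double_commutator hi hk0 (Ne.symm hk) (i + l)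
  have s1 := h.square_eq hT hi l
  have s2 := h.square_eq hT hi (k + l)
  rw [h.square_eq hT hi j]
  rw [add_left_comm k i l, add_add_self_class, add_add_self_class] at r2
  generalize square c i 0 = a at *
  unfold square at s1 s2
  have t1 : c i (i + l) * c i l = classSign i i * a := by
    linear_combination classSign i i * s1 - c i (i + l) * c i l * hs i
  have t2 : c i (i + (k + l)) * c i (k + l) = classSign i i * a := by
    linear_combination classSign i i * s2 - c i (i + (k + l)) * c i (k + l) * hs i
  have t3 : (2 * a - 4) * c k l = 2 * classSign i i * (c i (i + (k + l)) * c k (i + l) * c i l) := by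
    linear_combination classSign i i * r1 - classSign i i * c k l * t1 - classSign i i * c k l * t2
      - (2 * a - 4) * c k l * hs i
  have t4 : (2 * a - 4) * c k (i + l) = 2 * classSign i i * (c i (k + l) * c k l * c i (i + l)) := by
    linear_combination classSign i i * r2 - classSign i i * c k (i + l) * t1
      - classSign i i * c k (i + l) * t2 - (2 * a - 4) * c k (i + l) * hs i
  -- Substituting `t4` into `t3`; the coefficient is (2a - 4)² - 4a².
  have t5 : (16 - 16 * a) * c k l = 0 := by
    linear_combination (2 * a - 4) * t3 + 2 * classSign i i * c i (i + (k + l)) * c i l * t4 +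
      4 * classSign i i * classSign i i * c k l * c i (i + l) * c i l * t2 +
      4 * classSign i i * classSign i i * c k l * classSign i i * a * t1 +
      4 * c k l * a ^ 2 * (classSign i i * classSign i i + 1) * hs i
  linear_combination -((mul_eq_zero.mp t5).resolve_right hkl) / 16

theorem mul_self_eq (h : ClassConstants T c) (hT : ∀ j, T j) (hc : ∃ i j, c i j ≠ 0)
    {i : ZMod 2 × ZMod 2} (hi : i ≠ 0) (j : ZMod 2 × ZMod 2) :
    c i (i + j) * c i j = classSign i i := by
  have hs : ∀ i, classSign i i * classSign i i = 1 := by decide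
  have hs' : (classSign i i : ℂ) * classSign i i = 1 := by exact_mod_cast hs i
  have := h.square_eq_one hT hc hi j
  unfold square at this
  linear_combination classSign i i * this - c i (i + j) * c i j * hs'

/-- Once the squares are the signs, the double commutator becomes E_i E_k E_i = -E_i² E_k. As E_i is
invertible, E_i and E_k anticommute, and E_i E_k is half their commutator. The Lie action thus
extends to the associative algebra of classes. -/
theorem mul_eq (h : ClassConstants T c) (hT : ∀ j, T j) (hc : ∃ i j, c i j ≠ 0)
    {i k : ZMod 2 × ZMod 2} (hi : i ≠ 0) (hk : k ≠ 0) (hik : i ≠ k) (j : ZMod 2 × ZMod 2) :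
    c i (k + j) * c k j = classSign i k * c (i + k) j := by
  have r := h.double_commutator hi hk hik j
  have s := h.mul_self_eq hT hc hi
  rw [s, s] at r
  have hn : c i (i + (k + j)) ≠ 0 := by
    intro h0
    have := s (k + j)
    rw [h0, zero_mul, eq_comm, Int.cast_eq_zero] at this
    revert this
    have : ∀ i, classSign i i ≠ 0 := by decide
    exact this i
  have anti : c i (k + j) * c k j + c k (i + j) * c i j = 0 := by
    apply mul_left_cancel₀ hn
    linear_combination -r / 2 + c k j * s (k + j)
  have t := h.rel i k j
  have s2 : ∀ i k, i ≠ 0 → k ≠ 0 → i ≠ k → classBracket i k = 2 * classSign i k := by decide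
  have s3 : (classBracket i k : ℂ) = 2 * classSign i k := by exact_mod_cast s2 i k hi hk hik
  rw [s3] at t
  linear_combination t / 2 + anti / 2

/-- When all the classes occur, the structure constants are those of `A_{0,α,b}` up to scaling. -/
theorem exists_gauge (h : ClassConstants T c) (hT : ∀ j, T j) (hc : ∃ i j, c i j ≠ 0) :
    ∃ τ : ZMod 2 × ZMod 2 → ℂ, (∀ j, τ j ≠ 0) ∧
      ∀ i j, i ≠ 0 → c i j * τ j = classSign i j * τ (i + j) := by
  have s := fun i hi => h.mul_self_eq (i := i) hT hc hi
  -- The new basis vector of class j is E_j applied to that of class 0. The class j = 0 is treated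
  -- apart, because `c 0 0` is 0 whereas the unit of M_2(ℂ) should act by 1.
  refine ⟨fun j => if j = 0 then 1 else c j 0, ?_, ?_⟩
  · intro j
    dsimp only
    split_ifs with hj
    · exact one_ne_zero
    · intro h0
      have := s j hj 0
      rw [h0, mul_zero, eq_comm, Int.cast_eq_zero] at this
      revert this
      have : ∀ i, classSign i i ≠ 0 := by decide
      exact this j
  · intro i j hi
    dsimp only
    by_cases hj : j = 0
    · subst hj
      have : ∀ i, classSign i 0 = 1 := by decide
      rw [add_zero, if_pos rfl, if_neg hi, this]
      simp
    · by_cases hij : i = j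
      · subst hij
        have e : i + i = 0 := by rw [CharTwo.add_self_eq_zero]
        have := s i hi 0
        rw [add_zero] at this
        rw [e, if_neg hj, if_pos rfl, mul_one, this]
      · have hne : i + j ≠ 0 := by
          revert i j; decide
        rw [if_neg hj, if_neg hne]
        have := h.mul_eq hT hc hi hj hij 0
        rwa [add_zero] at this

end ClassConstants
end

/-! ### The finite problem with a missing class -/

noncomputable section

open QTorus Filter

namespace ClassConstants

variable {T : ZMod 2 × ZMod 2 → Prop} {c : ZMod 2 × ZMod 2 → ZMod 2 × ZMod 2 → ℂ}
  {t : ZMod 2 × ZMod 2}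

/-- The coefficient from the class `t + x` to the class `t + y`, relative to that of the adjoint
action. -/
def ratio (c : ZMod 2 × ZMod 2 → ZMod 2 × ZMod 2 → ℂ) (t x y : ZMod 2 × ZMod 2) : ℂ :=
  c (x + y) (t + x) / classBracket (x + y) x

/-- Since t does not occur, E_x kills the class t + x. The commutator of E_x and E_z therefore acts
there by a single composite, which reads the step from x to z as the steps from x to y and from y to
z. -/
theorem ratio_mul_ratio (h : ClassConstants T c) (ht : ¬ T t) {x y z : ZMod 2 × ZMod 2}
    (hx : x ≠ 0) (hy : y ≠ 0) (hz : z ≠ 0) (hxy : x ≠ y) (hyz : y ≠ z) (hxz : x ≠ z) :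
    ratio c t y z * ratio c t x y = ratio c t x z := by
  have e0 : ∀ x y z : ZMod 2 × ZMod 2, (x ≠ 0 ∧ y ≠ 0 ∧ z ≠ 0 ∧ x ≠ y ∧ y ≠ z ∧ x ≠ z) →
      y + z = x ∧ x + y = z ∧ x + z = y ∧ classBracket x y * classBracket z x ≠ 0 ∧
      classBracket x y * classBracket z x = classBracket x z * classBracket y x := by decide
  obtain ⟨e1, e2, e3, e6, e8⟩ := e0 x y z ⟨hx, hy, hz, hxy, hyz, hxz⟩
  have e4 : z + (t + x) = t + y := by rw [← e3]; abel
  have e5 : x + (t + x) = t := by rw [add_comm t, add_add_self_class]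
  have r := h.rel x z (t + x)
  have hz0 : c x (t + x) = 0 := by
    by_contra hn
    have := (h.supp _ _ hn).2
    rw [e5] at this
    exact ht this
  rw [hz0, e4, e3, mul_zero, sub_zero] at r
  have e6' : (classBracket x y : ℂ) * classBracket z x ≠ 0 := by exact_mod_cast e6
  have e8' : (classBracket x y : ℂ) * classBracket z x = classBracket x z * classBracket y x := by
    exact_mod_cast e8
  rw [ratio, ratio, ratio, div_mul_div_comm, e1, e2, e3, r, e8']
  rw [e8'] at e6'
  exact mul_div_mul_left _ _ (left_ne_zero_of_mul e6')

theorem third_class : ∀ x y : ZMod 2 × ZMod 2, x ≠ 0 → y ≠ 0 → x ≠ y →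
    x + y ≠ 0 ∧ x ≠ x + y ∧ y ≠ x + y := by decide

/-- Multiplicativity means that a nonzero ratio has nonzero factors; starting from one nonzero ratio
this reaches all six ordered pairs of nonzero classes. -/
theorem ratio_ne_zero (h : ClassConstants T c) (ht : ¬ T t) (hc : ∃ i j, c i j ≠ 0)
    {x y : ZMod 2 × ZMod 2} (hx : x ≠ 0) (hy : y ≠ 0) (hxy : x ≠ y) : ratio c t x y ≠ 0 := by
  have step : ∀ x y z : ZMod 2 × ZMod 2, x ≠ 0 → y ≠ 0 → z ≠ 0 → x ≠ y → y ≠ z → x ≠ z →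
      ratio c t x z ≠ 0 → ratio c t y z ≠ 0 ∧ ratio c t x y ≠ 0 := by
    intro x y z hx hy hz hxy hyz hxz hn
    rw [← h.ratio_mul_ratio ht hx hy hz hxy hyz hxz] at hn
    exact mul_ne_zero_iff.mp hn
  obtain ⟨i, j, hij⟩ := hc
  obtain ⟨h1, h2⟩ := h.supp _ _ hij
  have e : ∀ t i j : ZMod 2 × ZMod 2, i ≠ 0 → j ≠ t → i + j ≠ t → t + j ≠ 0 ∧ t + (i + j) ≠ 0 ∧
      t + j ≠ t + (i + j) ∧ t + j + (t + (i + j)) = i ∧ t + (t + j) = j ∧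
      classBracket i (t + j) ≠ 0 := by decide
  obtain ⟨e1, e2, e3, e4, e5, e6⟩ := e t i j (h.ne_zero_left hij)
    (fun he => ht (he ▸ h1)) (fun he => ht (he ▸ h2))
  have h0 : ratio c t (t + j) (t + (i + j)) ≠ 0 := by
    rw [ratio, e4, e5]
    exact div_ne_zero hij (Int.cast_ne_zero.mpr e6)
  generalize t + j = a at h0 e1 e2 e3
  generalize t + (i + j) = b at h0 e1 e2 e3
  obtain ⟨d1, d2, d3⟩ := third_class a b e1 e2 e3
  obtain ⟨k1, k2⟩ := step a (a + b) b e1 d1 e2 d2 (Ne.symm d3) e3 h0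
  obtain ⟨k3, _⟩ := step a b (a + b) e1 e2 d1 e3 d3 d2 k2
  obtain ⟨_, k4⟩ := step (a + b) a b d1 e1 e2 (Ne.symm d2) e3 (Ne.symm d3) k1
  obtain ⟨k5, _⟩ := step (a + b) b a d1 e2 e1 (Ne.symm d3) (Ne.symm e3) (Ne.symm d2) k4
  have cases : ∀ a b x : ZMod 2 × ZMod 2, a ≠ 0 → b ≠ 0 → a ≠ b → x ≠ 0 →
      x = a ∨ x = b ∨ x = a + b := by decide
  rcases cases a b x e1 e2 e3 hx with rfl | rfl | rfl <;>
    rcases cases _ _ y e1 e2 e3 hy with rfl | rfl | rfl <;>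
    first | assumption | exact absurd rfl hxy

/-- When a class `t` does not occur and the action is not trivial, the structure constants are
those of `A'_{1,α,b}` up to scaling. -/
theorem exists_gauge_of_missing (h : ClassConstants T c) (ht : ¬ T t) (hc : ∃ i j, c i j ≠ 0) :
    (∀ j, T j ↔ j ≠ t) ∧ ∃ τ : ZMod 2 × ZMod 2 → ℂ, (∀ j, τ j ≠ 0) ∧
      ∀ i j, i ≠ 0 → c i j * τ j = classBracket i (t + j) * τ (i + j) := by
  have hn := fun x y hx hy hxy => h.ratio_ne_zero (x := x) (y := y) ht hc hx hy hxy
  -- Going from the third class to y through x, and to x through y, and cancelling.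
  have inv : ∀ x y, x ≠ 0 → y ≠ 0 → x ≠ y → ratio c t x y * ratio c t y x = 1 := by
    intro x y hx hy hxy
    obtain ⟨hz, hxz, hyz⟩ := third_class x y hx hy hxy
    have r1 := h.ratio_mul_ratio ht hz hx hy (Ne.symm hxz) hxy (Ne.symm hyz)
    have r2 := h.ratio_mul_ratio ht hz hy hx (Ne.symm hyz) (Ne.symm hxy) (Ne.symm hxz)
    apply mul_right_cancel₀ (hn (x + y) y hz hy (Ne.symm hyz))
    rw [mul_assoc, r2, r1, one_mul]
  refine ⟨fun j => ⟨fun hj he => ht (he ▸ hj), fun hj => ?_⟩, ?_⟩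
  · have e : ∀ t j : ZMod 2 × ZMod 2, j ≠ t → ∃ y, t + j ≠ 0 ∧ y ≠ 0 ∧ t + j ≠ y ∧
        t + (t + j) = j := by decide
    obtain ⟨y, h1, h2, h3, h4⟩ := e t j hj
    have := hn _ _ h1 h2 h3
    rw [ratio, h4] at this
    exact (h.supp _ _ (div_ne_zero_iff.mp this).1).1
  -- The scale is the ratio from the base class t + (1,0). It is 1 at the base, where the ratio
  -- formula would divide by 0; at the missing class t only its being nonzero matters.
  · refine ⟨fun j => if t + j = 0 ∨ t + j = (1, 0) then 1 else ratio c t (1, 0) (t + j), ?_, ?_⟩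
    · intro j
      dsimp only
      split_ifs with hj
      · exact one_ne_zero
      · push Not at hj
        exact hn _ _ (by decide) hj.1 hj.2.symm
    · intro i j hi
      dsimp only
      by_cases hj : t + j = 0
      · have e1 : ∀ t j : ZMod 2 × ZMod 2, t + j = 0 → j = t := by decide
        have e2 : ∀ i, classBracket i 0 = 0 := by decide
        have : c i j = 0 := by
          by_contra hne
          exact ht (e1 t j hj ▸ (h.supp _ _ hne).1)
        rw [this, hj, e2]
        simp
      by_cases hij : t + (i + j) = 0
      · have e1 : ∀ t i j : ZMod 2 × ZMod 2, t + (i + j) = 0 → i + j = t ∧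
          classBracket i (t + j) = 0 := by decide
        obtain ⟨e1, e2⟩ := e1 t i j hij
        have : c i j = 0 := by
          by_contra hne
          exact ht (e1 ▸ (h.supp _ _ hne).2)
        rw [this, e2]
        simp
      have e : ∀ t i j : ZMod 2 × ZMod 2, i ≠ 0 → t + j ≠ 0 → t + (i + j) ≠ 0 →
        t + j ≠ t + (i + j) ∧ t + j + (t + (i + j)) = i ∧ t + (t + j) = j ∧
        classBracket i (t + j) ≠ 0 := by decide
      obtain ⟨e1, e2, e3, e5⟩ := e t i j hi hj hij
      have e5' : (classBracket i (t + j) : ℂ) ≠ 0 := Int.cast_ne_zero.mpr e5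
      have key : c i j = ratio c t (t + j) (t + (i + j)) * classBracket i (t + j) := by
        rw [ratio, e2, e3, div_mul_cancel₀ _ e5']
      rw [key]
      clear e2 e3 key
      generalize t + j = x at *
      generalize t + (i + j) = y at *
      simp only [hj, hij, false_or]
      by_cases hx : x = (1, 0)
      · rw [if_pos hx, if_neg (by rw [← hx]; exact e1.symm), hx]; ring
      rw [if_neg hx]
      by_cases hy : y = (1, 0)
      · rw [if_pos hy, hy]
        linear_combination classBracket i x * inv x (1, 0) hj (by decide) hx
      · rw [if_neg hy, ← h.ratio_mul_ratio ht (by decide) hj hij (Ne.symm hx) e1 (Ne.symm hy)]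
        ring

/-- When the action of the classes is trivial, a single class occurs. -/
theorem eq_of_trivial (h : ClassConstants T c) (hc : ∀ i j, c i j = 0) {j j' : ZMod 2 × ZMod 2}
    (hj : T j) (hj' : T j') : j' = j :=
  h.conn (fun l => l = j) ⟨j, rfl, hj⟩ (fun i l _ hn => absurd (hc i l) hn) j' hj'

end ClassConstants
end

/-! ### Coordinates in the model modules and comparison with V -/

noncomputable section

open QTorus Filter

namespace ModA

variable {a : Fin 2} {α : ℂ × ℂ} {b : ℂ}

/-- The coordinates in the basis `v_k`. -/
def coord (k : ℤ × ℤ) : ModA a α b →ₗ[ℂ] ℂ := coef k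

theorem coord_v (k l : ℤ × ℤ) : coord k (v a α b l) = if l = k then 1 else 0 := coef_mono k l

theorem coord_v_self (k : ℤ × ℤ) : coord k (v a α b k) = 1 := by rw [coord_v, if_pos rfl]

theorem ext_coord {x y : ModA a α b} (h : ∀ k, coord k x = coord k y) : x = y := QTorus.ext h

theorem mem_of_forall_coord {S : Submodule ℂ (ModA a α b)} (x : ModA a α b)
    (h : ∀ k, coord k x ≠ 0 → v a α b k ∈ S) : x ∈ S :=
  mem_of_forall_coef (q := -1) (S := S) x h

theorem lie_evenDer_v (p : ℤ × ℤ) (c : ℂ × ℂ) (k : ℤ × ℤ) :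
    ⁅evenDer p c, v a α b k⁆ = pairing c (α + toC k + b • dbl p) • v a α b (k + (p + p)) := by
  rw [add_comm k]
  exact central_v (inTwo_add_self p) c k

theorem lie_adMono_v {m : ℤ × ℤ} (hm : ¬ InTwo m) (k : ℤ × ℤ) :
    ⁅adMono m, v a α b k⁆ =
      ((-1 : ℂ) ^ (m.2 * k.1) - (a : ℕ) * (-1 : ℂ) ^ (m.1 * k.2)) • v a α b (k + m) := by
  rw [add_comm k]
  exact inner_v hm k

theorem v_mem_weightSpace (k : ℤ × ℤ) : v a α b k ∈ weightSpace (ModA a α b) (latWt α k) := by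
  rw [mem_weightSpace]
  intro c
  rw [lie_evenDer_v, dbl_zero, smul_zero, add_zero, add_zero, add_zero, latWt]

/-- An operator sending each basis vector to a multiple of its translate by d acts coordinatewise;
this is the dual description, valid for arbitrary vectors. -/
theorem coord_lie {D : DerCq} {d : ℤ × ℤ} {r : ℤ × ℤ → ℂ}
    (h : ∀ k, ⁅D, v a α b k⁆ = r k • v a α b (k + d)) (k : ℤ × ℤ) (y : ModA a α b) :
    coord (k + d) ⁅D, y⁆ = r k * coord k y := by
  have hy : y ∈ LinearMap.ker (coord (k + d) ∘ₗ LieModule.toEnd ℂ DerCq (ModA a α b) D -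
      r k • coord k) := by
    apply mem_of_forall_coord
    intro l _
    rw [LinearMap.mem_ker]
    change coord (k + d) ⁅D, v a α b l⁆ - r k * coord k (v a α b l) = 0
    rw [h, map_smul, coord_v, coord_v, smul_eq_mul]
    by_cases hl : l = k
    · rw [if_pos hl, if_pos (by rw [hl]), hl, sub_self]
    · rw [if_neg hl, if_neg (fun h => hl (add_right_cancel h))]; ring
  exact sub_eq_zero.mp (LinearMap.mem_ker.mp hy)

theorem coord_eq_zero_of_mem_weightSpace {nu : ℂ × ℂ} {k : ℤ × ℤ} (hne : nu ≠ latWt α k)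
    {y : ModA a α b} (hy : y ∈ weightSpace (ModA a α b) nu) : coord k y = 0 := by
  obtain ⟨c, hc⟩ := exists_pairing_ne_zero (sub_ne_zero.mpr hne)
  have h := coord_lie (D := evenDer 0 c) (d := 0) (fun k => lie_evenDer_v (b := b) (α := α) (a := a)
    0 c k) k y
  rw [mem_weightSpace.mp hy, dbl_zero, smul_zero, add_zero, add_zero, map_smul, smul_eq_mul] at h
  apply (mul_eq_zero.mp ?_).resolve_left hc
  rw [pairing_sub_right, sub_mul, h, latWt, sub_self]

end ModA

section

variable {V : Type*} [AddCommGroup V] [Module ℂ V] [LieRingModule DerCq V] [LieModule ℂ DerCq V]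

/-- The coefficient of the action of `adMono m` on the vector of index `k` of `A_{a,α,b}`, when
indices are translated by `s`. -/
def adCoeff (a : Fin 2) (s m k : ℤ × ℤ) : ℂ :=
  (-1 : ℂ) ^ (m.2 * (k - s).1) - (a : ℕ) * (-1 : ℂ) ^ (m.1 * (k - s).2)

/-- A basis of the weight spaces of nonzero weight of `V` in `lam + ℤ²`, supported on the classes
in `T`, on which `Der ℂ_q` acts as on the basis of `A_{a,α,β}` with indices translated by `s`. -/
structure IsModelBasis (lam : ℂ × ℂ) (T : ZMod 2 × ZMod 2 → Prop) (a : Fin 2) (s : ℤ × ℤ) (β : ℂ)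
    (w : ℤ × ℤ → V) : Prop where
  mem : ∀ k, latWt lam k ≠ 0 → w k ∈ weightSpace V (latWt lam k)
  ne_zero : ∀ k, latWt lam k ≠ 0 → (w k ≠ 0 ↔ T (parity k))
  lie_evenDer : ∀ k p c, latWt lam k ≠ 0 → latWt lam (k + (p + p)) ≠ 0 →
    ⁅evenDer p c, w k⁆ = pairing c (latWt lam k + β • dbl p) • w (k + (p + p))
  lie_adMono : ∀ k m, ¬ InTwo m → T (parity k) → latWt lam k ≠ 0 → latWt lam (k + m) ≠ 0 →
    ⁅adMono m, w k⁆ = adCoeff a s m k • w (k + m)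
  adCoeff_eq_zero : ∀ k m, ¬ InTwo m → T (parity k) → ¬ T (parity (k + m)) → adCoeff a s m k = 0

variable {lam : ℂ × ℂ} {T : ZMod 2 × ZMod 2 → Prop} {a : Fin 2} {s : ℤ × ℤ} {β : ℂ} {w : ℤ × ℤ → V}

theorem lie_evenDer_v_sub (p : ℤ × ℤ) (c : ℂ × ℂ) (k : ℤ × ℤ) :
    ⁅evenDer p c, ModA.v a (latWt lam s) β (k - s)⁆ =
      pairing c (latWt lam k + β • dbl p) • ModA.v a (latWt lam s) β (k + (p + p) - s) := by
  rw [ModA.lie_evenDer_v, ← sub_add_eq_add_sub]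
  congr 3
  rw [← latWt_add, add_sub_cancel]

theorem lie_adMono_v_sub {m : ℤ × ℤ} (hm : ¬ InTwo m) (k : ℤ × ℤ) :
    ⁅adMono m, ModA.v a (latWt lam s) β (k - s)⁆ =
      adCoeff a s m k • ModA.v a (latWt lam s) β (k + m - s) := by
  rw [ModA.lie_adMono_v hm, ← sub_add_eq_add_sub]
  rfl

open Classical in
/-- A model basis of `V` with support in the classes of `T` presents `V` as a quotient of a submodule
of any submodule `M` of the model that contains the corresponding basis vectors. -/
theorem IsModelBasis.exists_hom (hirr : LieModule.IsIrreducible ℂ DerCq V)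
    (hV : IsIntermediateSeries V) (hw : IsModelBasis lam T a s β w)
    (hT : ∃ k, latWt lam k ≠ 0 ∧ T (parity k))
    {M : Type*} [AddCommGroup M] [Module ℂ M] [LieRingModule DerCq M] [LieModule ℂ DerCq M]
    (ι : M →ₗ⁅ℂ, DerCq⁆ ModA a (latWt lam s) β) (hι : Function.Injective ι) (u : ℤ × ℤ → M)
    (hu : ∀ k, ι (u k) = if T (parity k) then ModA.v a (latWt lam s) β (k - s) else 0) :
    ∃ (Q : LieSubmodule ℂ DerCq M) (φ : Q →ₗ⁅ℂ, DerCq⁆ V), Function.Surjective φ ∧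
      (∀ k, latWt lam k ≠ 0 → u k ∈ Q) ∧
      ∀ y : Q, φ y = 0 → ∀ k, latWt lam k ≠ 0 → T (parity k) →
        ModA.coord (k - s) (ι (y : M)) = 0 := by
  have wt_sub : ∀ k, latWt (latWt lam s) (k - s) = latWt lam k := by
    intro k
    conv_lhs => rw [latWt]
    rw [← latWt_add, add_sub_cancel]
  have hιw : ∀ nu y, y ∈ weightSpace M nu → ι y ∈ weightSpace (ModA a (latWt lam s) β) nu := by
    intro nu y hy
    rw [mem_weightSpace] at hy ⊢
    intro c
    rw [← LieModuleHom.map_lie, hy, map_smul]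
  obtain ⟨k₁, hk₁, hTk₁⟩ := hT
  have hw0 : ∀ k, latWt lam k ≠ 0 → ¬ T (parity k) → w k = 0 := by
    intro k hk h
    by_contra hn
    exact h ((hw.ne_zero k hk).mp hn)
  -- A model basis is unconstrained at weight 0; truncating it there makes the normalization of the
  -- coordinate functionals hold for every index with w' k ≠ 0.
  let w' : ℤ × ℤ → V := fun k => if latWt lam k = 0 then 0 else w k
  have hw' : ∀ k, latWt lam k ≠ 0 → w' k = w k := fun k hk => if_neg hk
  obtain ⟨Q, φ, h1, h2, h4⟩ := exists_hom_of_matching hirr hV.isInternal (lam := lam) (w := w')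
    (v := u) (f := fun k => ModA.coord (k - s) ∘ₗ (ι : M →ₗ[ℂ] ModA a (latWt lam s) β))
    (fun k hk => by rw [hw' k hk]; exact hw.mem k hk)
    (by
      intro k hk
      rw [mem_weightSpace]
      intro c
      apply hι
      rw [LieModuleHom.map_lie, map_smul, hu]
      split_ifs
      · have := ModA.v_mem_weightSpace (a := a) (α := latWt lam s) (b := β) (k - s)
        rw [wt_sub, mem_weightSpace] at this
        exact this c
      · simp)
    (by
      intro k d X hk hd hX
      rw [hw' k hk, hw' _ hd]
      suffices h : ⁅X, (w k, u k)⁆ ∈ Submodule.span ℂ {(w (k + d), u (k + d))} by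
        obtain ⟨c, hc⟩ := Submodule.mem_span_singleton.mp h
        exact ⟨c, (congrArg Prod.fst hc).symm, (congrArg Prod.snd hc).symm⟩
      have hmem : ∀ D : DerCq, (∃ c : ℂ, ⁅D, w k⁆ = c • w (k + d) ∧
          ι ⁅D, u k⁆ = c • ι (u (k + d))) →
          ⁅D, (w k, u k)⁆ ∈ Submodule.span ℂ {(w (k + d), u (k + d))} := by
        rintro D ⟨c, hc1, hc2⟩
        rw [← map_smul] at hc2
        exact Submodule.mem_span_singleton.mpr ⟨c, Prod.ext hc1.symm (hι hc2).symm⟩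
      by_cases hTk : T (parity k)
      swap
      · have e1 := hw0 k hk hTk
        have e2 : u k = 0 := by
          apply hι
          rw [hu, if_neg hTk, map_zero]
        rw [e1, e2, Prod.mk_zero_zero, lie_zero]
        exact zero_mem _
      refine lie_mem_of_mem_derGrade (hmem _ ?_) ?_ hX
      · by_cases hm : InTwo d
        · obtain ⟨p, rfl⟩ := exists_add_self hm
          exact ⟨0, by simp [adMono_even], by simp [adMono_even]⟩
        · refine ⟨adCoeff a s d k, hw.lie_adMono k d hm hTk hk hd, ?_⟩
          rw [LieModuleHom.map_lie, hu, hu, if_pos hTk, lie_adMono_v_sub hm]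
          split_ifs with h
          · rfl
          · rw [hw.adCoeff_eq_zero k d hm hTk h, zero_smul, zero_smul]
      · rintro p c rfl
        refine hmem _ ⟨_, hw.lie_evenDer k p c hk hd, ?_⟩
        rw [LieModuleHom.map_lie, hu, hu, if_pos hTk, if_pos (by rwa [AdConstants.parity_shift]),
          lie_evenDer_v_sub])
    (by
      intro k hk
      have hk0 : latWt lam k ≠ 0 := fun h => hk (if_pos h)
      rw [hw' k hk0, hw.ne_zero k hk0] at hk
      change ModA.coord (k - s) (ι (u k)) = 1
      rw [hu, if_pos hk, ModA.coord_v_self])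
    (by
      intro k nu hnu y hy
      rw [← wt_sub] at hnu
      exact ModA.coord_eq_zero_of_mem_weightSpace hnu (hιw nu y hy))
    k₁ hk₁ (by rw [hw' _ hk₁]; exact (hw.ne_zero _ hk₁).mpr hTk₁)
  refine ⟨Q, φ, h1, h2, fun y hy k hk hTk => h4 y hy k hk ?_⟩
  rw [hw' k hk]
  exact (hw.ne_zero k hk).mpr hTk

open Classical in
/-- If the corresponding basis vectors span `M` and each is moved to and reached from another one by
some `adMono m`, then `V` is isomorphic to `M`. -/
theorem IsModelBasis.exists_bijective (hirr : LieModule.IsIrreducible ℂ DerCq V)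
    (hV : IsIntermediateSeries V) (hw : IsModelBasis lam T a s β w)
    (hT : ∃ k, latWt lam k ≠ 0 ∧ T (parity k))
    {M : Type*} [AddCommGroup M] [Module ℂ M] [LieRingModule DerCq M] [LieModule ℂ DerCq M]
    (ι : M →ₗ⁅ℂ, DerCq⁆ ModA a (latWt lam s) β) (hι : Function.Injective ι) (u : ℤ × ℤ → M)
    (hu : ∀ k, ι (u k) = if T (parity k) then ModA.v a (latWt lam s) β (k - s) else 0)
    (hM : ∀ y k, ¬ T (parity k) → ModA.coord (k - s) (ι y) = 0)
    (hout : ∀ k, T (parity k) → ∃ m, ¬ InTwo m ∧ T (parity (k + m)) ∧ adCoeff a s m k ≠ 0)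
    (hin : ∀ k, T (parity k) → ∃ m, ¬ InTwo m ∧ T (parity (k - m)) ∧ adCoeff a s m (k - m) ≠ 0) :
    ∃ φ : M →ₗ⁅ℂ, DerCq⁆ V, Function.Bijective φ := by
  obtain ⟨Q, φ, h1, h2, h3⟩ := hw.exists_hom hirr hV hT ι hι u hu
  have wt_ne : ∀ k l : ℤ × ℤ, latWt lam k = 0 → l ≠ k → latWt lam l ≠ 0 := by
    intro k l hk hl h
    exact hl (latWt_injective lam (h.trans hk.symm))
  have ne_zero : ∀ m : ℤ × ℤ, ¬ InTwo m → m ≠ 0 := by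
    rintro m hm rfl
    exact hm ⟨Even.zero, Even.zero⟩
  -- At most one index has weight 0. Its vector is obtained from one of nonzero weight by some
  -- `adMono m` with nonzero coefficient.
  have huQ : ∀ k, T (parity k) → u k ∈ Q := by
    intro k hk
    by_cases h0 : latWt lam k = 0
    swap
    · exact h2 k h0
    obtain ⟨m, hm, hTm, hc⟩ := hin k hk
    have e : ⁅adMono m, u (k - m)⁆ = adCoeff a s m (k - m) • u k := by
      apply hι
      rw [LieModuleHom.map_lie, map_smul, hu, hu, if_pos hTm, if_pos hk, lie_adMono_v_sub hm,
        sub_add_cancel]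
    have h4 : ⁅adMono m, u (k - m)⁆ ∈ Q :=
      Q.lie_mem (h2 _ (wt_ne k _ h0 (fun h => ne_zero m hm (sub_eq_self.mp h))))
    rw [e] at h4
    have h5 := Q.smul_mem (adCoeff a s m (k - m))⁻¹ h4
    rwa [smul_smul, inv_mul_cancel₀ hc, one_smul] at h5
  have hQ : ∀ y, y ∈ Q := by
    intro y
    have h4 : ι y ∈ Q.toSubmodule.map (ι : M →ₗ[ℂ] ModA a (latWt lam s) β) := by
      apply ModA.mem_of_forall_coord
      intro k hk
      have e : k = k + s - s := (add_sub_cancel_right k s).symm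
      rw [e] at hk
      have hT' : T (parity (k + s)) := by
        by_contra h
        exact hk (hM y _ h)
      refine ⟨u (k + s), huQ _ hT', ?_⟩
      change ι (u (k + s)) = _
      rw [hu, if_pos hT', ← e]
    obtain ⟨y', hy', e⟩ := h4
    rwa [← hι e]
  -- The coordinates of a kernel element at nonzero weights vanish already. The one at weight 0 is
  -- moved by some `adMono m` to a nonzero weight, staying in the kernel, so it vanishes too.
  have hinj : ∀ y : Q, φ y = 0 → y = 0 := by
    intro y hy
    apply Subtype.ext
    apply hι
    apply ModA.ext_coord
    intro k
    obtain ⟨l, rfl⟩ : ∃ l, k = l - s := ⟨k + s, (add_sub_cancel_right k s).symm⟩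
    change ModA.coord (l - s) (ι (y : M)) = ModA.coord (l - s) (ι 0)
    rw [map_zero, map_zero]
    by_cases hTl : T (parity l)
    swap
    · exact hM _ _ hTl
    by_cases h0 : latWt lam l = 0
    swap
    · exact h3 y hy l h0 hTl
    obtain ⟨m, hm, hTm, hc⟩ := hout l hTl
    have h4 : φ ⁅adMono m, y⁆ = 0 := by rw [LieModuleHom.map_lie, hy, lie_zero]
    have h5 := h3 _ h4 (l + m) (wt_ne l _ h0 (fun h => ne_zero m hm (add_eq_left.mp h))) hTm
    have e : ι ((⁅adMono m, y⁆ : Q) : M) = ⁅adMono m, ι (y : M)⁆ := by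
      rw [LieSubmodule.coe_bracket, LieModuleHom.map_lie]
    rw [e, ← sub_add_eq_add_sub, ModA.coord_lie (r := fun k => adCoeff a s m (k + s))] at h5
    · rw [sub_add_cancel] at h5
      exact (mul_eq_zero.mp h5).resolve_left hc
    · intro k
      rw [ModA.lie_adMono_v hm, adCoeff, add_sub_cancel_right]
  let j : M →ₗ⁅ℂ, DerCq⁆ Q :=
    { toFun := fun y => ⟨y, hQ y⟩
      map_add' := fun _ _ => rfl
      map_smul' := fun _ _ => rfl
      map_lie' := rfl }
  refine ⟨φ.comp j, ?_, ?_⟩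
  · intro y y' h
    have h' : φ ⟨y, hQ y⟩ = φ ⟨y', hQ y'⟩ := h
    rw [← sub_eq_zero, ← map_sub] at h'
    have := congrArg Subtype.val (hinj _ h')
    exact sub_eq_zero.mp this
  · intro x
    obtain ⟨y, hy⟩ := h1 x
    exact ⟨y, hy⟩

end
end

/-! ### Assembly of the classification -/

noncomputable section

open QTorus Filter

section

variable {V : Type*} [AddCommGroup V] [Module ℂ V] [LieRingModule DerCq V] [LieModule ℂ DerCq V]

theorem exists_classConstants_basis (hirr : LieModule.IsIrreducible ℂ DerCq V)
    (hV : IsIntermediateSeries V) (lam : ℂ × ℂ) :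
    ∃ (T : ZMod 2 × ZMod 2 → Prop) (β : ℂ) (c : ZMod 2 × ZMod 2 → ZMod 2 × ZMod 2 → ℂ)
      (w : ℤ × ℤ → V), ClassConstants T c ∧ ∀ k, latWt lam k ≠ 0 →
        w k ∈ weightSpace V (latWt lam k) ∧ (w k ≠ 0 ↔ T (parity k)) ∧
        (¬ T (parity k) → weightSpace V (latWt lam k) = ⊥) ∧
        (∀ p a, latWt lam (k + (p + p)) ≠ 0 → ⁅evenDer p a, w k⁆ =
          pairing a (latWt lam k + β • dbl p) • w (k + (p + p))) ∧
        ∀ m, latWt lam (k + m) ≠ 0 → ⁅adMono m, w k⁆ = c (parity m) (parity k) • w (k + m) := by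
  obtain ⟨T, b, w, e, he, hw⟩ := exists_adConstants hirr hV lam
  obtain ⟨β, hβ⟩ := he.exists_param
  obtain ⟨c, hc, hec⟩ := (he.const_param hβ).exists_classConstants
  refine ⟨T, β, c, w, hc, fun k hk => ?_⟩
  obtain ⟨h1, h2, h3, h4, h5⟩ := hw k hk
  refine ⟨h1, h2, h3, fun p a hp => ?_, fun m hm => ?_⟩
  · by_cases hT : T (parity k)
    · rw [h4 p a hp, hβ _ hT]
    · have z1 : w k = 0 := by
        by_contra h
        exact hT (h2.mp h)
      have z2 : w (k + (p + p)) = 0 := by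
        by_contra h
        have := (hw _ hp).2.1.mp h
        rw [AdConstants.parity_shift] at this
        exact hT this
      rw [z1, z2, lie_zero, smul_zero]
  · rw [h5 m hm, hec m k hk hm]

theorem adCoeff_parity (a : Fin 2) (s m k : ℤ × ℤ) : adCoeff a s m k =
    classSign (parity m) (parity s + parity k) -
      (a : ℕ) * classSign (parity s + parity k) (parity m) := by
  have e : parity s + parity k = parity (k - s) := by
    have : parity (k - s) + parity s = parity k := by rw [← parity_add, sub_add_cancel]
    rw [← this, add_comm (parity (k - s)), add_add_self_class]
  rw [e, classSign_parity, classSign_parity, adCoeff, mul_comm m.1]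

theorem parity_ne_zero {m : ℤ × ℤ} (hm : ¬ InTwo m) : parity m ≠ 0 :=
  fun h => hm (parity_eq_zero.mp h)

theorem parity_sub (k m : ℤ × ℤ) : parity (k - m) = parity k + parity m := by
  have : parity (k - m) + parity m = parity k := by rw [← parity_add, sub_add_cancel]
  rw [← this, add_assoc, CharTwo.add_self_eq_zero, add_zero]

/-- Rescaling by a function of the class leaves the formulas for W unchanged, since W preserves
classes, so only the constants of the inner derivations need to be matched with the model. -/
theorem isModelBasis_smul {lam : ℂ × ℂ} {T : ZMod 2 × ZMod 2 → Prop} {a : Fin 2} {s : ℤ × ℤ} {β : ℂ}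
    {c : ZMod 2 × ZMod 2 → ZMod 2 × ZMod 2 → ℂ} {w : ℤ × ℤ → V} (hc : ClassConstants T c)
    (hw : ∀ k, latWt lam k ≠ 0 → w k ∈ weightSpace V (latWt lam k) ∧ (w k ≠ 0 ↔ T (parity k)) ∧
      (¬ T (parity k) → weightSpace V (latWt lam k) = ⊥) ∧
      (∀ p a, latWt lam (k + (p + p)) ≠ 0 → ⁅evenDer p a, w k⁆ =
        pairing a (latWt lam k + β • dbl p) • w (k + (p + p))) ∧
      ∀ m, latWt lam (k + m) ≠ 0 → ⁅adMono m, w k⁆ = c (parity m) (parity k) • w (k + m))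
    {τ : ZMod 2 × ZMod 2 → ℂ} (hτ : ∀ j, τ j ≠ 0)
    (hcτ : ∀ i j, i ≠ 0 → T j → c i j * τ j = (classSign i (parity s + j) -
      (a : ℕ) * classSign (parity s + j) i) * τ (i + j)) :
    IsModelBasis lam T a s β fun k => τ (parity k) • w k where
  mem k hk := Submodule.smul_mem _ _ (hw k hk).1
  ne_zero k hk := by rw [smul_ne_zero_iff, (hw k hk).2.1]; exact and_iff_right (hτ _)
  lie_evenDer k p x hk hp := by
    rw [lie_smul, (hw k hk).2.2.2.1 p x hp, AdConstants.parity_shift, smul_comm]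
  lie_adMono k m hm hT hk hkm := by
    rw [lie_smul, (hw k hk).2.2.2.2 m hkm, smul_smul, smul_smul, adCoeff_parity, mul_comm,
      hcτ _ _ (parity_ne_zero hm) hT, parity_add, add_comm (parity k) (parity m)]
  adCoeff_eq_zero k m hm hT hT' := by
    have h := hcτ _ _ (parity_ne_zero hm) hT
    have : c (parity m) (parity k) = 0 := by
      by_contra hn
      have := (hc.supp _ _ hn).2
      rw [add_comm, ← parity_add] at this
      exact hT' this
    rw [this, zero_mul, eq_comm] at h
    rw [adCoeff_parity]
    exact (mul_eq_zero.mp h).resolve_right (hτ _)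

theorem exists_adSign_ne_zero {m : ℤ × ℤ} (hm : ¬ InTwo m) : ∃ l, adSign (m - l) l ≠ 0 := by
  by_cases h : Even m.2
  · have h' : ¬ Even m.1 := fun e => hm ⟨e, h⟩
    refine ⟨(0, 1), ?_⟩
    rw [adSign]
    simp [(Int.not_even_iff_odd.mp h').neg_one_zpow]
  · refine ⟨(1, 0), ?_⟩
    rw [adSign]
    simp [(Int.not_even_iff_odd.mp h).neg_one_zpow]
    norm_num

theorem inner_lie_eq_zero_of_adMono {x : V} (h : ∀ m, ⁅adMono m, x⁆ = 0) (u : QTorus (-1)) :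
    ⁅(innerDer u : DerCq), x⁆ = 0 := by
  induction u using induct with
  | h0 => rw [map_zero, zero_lie]
  | hadd u u' hu hu' => rw [map_add, add_lie, hu, hu', add_zero]
  | hmono c m =>
    have := h m
    rw [adMono] at this
    rw [map_smul, smul_lie, this, smul_zero]

theorem lie_innerDer (d : DerCq) (u : QTorus (-1)) :
    (⁅d, innerDer u⁆ : DerCq) = innerDer (d.1 u) := by
  apply Subtype.ext
  apply LinearMap.ext
  intro x
  rw [lie_der_apply, innerDer_apply, innerDer_apply, innerDer_apply, map_sub, derivation_mul,
    derivation_mul]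
  abel

/-- The vectors killed by all inner derivations. -/
def adInvariants (V : Type*) [AddCommGroup V] [Module ℂ V] [LieRingModule DerCq V]
    [LieModule ℂ DerCq V] : LieSubmodule ℂ DerCq V where
  carrier := {x | ∀ u : QTorus (-1), ⁅(innerDer u : DerCq), x⁆ = 0}
  add_mem' hx hy u := by rw [lie_add, hx u, hy u, add_zero]
  zero_mem' u := lie_zero _
  smul_mem' c x hx u := by rw [lie_smul, hx u, smul_zero]
  lie_mem := by
    intro d x hx u
    have h1 := hx (d.1 u)
    rw [← lie_innerDer, lie_lie, hx u, lie_zero, zero_sub, neg_eq_zero] at h1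
    exact h1

/-- The inner derivations form an ideal, so the vectors they kill form a submodule; a single nonzero
such vector makes it everything. -/
theorem inner_lie_eq_zero (hirr : LieModule.IsIrreducible ℂ DerCq V) {x : V} (hx : x ≠ 0)
    (h : ∀ m, ⁅adMono m, x⁆ = 0) (u : QTorus (-1)) (y : V) : ⁅(innerDer u : DerCq), y⁆ = 0 := by
  rcases hirr.eq_bot_or_eq_top (adInvariants V) with hN | hN
  · exfalso
    have : x ∈ adInvariants V := inner_lie_eq_zero_of_adMono h
    rw [hN, LieSubmodule.mem_bot] at this
    exact hx this
  · have : y ∈ adInvariants V := by rw [hN]; exact LieSubmodule.mem_top _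
    exact this u

/-- A weight vector that is killed by all `adMono m` with a target of nonzero weight is killed by
all the `adMono m`. -/
theorem adMono_lie_eq_zero {lam : ℂ × ℂ} {k : ℤ × ℤ} {x : V}
    (h : ∀ m, latWt lam (k + m) ≠ 0 → ⁅adMono m, x⁆ = 0) (m : ℤ × ℤ) : ⁅adMono m, x⁆ = 0 := by
  by_cases h0 : latWt lam (k + m) = 0
  swap
  · exact h m h0
  by_cases hm : InTwo m
  · obtain ⟨p, rfl⟩ := exists_add_self hm
    rw [adMono_even, zero_lie]
  -- The unique degree m leading to weight 0 is a multiple of a bracket of degrees m - l and l, both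
  -- different from m, hence already known to kill x.
  obtain ⟨l, hl⟩ := exists_adSign_ne_zero hm
  have ne : ∀ n, n ≠ m → latWt lam (k + n) ≠ 0 := fun n hn h1 =>
    hn (add_left_cancel (latWt_injective lam (h1.trans h0.symm)))
  have h1 : ⁅adMono l, x⁆ = 0 := by
    refine h l (ne l ?_)
    rintro rfl
    apply hl
    simp [adSign]
  have h2 : ⁅adMono (m - l), x⁆ = 0 := by
    refine h _ (ne _ ?_)
    intro h2
    rw [sub_eq_self] at h2
    apply hl
    simp [adSign, h2]
  have h3 : ⁅(⁅adMono (m - l), adMono l⁆ : DerCq), x⁆ = 0 := by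
    rw [lie_lie, h1, h2, lie_zero, lie_zero, sub_zero]
  rw [lie_adMono_adMono, sub_add_cancel, smul_lie] at h3
  exact (smul_eq_zero.mp h3).resolve_left hl

/-- A module without nonzero weights is the trivial module. -/
theorem isSubquotient_of_weightSpace_zero (hirr : LieModule.IsIrreducible ℂ DerCq V)
    (hV : IsIntermediateSeries V) (h : ∀ lam ≠ 0, weightSpace V lam = ⊥) :
    IsSubquotient V (ModA 1 0 0) ∧
      ∀ (u : QTorus (-1)) (x : V), ⁅(innerDer u : DerCq), x⁆ = 0 := by
  have hall : ∀ x : V, x ∈ weightSpace V 0 := by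
    intro x
    have h1 : (⨆ lam, weightSpace V lam) ≤ weightSpace V 0 := by
      apply iSup_le
      intro lam
      by_cases h0 : lam = 0
      · rw [h0]
      · rw [h lam h0]; exact bot_le
    rw [hV.isInternal.submodule_iSup_eq_top] at h1
    exact h1 Submodule.mem_top
  have hgr : ∀ d ≠ 0, ∀ X ∈ derGrade d, ∀ x : V, ⁅X, x⁆ = 0 := by
    intro d hd X hX x
    have h1 := lie_mem_weightSpace hX (hall x)
    rw [zero_add, h _ (fun h => hd (toC_eq_zero.mp h))] at h1
    exact (Submodule.mem_bot ℂ).mp h1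
  have had : ∀ m, ∀ x : V, ⁅adMono m, x⁆ = 0 := by
    intro m x
    by_cases hm : m = 0
    · have := adMono_even 0
      rw [add_zero] at this
      rw [hm, this, zero_lie]
    · exact hgr m hm _ (adMono_mem m) x
  have hev : ∀ p a, ∀ x : V, ⁅evenDer p a, x⁆ = 0 := by
    intro p a x
    by_cases hp : p = 0
    · rw [hp, mem_weightSpace.mp (hall x) a, pairing_zero_right, zero_smul]
    · exact hgr _ (fun h => hp (add_self_eq_zero_iff.mp h)) _ (evenDer_mem p a) x
  have hzero : ∀ (d : DerCq) (x : V), ⁅d, x⁆ = 0 := by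
    intro d x
    exact der_span (LinearMap.ker ((LieModule.toEnd ℂ DerCq V : DerCq →ₗ[ℂ] Module.End ℂ V).flip x))
      (fun m => had m x) (fun p a => hev p a x) d
  refine ⟨?_, fun u x => hzero _ x⟩
  have hv : ∀ d : DerCq, ⁅d, ModA.v 1 0 0 0⁆ = 0 := by
    intro d
    refine der_span (LinearMap.ker ((LieModule.toEnd ℂ DerCq (ModA 1 0 0) :
      DerCq →ₗ[ℂ] Module.End ℂ (ModA 1 0 0)).flip (ModA.v 1 0 0 0))) (fun m => ?_)
      (fun p a => ?_) d
    · change ⁅adMono m, ModA.v 1 0 0 0⁆ = 0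
      by_cases hm : InTwo m
      · obtain ⟨p, rfl⟩ := exists_add_self hm
        rw [adMono_even, zero_lie]
      · rw [ModA.lie_adMono_v hm]; simp
    · change ⁅evenDer p a, ModA.v 1 0 0 0⁆ = 0
      rw [ModA.lie_evenDer_v]; simp
  have hn : Nontrivial (LieSubmodule ℂ DerCq V) := hirr.toNontrivial
  rw [LieSubmodule.nontrivial_iff] at hn
  obtain ⟨x₀, hx₀⟩ := exists_ne (0 : V)
  -- In A_{1,0,0} the vector v_0 is killed by everything. This line is the graph of the map from ℂ
  -- v_0 to V taking v_0 to x₀.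
  let R : LieSubmodule ℂ DerCq (V × ModA 1 0 0) :=
    { Submodule.span ℂ {(x₀, ModA.v 1 0 0 0)} with
      lie_mem := by
        intro d y hy
        obtain ⟨c, rfl⟩ := Submodule.mem_span_singleton.mp hy
        rw [lie_smul, lie_prod, hzero, hv, Prod.mk_zero_zero, smul_zero]
        exact Submodule.zero_mem (Submodule.span ℂ {(x₀, (ModA.v 1 0 0 0 : ModA 1 0 0))}) }
  have hR : ∀ z, z ∈ R ↔ ∃ c : ℂ, c • (x₀, (ModA.v 1 0 0 0 : ModA 1 0 0)) = z := fun z =>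
    Submodule.mem_span_singleton
  have hspan : ∀ x : V, ∃ c : ℂ, c • x₀ = x := by
    let K : LieSubmodule ℂ DerCq V :=
      { Submodule.span ℂ {x₀} with
        lie_mem := by
          intro d y _
          rw [hzero]
          exact zero_mem (Submodule.span ℂ {x₀}) }
    have hx₀K : x₀ ∈ K := Submodule.mem_span_singleton_self x₀
    rcases hirr.eq_bot_or_eq_top K with hK | hK
    · rw [hK, LieSubmodule.mem_bot] at hx₀K
      exact absurd hx₀K hx₀
    · intro x
      have : x ∈ K := by rw [hK]; exact LieSubmodule.mem_top _
      exact Submodule.mem_span_singleton.mp this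
  obtain ⟨Q, φ, hφ, _⟩ := exists_hom_of_correspondence R
    (by
      intro x hx
      obtain ⟨c, hc⟩ := (hR _).mp hx
      have h1 := congrArg (fun z => ModA.coord 0 z.2) hc
      change ModA.coord 0 (c • ModA.v 1 0 0 0) = ModA.coord 0 0 at h1
      rw [map_smul, ModA.coord_v_self, map_zero, smul_eq_mul, mul_one] at h1
      have h2 := congrArg Prod.fst hc
      change c • x₀ = x at h2
      rw [← h2, h1, zero_smul])
    (by
      intro x
      obtain ⟨c, rfl⟩ := hspan x
      exact ⟨c • ModA.v 1 0 0 0, (hR _).mpr ⟨c, rfl⟩⟩)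
  exact isSubquotient_of_surjective φ hφ

end

theorem theorem2p3 (V : Type*) [AddCommGroup V] [Module ℂ V] [LieRingModule DerCq V]
    [LieModule ℂ DerCq V] (hirr : LieModule.IsIrreducible ℂ DerCq V)
    (hV : IsIntermediateSeries V) :
    (∃ (a : Fin 2) (α : ℂ × ℂ) (b : ℂ), IsSubquotient V (ModA a α b)) ∧
    ((∃ (α : ℂ × ℂ) (b : ℂ), Nonempty (V ≃ₗ⁅ℂ, DerCq⁆ ModA 0 α b)) ∨
      (∃ (α : ℂ × ℂ) (b : ℂ), Nonempty (V ≃ₗ⁅ℂ, DerCq⁆ ModA.prime α b)) ∨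
      (∀ u ∈ commutatorSpan (QTorus (-1)), ∀ x : V, ⁅(innerDer u : DerCq), x⁆ = 0)) := by
  classical
  by_cases hlam : ∃ lam ≠ 0, weightSpace V lam ≠ ⊥
  swap
  · push Not at hlam
    obtain ⟨h1, h2⟩ := isSubquotient_of_weightSpace_zero hirr hV hlam
    exact ⟨⟨1, 0, 0, h1⟩, Or.inr (Or.inr fun u _ x => h2 u x)⟩
  obtain ⟨lam, hlam0, hlam⟩ := hlam
  obtain ⟨T, β, c, w, hc, hw⟩ := exists_classConstants_basis hirr hV lam
  have hl0 : latWt lam 0 ≠ 0 := by rwa [latWt, toC_zero, add_zero]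
  have hT0 : T (parity 0) := by
    by_contra h
    apply hlam
    have := (hw 0 hl0).2.2.1 h
    rwa [latWt, toC_zero, add_zero] at this
  have hT : ∃ k, latWt lam k ≠ 0 ∧ T (parity k) := ⟨0, hl0, hT0⟩
  by_cases hz : ∀ i j, c i j = 0
  · have hTj : ∀ j, T j → j = 0 := fun j hj => hc.eq_of_trivial hz hT0 hj
    have p0 : parity 0 = 0 := rfl
    constructor
    -- Only the class of 0 occurs, and for a = 1 the inner derivations kill every v_k with k even;
    -- so A_1 contains a model with trivial inner action.
    · have hb := isModelBasis_smul (a := 1) (s := 0) hc hw (τ := fun _ => 1)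
        (fun _ => one_ne_zero) (by
          intro i j hi hj
          have e : ∀ i, classSign i 0 - classSign 0 i = 0 := by decide
          have e' : (classSign i 0 : ℂ) - classSign 0 i = 0 := by exact_mod_cast e i
          rw [hz, hTj j hj, p0, add_zero]
          simp [e'])
      obtain ⟨Q, φ, hφ, _⟩ := hb.exists_hom hirr hV hT (LieModuleHom.id) Function.injective_id
        (fun k => if T (parity k) then ModA.v 1 (latWt lam 0) β (k - 0) else 0) (fun k => rfl)
      exact ⟨1, _, _, isSubquotient_of_surjective φ hφ⟩
    · right; right
      intro u _ x
      refine inner_lie_eq_zero hirr ((hw 0 hl0).2.1.mpr hT0)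
        (adMono_lie_eq_zero (lam := lam) (k := 0) fun m hm => ?_) u x
      rw [(hw 0 hl0).2.2.2.2 m hm, hz, zero_smul]
  push Not at hz
  by_cases hTall : ∀ j, T j
  · obtain ⟨τ, hτ, hcτ⟩ := hc.exists_gauge hTall hz
    have p0 : parity 0 = 0 := rfl
    have hb := isModelBasis_smul (a := 0) (s := 0) hc hw hτ (by
      intro i j hi _
      rw [hcτ i j hi, p0, zero_add]
      simp)
    have hne : ∀ m k, adCoeff 0 0 m k ≠ 0 := by
      intro m k
      rw [adCoeff]
      simp only [Fin.val_zero, Nat.cast_zero, zero_mul, sub_zero]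
      exact zpow_ne_zero _ (by norm_num)
    have h10 : ¬ InTwo (1, 0) := fun h => by simpa using h.1
    obtain ⟨φ, hφ⟩ := hb.exists_bijective hirr hV hT (LieModuleHom.id) Function.injective_id
      (fun k => ModA.v 0 (latWt lam 0) β (k - 0)) (fun k => by rw [if_pos (hTall _)]; rfl)
      (fun y k hk => absurd (hTall _) hk) (fun k _ => ⟨(1, 0), h10, hTall _, hne _ _⟩)
      (fun k _ => ⟨(1, 0), h10, hTall _, hne _ _⟩)
    refine ⟨⟨0, latWt lam 0, β, ?_⟩, Or.inl ⟨_, _, nonempty_equiv_of_bijective φ hφ⟩⟩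
    refine isSubquotient_of_surjective (φ.comp (⊤ : LieSubmodule ℂ DerCq _).incl) ?_
    intro x
    obtain ⟨y, hy⟩ := hφ.2 x
    exact ⟨⟨y, LieSubmodule.mem_top _⟩, hy⟩
  · push Not at hTall
    obtain ⟨t, ht⟩ := hTall
    obtain ⟨hTt, τ, hτ, hcτ⟩ := hc.exists_gauge_of_missing ht hz
    -- A'_1 lacks the class 0 while V lacks the class t; translating indices by a representative s
    -- of t, and replacing α by `latWt lam s`, lines the two up.
    obtain ⟨s, rfl⟩ := exists_parity_eq t
    have hb := isModelBasis_smul (a := 1) (s := s) hc hw hτ (by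
      intro i j hi _
      rw [hcτ i j hi, classBracket]
      simp)
    have hTs : ∀ k, T (parity k) ↔ ¬ InTwo (k - s) := by
      intro k
      rw [hTt, ← parity_eq_zero, parity_sub, not_iff_not]
      have : ∀ i j : ZMod 2 × ZMod 2, i = j ↔ i + j = 0 := by decide
      exact this _ _
    have hcl : ∀ k, T (parity k) → ∃ m, ¬ InTwo m ∧ T (parity (k + m)) ∧ T (parity (k - m)) ∧
        adCoeff 1 s m k ≠ 0 ∧ adCoeff 1 s m (k - m) ≠ 0 := by
      intro k hk
      have e : ∀ s j : ZMod 2 × ZMod 2, j ≠ s → ∃ i, i ≠ 0 ∧ j + i ≠ s ∧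
          classSign i (s + j) - classSign (s + j) i ≠ 0 ∧
          classSign i (s + (j + i)) - classSign (s + (j + i)) i ≠ 0 := by decide
      obtain ⟨i, h1, h2, h3, h4⟩ := e (parity s) (parity k) ((hTt _).mp hk)
      obtain ⟨m, rfl⟩ := exists_parity_eq i
      refine ⟨m, fun h => h1 (parity_eq_zero.mpr h), ?_, ?_, ?_, ?_⟩
      · rwa [hTt, parity_add]
      · rwa [hTt, parity_sub]
      · rw [adCoeff_parity]
        simpa [sub_eq_zero] using h3
      · rw [adCoeff_parity, parity_sub]
        simpa [sub_eq_zero] using h4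
    have hmem : ∀ k, T (parity k) →
        ModA.v 1 (latWt lam s) β (k - s) ∈ ModA.prime (latWt lam s) β := fun k hk =>
      Submodule.subset_span ⟨k - s, (hTs k).mp hk, rfl⟩
    obtain ⟨φ, hφ⟩ := hb.exists_bijective hirr hV hT (ModA.prime (latWt lam s) β).incl
      Subtype.val_injective
      (fun k => if h : T (parity k) then ⟨ModA.v 1 (latWt lam s) β (k - s), hmem k h⟩ else 0)
      (fun k => by split_ifs <;> rfl)
      (by
        rintro ⟨y, hy⟩ k hk
        rw [hTs, not_not] at hk
        change ModA.coord (k - s) y = 0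
        have hle : Submodule.span ℂ {y | ∃ k : ℤ × ℤ, ¬ InTwo k ∧
            y = ModA.v 1 (latWt lam s) β k} ≤ LinearMap.ker (ModA.coord (k - s)) := by
          rw [Submodule.span_le]
          rintro _ ⟨l, hl, rfl⟩
          change ModA.coord (k - s) _ = 0
          rw [ModA.coord_v, if_neg]
          rintro rfl
          exact hl hk
        exact hle hy)
      (fun k hk => by
        obtain ⟨m, h1, h2, _, h4, _⟩ := hcl k hk
        exact ⟨m, h1, h2, h4⟩)
      (fun k hk => by
        obtain ⟨m, h1, _, h3, _, h5⟩ := hcl k hk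
        exact ⟨m, h1, h3, h5⟩)
    exact ⟨⟨1, _, _, isSubquotient_of_surjective φ hφ.2⟩,
      Or.inr (Or.inl ⟨_, _, nonempty_equiv_of_bijective φ hφ⟩)⟩
end
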